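/- Let $\Omega\subset\mathbb R^3$ be a simply connected bounded domain with smooth boundary and unit outward normal $n$, and let $\mu>0$, $2\mu+3\lambda\ge 0$, $\gamma>1$. Consider the compressible isentropic magnetohydrodynamic system $$ \begin{cases} \rho_t+\operatorname{div}(\rho u)=0,\\ (\rho u)_t+\operatorname{div}(\rho u\otimes u)+\nabla \rho^\gamma-\mu\Delta u-(\mu+\lambda)\nabla\operatorname{div}u=(\nabla\times H)\times H,\\ H_t-\nabla\times(u\times H)=-\nabla\times(\nabla\times H),\\ \operatorname{div}H=0 \end{cases} $$ in $\Omega$, with initial data $\rho(\cdot,0)=\rho_0$, $(\rho u)(\cdot,0)=\rho_0u_0$, $H(\cdot,0)=H_0$ and, for $t>0$, the slip boundary conditions $$u\cdot n=0,\quad \operatorname{curl}u\times n=0,\quad H\cdot n=0,\quad \operatorname{curl}H\times n=0\qquad\text{on }\partial\Omega .$$ For $T>0$, $(\rho,u,H)$ is a strong solution of this problem on $\Omega\times[0,T]$ if it satisfies the system a.e. in $\Omega\times[0,T]$, together with the initial and boundary conditions, and if, for some $q\in(3,6]$, $$ \begin{cases} 0\le\rho\in C([0,T];W^{1,q}(\Omega)),\quad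 \rho_t\in C([0,T];L^q(\Omega)),\\ (u,H)\in C([0,T];H^2(\Omega))\cap L^2(0,T;W^{2,q}(\Omega)),\\ (\sqrt\rho\,u_t,H_t)\in L^\infty(0,T;L^2(\Omega)),\quad (u_t,H_t)\in L^2(0,T;H^1(\Omega)). \end{cases} $$ It is a global strong solution if it is a strong solution on $\Omega\times[0,T]$ for every $T>0$. Suppose that $\rho_0\ge0$ and, with $\bar\rho_0=\frac1{|\Omega|}\int_\Omega\rho_0\,dx$, $$\|\rho_0-\bar\rho_0\|_{L^2(\Omega)}+\|\sqrt{\rho_0}\,u_0\|_{L^2(\Omega)}+\|\nabla u_0\|_{H^1(\Omega)}+\|\nabla H_0\|_{H^1(\Omega)}<\infty .$$ Let $(\rho,u,H)$ be a global strong solution such that $\sup_{t\ge0}\|\rho(\cdot,t)\|_{L^\infty(\Omega)}\le\hat\rho$ for some constant $\hat\rho>0$. If $\inf_{x\in\Omega}\rho_0(x)=0$, then $$\inf_{x\in\Omega}\rho(x,t)=0\qquad\text{for every }t\ge0 .$$ Here the infimum of a Lebesgue class of functions is its essential infimum, which for $\rho(\cdot,t)\in W^{1,q}(\Omega)$, $q>3$,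 is the infimum of its continuous representative. -/

import Mathlib

open MeasureTheory Set Filter Topology
open scoped ENNReal ContDiff

noncomputable section

namespace MHD

/-- Three-dimensional Euclidean space. -/
abbrev E3 : Type := EuclideanSpace ℝ (Fin 3)

/-- The vector product on `E3`. -/
def cross (a b : E3) : E3 := WithLp.toLp 2 (crossProduct a.ofLp b.ofLp)

/-! ### Weak derivatives and Sobolev spaces on an open set -/

/-- The `i`-th classical partial derivative of a real function on `E3`. -/
def partialDeriv (i : Fin 3) (φ : E3 → ℝ) (x : E3) : ℝ :=
  fderiv ℝ φ x (EuclideanSpace.single i 1)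

/-- `g` is the weak (distributional) partial derivative `∂ᵢ f` in `Ω`. -/
def HasWeakPartial (Ω : Set E3) (i : Fin 3) (f g : E3 → ℝ) : Prop :=
  LocallyIntegrableOn f Ω ∧ LocallyIntegrableOn g Ω ∧
    ∀ φ : E3 → ℝ, ContDiff ℝ ∞ φ → HasCompactSupport φ → tsupport φ ⊆ Ω →
      ∫ x in Ω, f x * partialDeriv i φ x = -∫ x in Ω, g x * φ x

open Classical in
/-- A representative of the weak partial derivative `∂ᵢ f` in `Ω` (unique up to null sets when it
exists; `0` when it does not exist). -/
def weakPartial (Ω : Set E3) (i : Fin 3) (f : E3 → ℝ) : E3 → ℝ :=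
  if h : ∃ g, HasWeakPartial Ω i f g then h.choose else 0

/-- The Sobolev space `W^{k,p}(Ω)`: `f` and its weak derivatives up to order `k` exist and are
in `L^p(Ω)`. For `k = 0` this is `L^p(Ω)`. -/
def MemSobolev : ℕ → ℝ≥0∞ → Set E3 → (E3 → ℝ) → Prop
  | 0, p, Ω, f => MemLp f p (volume.restrict Ω)
  | k + 1, p, Ω, f => MemLp f p (volume.restrict Ω) ∧
      ∀ i, (∃ g, HasWeakPartial Ω i f g) ∧ MemSobolev k p Ω (weakPartial Ω i f)

/-- The norm of `W^{k,p}(Ω)` (sum of the `L^p` norms of the iterated weak derivatives of order at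
most `k`), meaningful for members of `W^{k,p}(Ω)`. -/
def sobolevENorm : ℕ → ℝ≥0∞ → Set E3 → (E3 → ℝ) → ℝ≥0∞
  | 0, p, Ω, f => eLpNorm f p (volume.restrict Ω)
  | k + 1, p, Ω, f => eLpNorm f p (volume.restrict Ω) +
      ∑ i, sobolevENorm k p Ω (weakPartial Ω i f)

/-- Weak divergence of a vector field. -/
def weakDiv (Ω : Set E3) (F : E3 → E3) (x : E3) : ℝ :=
  ∑ j, weakPartial Ω j (fun y => F y j) x

/-- Weak curl of a vector field. -/
def weakCurl (Ω : Set E3) (F : E3 → E3) (x : E3) : E3 :=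
  !₂[weakPartial Ω 1 (fun y => F y 2) x - weakPartial Ω 2 (fun y => F y 1) x,
     weakPartial Ω 2 (fun y => F y 0) x - weakPartial Ω 0 (fun y => F y 2) x,
     weakPartial Ω 0 (fun y => F y 1) x - weakPartial Ω 1 (fun y => F y 0) x]

/-- Weak Laplacian of a scalar function. -/
def weakLaplacian (Ω : Set E3) (f : E3 → ℝ) (x : E3) : ℝ :=
  ∑ j, weakPartial Ω j (weakPartial Ω j f) x

/-- The infimum over `Ω` of a Lebesgue class of functions, i.e. the essential infimum. For a
function that is continuous on the open set `Ω` it is the pointwise infimum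
(`infOver_eq_sInf_image`). -/
def infOver (Ω : Set E3) (f : E3 → ℝ) : ℝ := essInf f (volume.restrict Ω)

/-! ### Functions of time with values in Sobolev spaces -/

/-- `f ∈ C([0,T]; W^{k,p}(Ω))`. -/
def ContinuousInSobolev (k : ℕ) (p : ℝ≥0∞) (Ω : Set E3) (T : ℝ) (f : ℝ → E3 → ℝ) : Prop :=
  (∀ t ∈ Icc 0 T, MemSobolev k p Ω (f t)) ∧
    ∀ t ∈ Icc 0 T, Tendsto (fun s => sobolevENorm k p Ω (f s - f t)) (𝓝[Icc 0 T] t) (𝓝 0)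

/-- `f ∈ L²(0,T; W^{k,p}(Ω))`. -/
def SqIntegrableInSobolev (k : ℕ) (p : ℝ≥0∞) (Ω : Set E3) (T : ℝ) (f : ℝ → E3 → ℝ) : Prop :=
  (∀ᵐ t ∂volume.restrict (Ioo 0 T), MemSobolev k p Ω (f t)) ∧
    ∫⁻ t in Ioo 0 T, sobolevENorm k p Ω (f t) ^ 2 < ⊤

/-- `f ∈ L^∞(0,T; L²(Ω))`. -/
def EssBoundedInL2 (Ω : Set E3) (T : ℝ) (f : ℝ → E3 → ℝ) : Prop :=
  ∃ M : ℝ, ∀ᵐ t ∂volume.restrict (Ioo 0 T), MemLp (f t) 2 (volume.restrict Ω) ∧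
    eLpNorm (f t) 2 (volume.restrict Ω) ≤ ENNReal.ofReal M

/-- `g` is the weak (distributional) time derivative of `f` in `(0,T) × Ω`. -/
def HasWeakTimeDeriv (Ω : Set E3) (T : ℝ) (f g : ℝ → E3 → ℝ) : Prop :=
  LocallyIntegrableOn (fun z : ℝ × E3 => f z.1 z.2) (Ioo 0 T ×ˢ Ω) ∧
  LocallyIntegrableOn (fun z : ℝ × E3 => g z.1 z.2) (Ioo 0 T ×ˢ Ω) ∧
    ∀ φ : ℝ × E3 → ℝ, ContDiff ℝ ∞ φ → HasCompactSupport φ → tsupport φ ⊆ Ioo 0 T ×ˢ Ω →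
      ∫ z in Ioo 0 T ×ˢ Ω, f z.1 z.2 * fderiv ℝ φ z (1, 0) =
        -∫ z in Ioo 0 T ×ˢ Ω, g z.1 z.2 * φ z

/-! ### Smooth domains, normals, boundary values -/

/-- `φ` is a smooth local defining function of `Ω` at `x`: near `x`, `Ω` is `{φ < 0}`, and the
gradient of `φ` at `x` does not vanish. -/
def IsDefiningFunctionAt (Ω : Set E3) (x : E3) (φ : E3 → ℝ) : Prop :=
  ContDiff ℝ ∞ φ ∧ gradient φ x ≠ 0 ∧ ∀ᶠ y in 𝓝 x, y ∈ Ω ↔ φ y < 0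

/-- A simply connected bounded domain of `ℝ³` with smooth boundary. -/
structure IsSmoothSimplyConnectedDomain (Ω : Set E3) : Prop where
  isOpen : IsOpen Ω
  isBounded : Bornology.IsBounded Ω
  isSimplyConnected : IsSimplyConnected Ω
  smooth_boundary : ∀ x ∈ frontier Ω, ∃ φ, IsDefiningFunctionAt Ω x φ

/-- `n` is the unit outward normal vector to `∂Ω` at `x`. -/
def IsOuterUnitNormal (Ω : Set E3) (x n : E3) : Prop :=
  ∃ φ, IsDefiningFunctionAt Ω x φ ∧ n = ‖gradient φ x‖⁻¹ • gradient φ x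

/-- `v` is the boundary value (trace) at `x ∈ ∂Ω` of the field `F` on `Ω`: the averages of
`|F - v|` over `Ω ∩ B(x,r)` tend to `0` as `r → 0⁺`. For `F ∈ W^{1,1}(Ω)` this gives the Sobolev
trace at almost every boundary point; for `F` continuous up to the boundary, it gives the value of
the continuous extension at every boundary point. -/
def HasBoundaryValue (Ω : Set E3) (F : E3 → E3) (x v : E3) : Prop :=
  Tendsto (fun r : ℝ => laverage (volume.restrict (Metric.ball x r ∩ Ω)) (fun y => ‖F y - v‖ₑ))
    (𝓝[>] 0) (𝓝 0)

/-- `F · n = 0` on `∂Ω`, at every boundary point (for `F ∈ H²(Ω) ⊂ C(closure Ω)`). -/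
def NormalComponentVanishes (Ω : Set E3) (F : E3 → E3) : Prop :=
  ∀ x ∈ frontier Ω, ∃ v, HasBoundaryValue Ω F x v ∧
    ∀ n, IsOuterUnitNormal Ω x n → inner ℝ v n = 0

/-- `F × n = 0` on `∂Ω` in the sense of traces, i.e. almost everywhere for the surface measure
(for `F ∈ H¹(Ω)`). -/
def TangentialComponentVanishes (Ω : Set E3) (F : E3 → E3) : Prop :=
  ∀ᵐ x ∂(Measure.hausdorffMeasure 2 : Measure E3).restrict (frontier Ω),
    ∃ v, HasBoundaryValue Ω F x v ∧ ∀ n, IsOuterUnitNormal Ω x n → cross v n = 0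

/-! ### Strong solutions -/

/-- `(ρ, u, H)` is a strong solution on `Ω × [0,T]` of the isentropic compressible
magnetohydrodynamic system with `P = ρ^γ` and unit resistivity, with slip boundary conditions and
initial data `(ρ₀, ρ₀u₀, H₀)`. Here `q` is the integrability exponent, and `ρt`, `ut`, `Ht`, `mt`
are the weak time derivatives of `ρ`, `u`, `H`, `ρu`. "Almost everywhere in `Ω × [0,T]`" is read as
"for a.e. `t`, for a.e. `x`". -/
structure IsStrongSolutionWith (Ω : Set E3) (mu lam γ T : ℝ)
    (ρ₀ : E3 → ℝ) (u₀ H₀ : E3 → E3) (ρ : ℝ → E3 → ℝ) (u H : ℝ → E3 → E3)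
    (q : ℝ≥0∞) (ρt : ℝ → E3 → ℝ) (ut Ht mt : ℝ → E3 → E3) : Prop where
  q_gt : 3 < q
  q_le : q ≤ 6
  rho_nonneg : ∀ t ∈ Icc 0 T, ∀ᵐ x ∂volume.restrict Ω, 0 ≤ ρ t x
  rho_cont : ContinuousInSobolev 1 q Ω T ρ
  rho_timeDeriv : HasWeakTimeDeriv Ω T ρ ρt
  rhot_cont : ContinuousInSobolev 0 q Ω T ρt
  u_cont : ∀ i, ContinuousInSobolev 2 2 Ω T (fun t x => u t x i)
  H_cont : ∀ i, ContinuousInSobolev 2 2 Ω T (fun t x => H t x i)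
  u_sq : ∀ i, SqIntegrableInSobolev 2 q Ω T (fun t x => u t x i)
  H_sq : ∀ i, SqIntegrableInSobolev 2 q Ω T (fun t x => H t x i)
  u_timeDeriv : ∀ i, HasWeakTimeDeriv Ω T (fun t x => u t x i) (fun t x => ut t x i)
  H_timeDeriv : ∀ i, HasWeakTimeDeriv Ω T (fun t x => H t x i) (fun t x => Ht t x i)
  sqrt_rho_ut_bdd : ∀ i, EssBoundedInL2 Ω T (fun t x => √(ρ t x) * ut t x i)
  Ht_bdd : ∀ i, EssBoundedInL2 Ω T (fun t x => Ht t x i)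
  ut_sq : ∀ i, SqIntegrableInSobolev 1 2 Ω T (fun t x => ut t x i)
  Ht_sq : ∀ i, SqIntegrableInSobolev 1 2 Ω T (fun t x => Ht t x i)
  momentum_timeDeriv : ∀ i,
    HasWeakTimeDeriv Ω T (fun t x => ρ t x * u t x i) (fun t x => mt t x i)
  /-- `ρ_t + div (ρ u) = 0` -/
  mass_eq : ∀ᵐ t ∂volume.restrict (Ioo 0 T), ∀ᵐ x ∂volume.restrict Ω,
    ρt t x + weakDiv Ω (fun y => ρ t y • u t y) x = 0
  /-- `(ρ u)_t + div (ρ u ⊗ u) + ∇P - μ Δu - (μ + λ) ∇ div u = (∇ × H) × H` -/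
  momentum_eq : ∀ᵐ t ∂volume.restrict (Ioo 0 T), ∀ᵐ x ∂volume.restrict Ω, ∀ i,
    mt t x i + ∑ j, weakPartial Ω j (fun y => ρ t y * u t y i * u t y j) x
      + weakPartial Ω i (fun y => ρ t y ^ γ) x
      - mu * weakLaplacian Ω (fun y => u t y i) x
      - (mu + lam) * weakPartial Ω i (weakDiv Ω (u t)) x
    = cross (weakCurl Ω (H t) x) (H t x) i
  /-- `H_t - ∇ × (u × H) = -∇ × (∇ × H)` -/
  magnetic_eq : ∀ᵐ t ∂volume.restrict (Ioo 0 T), ∀ᵐ x ∂volume.restrict Ω,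
    Ht t x - weakCurl Ω (fun y => cross (u t y) (H t y)) x = -weakCurl Ω (weakCurl Ω (H t)) x
  /-- `div H = 0` -/
  div_H : ∀ᵐ t ∂volume.restrict (Ioo 0 T), ∀ᵐ x ∂volume.restrict Ω, weakDiv Ω (H t) x = 0
  u_normal : ∀ t ∈ Ioc 0 T, NormalComponentVanishes Ω (u t)
  curl_u_tangential : ∀ t ∈ Ioc 0 T, TangentialComponentVanishes Ω (weakCurl Ω (u t))
  H_normal : ∀ t ∈ Ioc 0 T, NormalComponentVanishes Ω (H t)
  curl_H_tangential : ∀ t ∈ Ioc 0 T, TangentialComponentVanishes Ω (weakCurl Ω (H t))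
  rho_init : ∀ᵐ x ∂volume.restrict Ω, ρ 0 x = ρ₀ x
  momentum_init : ∀ᵐ x ∂volume.restrict Ω, ρ 0 x • u 0 x = ρ₀ x • u₀ x
  H_init : ∀ᵐ x ∂volume.restrict Ω, H 0 x = H₀ x

/-- Strong solution on `Ω × [0,T]`, for some exponent `q ∈ (3,6]`. -/
def IsStrongSolutionOn (Ω : Set E3) (mu lam γ T : ℝ)
    (ρ₀ : E3 → ℝ) (u₀ H₀ : E3 → E3) (ρ : ℝ → E3 → ℝ) (u H : ℝ → E3 → E3) : Prop :=
  ∃ (q : ℝ≥0∞) (ρt : ℝ → E3 → ℝ) (ut Ht mt : ℝ → E3 → E3),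
    IsStrongSolutionWith Ω mu lam γ T ρ₀ u₀ H₀ ρ u H q ρt ut Ht mt

/-- Global strong solution: a strong solution on `Ω × [0,T]` for every `T > 0`. -/
def IsGlobalStrongSolution (Ω : Set E3) (mu lam γ : ℝ)
    (ρ₀ : E3 → ℝ) (u₀ H₀ : E3 → E3) (ρ : ℝ → E3 → ℝ) (u H : ℝ → E3 → E3) : Prop :=
  ∀ T : ℝ, 0 < T → IsStrongSolutionOn Ω mu lam γ T ρ₀ u₀ H₀ ρ u H

/-- The assumptions on the initial data: `ρ₀ ≥ 0` and
`‖ρ₀ - ρ̄₀‖_{L²} + ‖√ρ₀ u₀‖_{L²} + ‖∇u₀‖_{H¹} + ‖∇H₀‖_{H¹} < ∞`. -/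
structure IsAdmissibleInitialData (Ω : Set E3) (ρ₀ : E3 → ℝ) (u₀ H₀ : E3 → E3) : Prop where
  nonneg : ∀ᵐ x ∂volume.restrict Ω, 0 ≤ ρ₀ x
  rho_sub_mean : MemLp (fun x => ρ₀ x - ⨍ y in Ω, ρ₀ y) 2 (volume.restrict Ω)
  sqrt_rho_u : MemLp (fun x => √(ρ₀ x) • u₀ x) 2 (volume.restrict Ω)
  grad_u : ∀ i j, ∃ g, HasWeakPartial Ω j (fun x => u₀ x i) g ∧ MemSobolev 1 2 Ω g
  grad_H : ∀ i j, ∃ g, HasWeakPartial Ω j (fun x => H₀ x i) g ∧ MemSobolev 1 2 Ω g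

theorem infOver_eq_sInf_image {Ω : Set E3} (hΩ : IsOpen Ω) {f : E3 → ℝ}
    (hf : ContinuousOn f Ω) (hne : Ω.Nonempty) (hb : BddBelow (f '' Ω)) :
    infOver Ω f = sInf (f '' Ω) := by
  have key : {a : ℝ | ∀ᵐ x ∂volume.restrict Ω, a ≤ f x} = lowerBounds (f '' Ω) := by
    ext a
    simp only [mem_ofPred_eq, mem_lowerBounds, forall_mem_image]
    constructor
    · intro h x hx
      by_contra! hlt
      have hU : IsOpen (Ω ∩ f ⁻¹' Iio a) := hf.isOpen_inter_preimage hΩ isOpen_Iio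
      have hpos := hU.measure_pos (volume : Measure E3) ⟨x, hx, hlt⟩
      rw [ae_restrict_iff' hΩ.measurableSet, ae_iff] at h
      refine hpos.ne' (measure_mono_null ?_ h)
      rintro y ⟨hy, hya⟩ hc
      exact absurd (hc hy) (not_le.2 hya)
    · intro h
      exact (ae_restrict_iff' hΩ.measurableSet).2 (Eventually.of_forall fun x hx => h hx)
  rw [infOver, essInf, Filter.liminf_eq, key]
  exact csSup_lowerBounds_eq_csInf hb (hne.image f)

end MHD

end

/-!
Vacuum cannot disappear, because a positive lower bound of the density at a time `T` propagates
backwards to the initial time. Suppose `ρ(T) ≥ c > 0`. For `G(r) = (r² + δ²)⁻ᵖ` one has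
`|r G'(r)| ≤ 2p G(r)`, and the continuity equation, renormalized by `G` and integrated over `Ω`
with `u · n = 0` on the boundary, gives
`d/dt ∫ G(ρ) = ∫ (G(ρ) - ρ G'(ρ)) div u`, hence
`|d/dt log ∫ G(ρ)| ≤ (2p + 1) ‖div u‖_∞`.
Since `u ∈ L²(0,T; W^{2,q})` with `q > 3`, Morrey's inequality makes `‖div u‖_∞` integrable in time,
with integral at most some `K`; hence `∫ G(ρ(0)) ≤ e^{(2p+1)K} |Ω| c^{-2p}`, uniformly in `δ`
(`IsStrongSolutionWith.exists_integral_negPow_le`). As `p → ∞`, Chebyshev's inequality forces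
`ρ₀ ≥ c e^{-K} / 2` almost everywhere (`ae_le_of_integral_negPow_le`), so that `ρ₀` has a positive
infimum.

Three ingredients have to be built. The spatial identity rests on `integral_div_eq_zero`: the flux
of `G(ρ) u` through the boundary vanishes. In place of a trace theorem, the proof uses that a
Lipschitz field whose boundary values are tangential satisfies `|∇φ · u| ≤ C |φ|` near a boundary
point, `φ` being a defining function; a cutoff in `φ` then has a vanishing contribution. The
embedding `W^{1,q} ⊂ L^∞` (`exists_sobolev_embedding_const`) follows from a cone condition, which
the defining functions provide near each boundary point, and compactness. Finally the weak time
derivative of `ρ`, both functions being continuous in time with values in `L²(Ω)`, is a derivative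
of a curve in `L²(Ω)` (`HasWeakTimeDeriv.hasDerivAt_toL2`), so that `∫ G(ρ)` may be differentiated.
The supremum norm of `∂ⱼ uⱼ` is measurable in time because it is a lower semicontinuous function of
`∂ⱼ uⱼ` in `L²(Ω)`.
-/

noncomputable section

namespace MHD

open ContinuousLinearMap Metric
open scoped Convolution

/-! ### Mollification -/

/-- A smooth bump at the origin, supported in the closed ball of radius `1 / (n + 1)`. The inner
radius is a fixed fraction of the outer one, as the Lebesgue differentiation theorem for
convolutions requires. -/
def bump (n : ℕ) : ContDiffBump (0 : E3) where
  rIn := 1 / (2 * ((n : ℝ) + 1))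
  rOut := 1 / ((n : ℝ) + 1)
  rIn_pos := by positivity
  rIn_lt_rOut := by
    apply one_div_lt_one_div_of_lt <;> linarith [(Nat.cast_nonneg n : (0 : ℝ) ≤ n)]

/-- The mollifier: the bump normalized to have integral `1`. -/
def mollifier (n : ℕ) : E3 → ℝ := (bump n).normed volume

/-- The mollification of `f`, i.e. its convolution with the mollifier. -/
def mollify (n : ℕ) (f : E3 → ℝ) : E3 → ℝ := mollifier n ⋆[lsmul ℝ ℝ, volume] f

theorem bump_rOut_tendsto : Tendsto (fun n => (bump n).rOut) atTop (𝓝 0) :=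
  tendsto_one_div_add_atTop_nhds_zero_nat

theorem contDiff_mollifier (n : ℕ) : ContDiff ℝ ∞ (mollifier n) := (bump n).contDiff_normed

theorem hasCompactSupport_mollifier (n : ℕ) : HasCompactSupport (mollifier n) :=
  (bump n).hasCompactSupport_normed

theorem mollifier_nonneg (n : ℕ) (x : E3) : 0 ≤ mollifier n x := (bump n).nonneg_normed x

theorem integral_mollifier (n : ℕ) : ∫ x, mollifier n x = 1 := (bump n).integral_normed

theorem integrable_mollifier (n : ℕ) : Integrable (mollifier n) := (bump n).integrable_normed

theorem mollifier_eq_zero {n : ℕ} {x : E3} (hx : (bump n).rOut ≤ ‖x‖) : mollifier n x = 0 := by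
  by_contra h
  have : x ∈ Function.support ((bump n).normed (volume : Measure E3)) := h
  rw [ContDiffBump.support_normed_eq] at this
  simp at this
  linarith

theorem mollify_eq (n : ℕ) (f : E3 → ℝ) (x : E3) :
    mollify n f x = ∫ y, mollifier n y * f (x - y) := rfl

theorem mollify_eq_swap (n : ℕ) (f : E3 → ℝ) (x : E3) :
    mollify n f x = ∫ y, mollifier n (x - y) * f y :=
  convolution_lsmul_swap

theorem contDiff_mollify (n : ℕ) {f : E3 → ℝ} (hf : LocallyIntegrable f) :
    ContDiff ℝ ∞ (mollify n f) :=
  HasCompactSupport.contDiff_convolution_left (n := ⊤) _ (hasCompactSupport_mollifier n)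
    (contDiff_mollifier n) hf

theorem mollify_tendsto_ae {f : E3 → ℝ} (hf : LocallyIntegrable f) :
    ∀ᵐ x, Tendsto (fun n => mollify n f x) atTop (𝓝 (f x)) := by
  refine ContDiffBump.ae_convolution_tendsto_right_of_locallyIntegrable (K := 2)
    bump_rOut_tendsto (Eventually.of_forall fun n => ?_) hf
  have : (bump n).rOut = 2 * (bump n).rIn := by
    simp only [bump]; field_simp
  exact this.le

/-- A bound for `f` near `x` passes to the mollification, the mollifier having mass `1`. -/
theorem abs_mollify_le {n : ℕ} {f : E3 → ℝ} {M : ℝ} {x : E3}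
    (hM : ∀ᵐ y, ‖x - y‖ < (bump n).rOut → |f y| ≤ M) : |mollify n f x| ≤ M := by
  rw [mollify_eq_swap]
  have hI : ∫ y, mollifier n (x - y) * M = M := by
    rw [integral_mul_const, integral_sub_left_eq_self (mollifier n), integral_mollifier, one_mul]
  rw [← hI, ← Real.norm_eq_abs]
  refine norm_integral_le_of_norm_le (((integrable_mollifier n).comp_sub_left x).mul_const M) ?_
  filter_upwards [hM] with y hy
  rw [norm_mul, Real.norm_of_nonneg (mollifier_nonneg n _), Real.norm_eq_abs]
  by_cases h : ‖x - y‖ < (bump n).rOut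
  · exact mul_le_mul_of_nonneg_left (hy h) (mollifier_nonneg n _)
  · simp [mollifier_eq_zero (not_lt.1 h)]

theorem integrable_mollify (n : ℕ) {f : E3 → ℝ} (hf : Integrable f) : Integrable (mollify n f) :=
  (integrable_mollifier n).integrable_convolution _ hf

theorem integrable_mollifier_mul (n : ℕ) {f : E3 → ℝ} (hf : LocallyIntegrable f) (x : E3) :
    Integrable (fun y => mollifier n (x - y) * f y) := by
  have := (hasCompactSupport_mollifier n).convolutionExists_left (lsmul ℝ ℝ)
    (contDiff_mollifier n).continuous hf x
  simpa using this.integrable_swap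

theorem mollify_sub (n : ℕ) {f g : E3 → ℝ} (hf : LocallyIntegrable f) (hg : LocallyIntegrable g)
    (x : E3) : mollify n (f - g) x = mollify n f x - mollify n g x := by
  simp only [mollify_eq_swap, Pi.sub_apply, mul_sub]
  exact integral_sub (integrable_mollifier_mul n hf x) (integrable_mollifier_mul n hg x)

theorem abs_mollify_le_mollify_abs (n : ℕ) (f : E3 → ℝ) (x : E3) :
    |mollify n f x| ≤ mollify n (fun y => |f y|) x := by
  simp only [mollify_eq_swap]
  refine (abs_integral_le_integral_abs).trans (le_of_eq ?_)
  simp only [abs_mul, abs_of_nonneg (mollifier_nonneg n _)]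

theorem integral_abs_mollify_le (n : ℕ) {f : E3 → ℝ} (hf : Integrable f) :
    ∫ x, |mollify n f x| ≤ ∫ x, |f x| := by
  calc ∫ x, |mollify n f x| ≤ ∫ x, mollify n (fun y => |f y|) x :=
        integral_mono (integrable_mollify n hf).abs (integrable_mollify n hf.abs)
          (abs_mollify_le_mollify_abs n f)
    _ = ∫ x, |f x| := by
        have := integral_convolution (lsmul ℝ ℝ) (integrable_mollifier n) hf.abs
        rw [integral_mollifier] at this
        exact this.trans (by simp)

/-- Mollifications converge in `L¹` on sets of finite measure. -/
theorem tendsto_setIntegral_abs_mollify_sub {f : E3 → ℝ} (hf : Integrable f) {S : Set E3}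
    (hS : volume S ≠ ⊤) :
    Tendsto (fun n => ∫ x in S, |mollify n f x - f x|) atTop (𝓝 0) := by
  have hfin : IsFiniteMeasure (volume.restrict S) := ⟨by simpa using hS.lt_top⟩
  rw [Metric.tendsto_atTop]
  intro ε hε
  obtain ⟨g, hgs, hgε, hgc, hgi⟩ :=
    hf.exists_hasCompactSupport_integral_sub_le (show (0 : ℝ) < ε / 4 by positivity)
  obtain ⟨C, hC⟩ := hgs.exists_bound_of_continuous hgc
  have hlim : Tendsto (fun n => ∫ x in S, |mollify n g x - g x|) atTop (𝓝 0) := by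
    have := tendsto_integral_of_dominated_convergence (μ := volume.restrict S)
      (F := fun n x => |mollify n g x - g x|) (f := fun _ => (0 : ℝ)) (fun _ => C + C)
      (fun n => ((integrable_mollify n hgi).sub hgi).abs.aestronglyMeasurable.restrict)
      (integrable_const _) (fun n => Eventually.of_forall fun x => by
        rw [Real.norm_eq_abs, abs_abs]
        refine (abs_sub _ _).trans (add_le_add ?_ (hC x))
        exact abs_mollify_le (Eventually.of_forall fun y _ => hC y))
      (ae_restrict_of_ae <| by
        filter_upwards [mollify_tendsto_ae hgi.locallyIntegrable] with x hx
        simpa using (hx.sub_const (g x)).abs)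
    simpa using this
  obtain ⟨N, hN⟩ := Metric.tendsto_atTop.1 hlim (ε / 4) (by positivity)
  refine ⟨N, fun n hn => ?_⟩
  have h1 := hN n hn
  rw [Real.dist_0_eq_abs, abs_of_nonneg (integral_nonneg fun x => abs_nonneg _)] at h1 ⊢
  have hd : Integrable (f - g) := hf.sub hgi
  have i1 : Integrable (fun x => |mollify n (f - g) x|) := (integrable_mollify n hd).abs
  have i2 : Integrable (fun x => |mollify n g x - g x|) := ((integrable_mollify n hgi).sub hgi).abs
  have i3 : Integrable (fun x => |f x - g x|) := hd.abs
  have hle : ∫ x in S, |mollify n f x - f x| ≤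
      ∫ x in S, (|mollify n (f - g) x| + |mollify n g x - g x| + |f x - g x|) := by
    refine integral_mono ((integrable_mollify n hf).sub hf).abs.restrict
      ((i1.add i2).add i3).restrict fun x => ?_
    simp only
    rw [mollify_sub n hf.locallyIntegrable hgi.locallyIntegrable]
    calc |mollify n f x - f x|
        = |(mollify n f x - mollify n g x) + (mollify n g x - g x) + (g x - f x)| := by ring_nf
      _ ≤ _ := (abs_add_three _ _ _).trans (by rw [abs_sub_comm (g x)])
  have hsplit : ∫ x in S, (|mollify n (f - g) x| + |mollify n g x - g x| + |f x - g x|) =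
      (∫ x in S, |mollify n (f - g) x|) + (∫ x in S, |mollify n g x - g x|)
        + ∫ x in S, |f x - g x| := by
    rw [← integral_add i1.restrict i2.restrict]
    exact integral_add (i1.add i2).restrict i3.restrict
  rw [hsplit] at hle
  have h2 : ∫ x in S, |mollify n (f - g) x| ≤ ε / 4 :=
    (setIntegral_le_integral i1 (Eventually.of_forall fun x => abs_nonneg _)).trans
      ((integral_abs_mollify_le n hd).trans hgε)
  have h3 : ∫ x in S, |f x - g x| ≤ ε / 4 :=
    (setIntegral_le_integral i3 (Eventually.of_forall fun x => abs_nonneg _)).trans hgε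
  linarith

theorem partialDeriv_mollify (n : ℕ) {f : E3 → ℝ} (hf : LocallyIntegrable f) (i : Fin 3) (x : E3) :
    partialDeriv i (mollify n f) x = ∫ y, partialDeriv i (mollifier n) (x - y) * f y := by
  have hk1 : ContDiff ℝ 1 (mollifier n) := (contDiff_mollifier n).of_le (by simp)
  have h := HasCompactSupport.hasFDerivAt_convolution_left (lsmul ℝ ℝ)
    (hasCompactSupport_mollifier n) hk1 hf x
  have hce := ((hasCompactSupport_mollifier n).fderiv (𝕜 := ℝ)).convolutionExists_left
    ((lsmul ℝ ℝ).precompL E3) (hk1.continuous_fderiv (by simp)) hf x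
  rw [partialDeriv, mollify, h.fderiv, convolution_eq_swap,
    ContinuousLinearMap.integral_apply hce.integrable_swap]
  rfl

/-- Away from the boundary, mollification commutes with weak derivatives. -/
theorem partialDeriv_mollify_of_hasWeakPartial {Ω : Set E3} (hΩ : MeasurableSet Ω) {i : Fin 3}
    {f g : E3 → ℝ} (hw : HasWeakPartial Ω i f g) (hf : IntegrableOn f Ω) (n : ℕ) {x : E3}
    (hx : closedBall x (bump n).rOut ⊆ Ω) :
    partialDeriv i (mollify n (Ω.indicator f)) x = mollify n (Ω.indicator g) x := by
  have hfi : Integrable (Ω.indicator f) := (integrable_indicator_iff hΩ).2 hf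
  rw [partialDeriv_mollify n hfi.locallyIntegrable, mollify_eq_swap]
  set φ : E3 → ℝ := fun y => mollifier n (x - y) with hφ
  have hφs : ContDiff ℝ ∞ φ := (contDiff_mollifier n).comp (contDiff_const.sub contDiff_id)
  have hts : tsupport φ ⊆ closedBall x (bump n).rOut := by
    refine closure_minimal (fun y hy => ?_) isClosed_closedBall
    by_contra h
    rw [mem_closedBall, not_le, dist_comm, dist_eq_norm] at h
    exact hy (mollifier_eq_zero h.le)
  have hφc : HasCompactSupport φ := (isCompact_closedBall x _).of_isClosed_subset
    (isClosed_tsupport _) hts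
  have hd : ∀ y, partialDeriv i φ y = -partialDeriv i (mollifier n) (x - y) := by
    intro y
    have h1 : HasFDerivAt (mollifier n) (fderiv ℝ (mollifier n) (x - y)) (x - y) :=
      ((contDiff_mollifier n).differentiable (by simp) _).hasFDerivAt
    have h2 : HasFDerivAt (fun y : E3 => x - y) (-ContinuousLinearMap.id ℝ E3) y :=
      (hasFDerivAt_id y).const_sub x
    have := h1.comp y h2
    rw [partialDeriv, hφ, show (fun y => mollifier n (x - y)) = mollifier n ∘ fun y => x - y from rfl,
      this.fderiv]
    simp [partialDeriv]
  have key := hw.2.2 φ hφs hφc (hts.trans hx)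
  have e1 : ∫ y, partialDeriv i (mollifier n) (x - y) * Ω.indicator f y
      = -∫ y in Ω, f y * partialDeriv i φ y := by
    rw [← integral_indicator hΩ, ← integral_neg]
    congr 1; ext y
    by_cases hy : y ∈ Ω <;> simp [hy, hd, mul_comm]
  have e2 : ∫ y, mollifier n (x - y) * Ω.indicator g y = ∫ y in Ω, g y * φ y := by
    rw [← integral_indicator hΩ]
    congr 1; ext y
    by_cases hy : y ∈ Ω <;> simp [hy, hφ, mul_comm]
  rw [e1, e2, key, neg_neg]

/-! ### Calculus of weak derivatives -/

/-- If `aₙ → a` almost everywhere and boundedly, and `bₙ → b` in `L¹`, then `∫ aₙ bₙ → ∫ a b`. -/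
theorem tendsto_integral_mul_of_bdd {α : Type*} [MeasurableSpace α] {μ : Measure α}
    {a : ℕ → α → ℝ} {a₀ : α → ℝ} {b : ℕ → α → ℝ} {b₀ : α → ℝ} {C : ℝ}
    (ham : ∀ n, AEStronglyMeasurable (a n) μ) (haC : ∀ n, ∀ᵐ x ∂μ, |a n x| ≤ C)
    (halim : ∀ᵐ x ∂μ, Tendsto (fun n => a n x) atTop (𝓝 (a₀ x)))
    (hb : ∀ n, Integrable (b n) μ) (hb₀ : Integrable b₀ μ)
    (hblim : Tendsto (fun n => ∫ x, |b n x - b₀ x| ∂μ) atTop (𝓝 0)) :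
    Tendsto (fun n => ∫ x, a n x * b n x ∂μ) atTop (𝓝 (∫ x, a₀ x * b₀ x ∂μ)) := by
  have i1 : ∀ n, Integrable (fun x => a n x * b₀ x) μ := fun n =>
    hb₀.bdd_mul (ham n) (haC n)
  have i2 : ∀ n, Integrable (fun x => a n x * (b n x - b₀ x)) μ := fun n =>
    ((hb n).sub hb₀).bdd_mul (ham n) (haC n)
  have l1 : Tendsto (fun n => ∫ x, a n x * b₀ x ∂μ) atTop (𝓝 (∫ x, a₀ x * b₀ x ∂μ)) := by
    refine tendsto_integral_of_dominated_convergence (fun x => C * |b₀ x|)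
      (fun n => (i1 n).aestronglyMeasurable) (hb₀.abs.const_mul C) (fun n => ?_) ?_
    · filter_upwards [haC n] with x hx
      rw [norm_mul]
      exact mul_le_mul_of_nonneg_right hx (norm_nonneg _)
    · filter_upwards [halim] with x hx
      exact hx.mul_const _
  have l2 : Tendsto (fun n => ∫ x, a n x * (b n x - b₀ x) ∂μ) atTop (𝓝 0) := by
    refine squeeze_zero_norm (a := fun n => C * ∫ x, |b n x - b₀ x| ∂μ) (fun n => ?_)
      (by simpa using hblim.const_mul C)
    rw [← integral_const_mul]
    refine norm_integral_le_of_norm_le (((hb n).sub hb₀).abs.const_mul C) ?_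
    filter_upwards [haC n] with x hx
    rw [norm_mul]
    exact mul_le_mul_of_nonneg_right hx (norm_nonneg _)
  have := l1.add l2
  rw [add_zero] at this
  refine this.congr fun n => ?_
  rw [← integral_add (i1 n) (i2 n)]
  congr 1; ext x; ring

theorem continuous_partialDeriv {φ : E3 → ℝ} (hφ : ContDiff ℝ ∞ φ) (i : Fin 3) :
    Continuous (partialDeriv i φ) :=
  (hφ.continuous_fderiv (by simp)).clm_apply continuous_const

theorem tsupport_partialDeriv_subset (φ : E3 → ℝ) (i : Fin 3) :
    tsupport (partialDeriv i φ) ⊆ tsupport φ := by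
  refine closure_minimal (fun x hx => ?_) (isClosed_tsupport _)
  by_contra h
  refine hx ?_
  rw [partialDeriv, fderiv_of_notMem_tsupport ℝ h]
  simp

theorem hasCompactSupport_partialDeriv {φ : E3 → ℝ} (hφ : HasCompactSupport φ) (i : Fin 3) :
    HasCompactSupport (partialDeriv i φ) :=
  hφ.of_isClosed_subset (isClosed_tsupport _) (tsupport_partialDeriv_subset φ i)

theorem partialDeriv_mul {a b : E3 → ℝ} {i : Fin 3} {x : E3} (ha : DifferentiableAt ℝ a x)
    (hb : DifferentiableAt ℝ b x) :
    partialDeriv i (fun y => a y * b y) x = a x * partialDeriv i b x + partialDeriv i a x * b x := by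
  simp only [partialDeriv]
  rw [fderiv_fun_mul ha hb]
  simp [mul_comm]

theorem integrable_mul_of_tsupport_subset {X : Type*} [TopologicalSpace X] [T2Space X]
    [MeasurableSpace X] [OpensMeasurableSpace X] {μ : Measure X} {Ω : Set X} {f φ : X → ℝ}
    (hf : LocallyIntegrableOn f Ω μ) (hφ : Continuous φ) (hφc : HasCompactSupport φ)
    (hφΩ : tsupport φ ⊆ Ω) : Integrable (fun x => f x * φ x) μ := by
  have h1 : IntegrableOn f (tsupport φ) μ := hf.integrableOn_compact_subset hφΩ hφc
  have h2 : IntegrableOn (fun x => f x * φ x) (tsupport φ) μ :=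
    h1.mul_continuousOn hφ.continuousOn hφc
  refine (integrableOn_iff_integrable_of_support_subset fun x hx => ?_).1 h2
  exact subset_tsupport φ (right_ne_zero_of_mul hx)

theorem setIntegral_mul_of_tsupport_subset {Ω : Set E3} {f φ : E3 → ℝ} (hφΩ : tsupport φ ⊆ Ω) :
    ∫ x in Ω, f x * φ x = ∫ x, f x * φ x :=
  setIntegral_eq_integral_of_forall_compl_eq_zero fun x hx => by
    rw [image_eq_zero_of_notMem_tsupport fun h => hx (hφΩ h), mul_zero]

theorem hasWeakPartial_weakPartial {Ω : Set E3} {i : Fin 3} {f : E3 → ℝ}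
    (h : ∃ g, HasWeakPartial Ω i f g) : HasWeakPartial Ω i f (weakPartial Ω i f) := by
  rw [weakPartial, dif_pos h]
  exact h.choose_spec

theorem HasWeakPartial.ae_eq {Ω : Set E3} (hΩ : IsOpen Ω) {i : Fin 3} {f g g' : E3 → ℝ}
    (h : HasWeakPartial Ω i f g) (h' : HasWeakPartial Ω i f g') :
    g =ᵐ[volume.restrict Ω] g' := by
  have h0 : ∀ᵐ x, x ∈ Ω → (g - g') x = 0 := by
    refine hΩ.ae_eq_zero_of_integral_contDiff_smul_eq_zero (h.2.1.sub h'.2.1)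
      fun φ hφ hφc hφΩ => ?_
    have e : ∫ x, φ x • (g - g') x = (∫ x in Ω, g x * φ x) - ∫ x in Ω, g' x * φ x := by
      rw [setIntegral_mul_of_tsupport_subset hφΩ, setIntegral_mul_of_tsupport_subset hφΩ,
        ← integral_sub (integrable_mul_of_tsupport_subset h.2.1 hφ.continuous hφc hφΩ)
          (integrable_mul_of_tsupport_subset h'.2.1 hφ.continuous hφc hφΩ)]
      congr 1; ext x; simp; ring
    have e1 := h.2.2 φ hφ hφc hφΩ
    have e2 := h'.2.2 φ hφ hφc hφΩ
    rw [e]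
    linarith
  filter_upwards [(ae_restrict_iff' hΩ.measurableSet).2 h0] with x hx
  simpa [sub_eq_zero] using hx

theorem HasWeakPartial.weakPartial_ae_eq {Ω : Set E3} (hΩ : IsOpen Ω) {i : Fin 3} {f g : E3 → ℝ}
    (h : HasWeakPartial Ω i f g) : weakPartial Ω i f =ᵐ[volume.restrict Ω] g :=
  (hasWeakPartial_weakPartial ⟨g, h⟩).ae_eq hΩ h

theorem HasWeakPartial.sub {Ω : Set E3} {i : Fin 3} {f₁ f₂ g₁ g₂ : E3 → ℝ}
    (h₁ : HasWeakPartial Ω i f₁ g₁) (h₂ : HasWeakPartial Ω i f₂ g₂) :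
    HasWeakPartial Ω i (f₁ - f₂) (g₁ - g₂) := by
  refine ⟨h₁.1.sub h₂.1, h₁.2.1.sub h₂.2.1, fun φ hφ hφc hφΩ => ?_⟩
  have hdΩ := (tsupport_partialDeriv_subset φ i).trans hφΩ
  have hdc : HasCompactSupport (partialDeriv i φ) := hasCompactSupport_partialDeriv hφc i
  have hdi := continuous_partialDeriv hφ i
  simp only [Pi.sub_apply, sub_mul]
  rw [integral_sub (integrable_mul_of_tsupport_subset h₁.1 hdi hdc hdΩ).restrict
      (integrable_mul_of_tsupport_subset h₂.1 hdi hdc hdΩ).restrict,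
    integral_sub (integrable_mul_of_tsupport_subset h₁.2.1 hφ.continuous hφc hφΩ).restrict
      (integrable_mul_of_tsupport_subset h₂.2.1 hφ.continuous hφc hφΩ).restrict,
    h₁.2.2 φ hφ hφc hφΩ, h₂.2.2 φ hφ hφc hφΩ]
  ring

/-- A compact subset of an open set stays inside it after a small enlargement. -/
theorem eventually_closedBall_bump_subset {Ω K : Set E3} (hΩ : IsOpen Ω) (hK : IsCompact K)
    (hKΩ : K ⊆ Ω) : ∀ᶠ n in atTop, ∀ x ∈ K, closedBall x (bump n).rOut ⊆ Ω := by
  obtain ⟨δ, hδ, hsub⟩ := hK.exists_cthickening_subset_open hΩ hKΩ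
  filter_upwards [bump_rOut_tendsto.eventually (gt_mem_nhds hδ)] with n hn x hx
  exact ((closedBall_subset_cthickening hx _).trans (cthickening_mono hn.le K)).trans hsub

theorem integrableOn_of_ae_abs_le {Ω : Set E3} (hfin : volume Ω ≠ ⊤) {f : E3 → ℝ} {C : ℝ}
    (hf : AEStronglyMeasurable f (volume.restrict Ω))
    (hC : ∀ᵐ x ∂volume.restrict Ω, |f x| ≤ C) : IntegrableOn f Ω := by
  have : IsFiniteMeasure (volume.restrict Ω) := isFiniteMeasure_restrict.2 hfin
  exact Integrable.of_bound hf C hC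

theorem ae_abs_indicator_le {Ω : Set E3} (hΩ : MeasurableSet Ω) {f : E3 → ℝ} {C : ℝ}
    (hC0 : 0 ≤ C) (hC : ∀ᵐ x ∂volume.restrict Ω, |f x| ≤ C) :
    ∀ᵐ x, |Ω.indicator f x| ≤ C := by
  filter_upwards [(ae_restrict_iff' hΩ).1 hC] with x hx
  by_cases h : x ∈ Ω <;> simp [h, hx, hC0]

theorem mollify_indicator_tendsto_ae {Ω : Set E3} (hΩ : MeasurableSet Ω) {f : E3 → ℝ}
    (hf : IntegrableOn f Ω) : ∀ᵐ x ∂volume.restrict Ω,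
      Tendsto (fun n => mollify n (Ω.indicator f) x) atTop (𝓝 (f x)) := by
  have h := mollify_tendsto_ae ((integrable_indicator_iff hΩ).2 hf).locallyIntegrable
  rw [ae_restrict_iff' hΩ]
  filter_upwards [h] with x hx hxΩ
  simpa [hxΩ] using hx

theorem tendsto_setIntegral_abs_mollify_indicator_sub {Ω : Set E3} (hΩ : MeasurableSet Ω)
    (hfin : volume Ω ≠ ⊤) {f : E3 → ℝ} (hf : IntegrableOn f Ω) :
    Tendsto (fun n => ∫ x in Ω, |mollify n (Ω.indicator f) x - f x|) atTop (𝓝 0) := by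
  refine (tendsto_setIntegral_abs_mollify_sub ((integrable_indicator_iff hΩ).2 hf) hfin).congr
    fun n => setIntegral_congr_fun hΩ fun x hx => ?_
  simp [hx]

/-- Product rule for bounded functions with integrable weak derivatives: test the derivative of `g`
against `fₙ φ`, where the `fₙ` are mollifications of `f`. -/
theorem HasWeakPartial.mul {Ω : Set E3} (hΩ : IsOpen Ω) (hfin : volume Ω ≠ ⊤) {i : Fin 3}
    {f g f' g' : E3 → ℝ} {C D : ℝ} (hf : HasWeakPartial Ω i f f') (hg : HasWeakPartial Ω i g g')
    (hfC : ∀ᵐ x ∂volume.restrict Ω, |f x| ≤ C) (hgD : ∀ᵐ x ∂volume.restrict Ω, |g x| ≤ D)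
    (hf' : IntegrableOn f' Ω) (hg' : IntegrableOn g' Ω) :
    HasWeakPartial Ω i (fun x => f x * g x) (fun x => f x * g' x + f' x * g x) := by
  have hΩm := hΩ.measurableSet
  replace hfC : ∀ᵐ x ∂volume.restrict Ω, |f x| ≤ max C 0 := by
    filter_upwards [hfC] with x hx using hx.trans (le_max_left _ _)
  have hfm := hf.1.aestronglyMeasurable
  have hgm := hg.1.aestronglyMeasurable
  have hfi := integrableOn_of_ae_abs_le hfin hfm hfC
  have hgi := integrableOn_of_ae_abs_le hfin hgm hgD
  have hfg' : IntegrableOn (fun x => f x * g' x) Ω := hg'.bdd_mul hfm hfC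
  have hf'g : IntegrableOn (fun x => f' x * g x) Ω := hf'.mul_bdd hgm hgD
  have hfgi : IntegrableOn (fun x => f x * g x) Ω := hgi.bdd_mul hfm hfC
  refine ⟨hfgi.locallyIntegrableOn,
    (show IntegrableOn _ Ω from hfg'.add hf'g).locallyIntegrableOn, fun φ hφ hφc hφΩ => ?_⟩
  set F : ℕ → E3 → ℝ := fun n => mollify n (Ω.indicator f) with hF
  set F' : ℕ → E3 → ℝ := fun n => mollify n (Ω.indicator f') with hF'
  have hfI : Integrable (Ω.indicator f) := (integrable_indicator_iff hΩm).2 hfi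
  have hfI' : Integrable (Ω.indicator f') := (integrable_indicator_iff hΩm).2 hf'
  have hFs : ∀ n, ContDiff ℝ ∞ (F n) := fun n => contDiff_mollify n hfI.locallyIntegrable
  have hFC : ∀ n x, |F n x| ≤ max C 0 := fun n x => abs_mollify_le <| by
    filter_upwards [ae_abs_indicator_le hΩm (le_max_right _ _) hfC] with y hy _ using hy
  have hFlim := mollify_indicator_tendsto_ae hΩm hfi
  obtain ⟨Cφ, hCφ⟩ := hφc.exists_bound_of_continuous hφ.continuous
  have hdi := continuous_partialDeriv hφ i
  have hdc : HasCompactSupport (partialDeriv i φ) := hasCompactSupport_partialDeriv hφc i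
  have hdΩ := (tsupport_partialDeriv_subset φ i).trans hφΩ
  -- The factors involving `fₙ` converge boundedly, while `∂ᵢ fₙ` converges to `f'` only in `L¹`;
  -- there it is `g` that has to be bounded.
  have igd : IntegrableOn (fun x => g x * partialDeriv i φ x) Ω :=
    (integrable_mul_of_tsupport_subset hg.1 hdi hdc hdΩ).integrableOn
  have igφ : IntegrableOn (fun x => g' x * φ x) Ω :=
    (integrable_mul_of_tsupport_subset hg.2.1 hφ.continuous hφc hφΩ).integrableOn
  have l1 : Tendsto (fun n => ∫ x in Ω, F n x * (g x * partialDeriv i φ x)) atTop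
      (𝓝 (∫ x in Ω, f x * (g x * partialDeriv i φ x))) :=
    tendsto_integral_mul_of_bdd (fun n => (hFs n).continuous.aestronglyMeasurable)
      (fun n => Eventually.of_forall (hFC n)) hFlim (fun _ => igd) igd (by simp)
  have l2 : Tendsto (fun n => ∫ x in Ω, F n x * (g' x * φ x)) atTop
      (𝓝 (∫ x in Ω, f x * (g' x * φ x))) :=
    tendsto_integral_mul_of_bdd (fun n => (hFs n).continuous.aestronglyMeasurable)
      (fun n => Eventually.of_forall (hFC n)) hFlim (fun _ => igφ) igφ (by simp)
  have l3 : Tendsto (fun n => ∫ x in Ω, (g x * φ x) * F' n x) atTop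
      (𝓝 (∫ x in Ω, (g x * φ x) * f' x)) := by
    refine tendsto_integral_mul_of_bdd (C := D * Cφ)
      (fun n => hgm.mul hφ.continuous.aestronglyMeasurable) (fun n => ?_)
      (Eventually.of_forall fun x => tendsto_const_nhds)
      (fun n => (integrable_mollify n hfI').restrict) hf'
      (tendsto_setIntegral_abs_mollify_indicator_sub hΩm hfin hf')
    filter_upwards [hgD] with x hx
    rw [abs_mul]
    exact mul_le_mul hx (hCφ x) (abs_nonneg _) ((abs_nonneg _).trans hx)
  have hev : ∀ᶠ n in atTop, (∫ x in Ω, F n x * (g x * partialDeriv i φ x))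
      + ∫ x in Ω, (g x * φ x) * F' n x = -∫ x in Ω, F n x * (g' x * φ x) := by
    filter_upwards [eventually_closedBall_bump_subset hΩ hφc hφΩ] with n hn
    have hsub : tsupport (fun x => F n x * φ x) ⊆ tsupport φ := tsupport_mul_subset_right
    have key := hg.2.2 (fun x => F n x * φ x) ((hFs n).mul hφ) hφc.mul_left (hsub.trans hφΩ)
    have e : ∀ x, g x * partialDeriv i (fun x => F n x * φ x) x
        = F n x * (g x * partialDeriv i φ x) + (g x * φ x) * F' n x := by
      intro x
      rw [partialDeriv_mul ((hFs n).differentiable (by simp) x) (hφ.differentiable (by simp) x)]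
      by_cases hx : x ∈ tsupport φ
      · rw [partialDeriv_mollify_of_hasWeakPartial hΩm hf hfi n (hn x hx)]
        ring
      · rw [image_eq_zero_of_notMem_tsupport hx]
        ring
    simp only [e] at key
    rw [integral_add] at key
    · rw [key]
      congr 2; ext x; ring
    · exact igd.bdd_mul (hFs n).continuous.aestronglyMeasurable (Eventually.of_forall (hFC n))
    · refine (integrable_mollify n hfI').restrict.bdd_mul (c := D * Cφ)
        (hgm.mul hφ.continuous.aestronglyMeasurable) ?_
      filter_upwards [hgD] with x hx
      rw [norm_mul]
      exact mul_le_mul hx (hCφ x) (abs_nonneg _) ((abs_nonneg _).trans hx)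
  have hlim := tendsto_nhds_unique ((l1.add l3).congr' hev) l2.neg
  have s1 : ∫ x in Ω, (f x * g' x + f' x * g x) * φ x
      = (∫ x in Ω, f x * (g' x * φ x)) + ∫ x in Ω, (g x * φ x) * f' x := by
    rw [← integral_add]
    · congr 1; ext x; ring
    · exact igφ.bdd_mul hfm hfC
    · refine hf'.bdd_mul (c := D * Cφ) (hgm.mul hφ.continuous.aestronglyMeasurable) ?_
      filter_upwards [hgD] with x hx
      rw [norm_mul]
      exact mul_le_mul hx (hCφ x) (abs_nonneg _) ((abs_nonneg _).trans hx)
  rw [s1]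
  have s2 : ∫ x in Ω, f x * g x * partialDeriv i φ x
      = ∫ x in Ω, f x * (g x * partialDeriv i φ x) := by
    congr 1; ext x; ring
  rw [s2]
  linarith

/-- Chain rule for a bounded `C¹` function with bounded derivative. -/
theorem HasWeakPartial.comp {Ω : Set E3} (hΩ : IsOpen Ω) (hfin : volume Ω ≠ ⊤) {i : Fin 3}
    {f f' : E3 → ℝ} {G : ℝ → ℝ} {C D : ℝ} (hf : HasWeakPartial Ω i f f') (hfi : IntegrableOn f Ω)
    (hf' : IntegrableOn f' Ω) (hG : ContDiff ℝ 1 G) (hGC : ∀ r, |G r| ≤ C)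
    (hGD : ∀ r, |deriv G r| ≤ D) :
    HasWeakPartial Ω i (fun x => G (f x)) (fun x => deriv G (f x) * f' x) := by
  have hΩm := hΩ.measurableSet
  have hG' : Continuous (deriv G) := hG.continuous_deriv le_rfl
  have hfm := hf.1.aestronglyMeasurable
  have hGm : AEStronglyMeasurable (fun x => G (f x)) (volume.restrict Ω) :=
    hG.continuous.comp_aestronglyMeasurable hfm
  have hGm' : AEStronglyMeasurable (fun x => deriv G (f x)) (volume.restrict Ω) :=
    hG'.comp_aestronglyMeasurable hfm
  have hGi := integrableOn_of_ae_abs_le hfin hGm (Eventually.of_forall fun x => hGC (f x))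
  have hGi' : IntegrableOn (fun x => deriv G (f x) * f' x) Ω :=
    hf'.bdd_mul hGm' (Eventually.of_forall fun x => hGD (f x))
  refine ⟨hGi.locallyIntegrableOn, hGi'.locallyIntegrableOn, fun φ hφ hφc hφΩ => ?_⟩
  set F : ℕ → E3 → ℝ := fun n => mollify n (Ω.indicator f) with hF
  set F' : ℕ → E3 → ℝ := fun n => mollify n (Ω.indicator f') with hF'
  have hfI : Integrable (Ω.indicator f) := (integrable_indicator_iff hΩm).2 hfi
  have hfI' : Integrable (Ω.indicator f') := (integrable_indicator_iff hΩm).2 hf'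
  have hFs : ∀ n, ContDiff ℝ ∞ (F n) := fun n => contDiff_mollify n hfI.locallyIntegrable
  have hFlim := mollify_indicator_tendsto_ae hΩm hfi
  obtain ⟨Cφ, hCφ⟩ := hφc.exists_bound_of_continuous hφ.continuous
  have hdi := continuous_partialDeriv hφ i
  have hdc : HasCompactSupport (partialDeriv i φ) := hasCompactSupport_partialDeriv hφc i
  have hdΩ := (tsupport_partialDeriv_subset φ i).trans hφΩ
  have ipd : IntegrableOn (partialDeriv i φ) Ω := (hdi.integrable_of_hasCompactSupport hdc).restrict
  have l1 : Tendsto (fun n => ∫ x in Ω, G (F n x) * partialDeriv i φ x) atTop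
      (𝓝 (∫ x in Ω, G (f x) * partialDeriv i φ x)) := by
    refine tendsto_integral_mul_of_bdd
      (fun n => (hG.continuous.comp (hFs n).continuous).aestronglyMeasurable)
      (fun n => Eventually.of_forall fun x => hGC (F n x)) ?_ (fun _ => ipd) ipd (by simp)
    filter_upwards [hFlim] with x hx
    exact (hG.continuous.tendsto _).comp hx
  have l2 : Tendsto (fun n => ∫ x in Ω, (deriv G (F n x) * φ x) * F' n x) atTop
      (𝓝 (∫ x in Ω, (deriv G (f x) * φ x) * f' x)) := by
    refine tendsto_integral_mul_of_bdd (C := D * Cφ)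
      (fun n => ((hG'.comp (hFs n).continuous).mul hφ.continuous).aestronglyMeasurable)
      (fun n => Eventually.of_forall fun x => ?_) ?_
      (fun n => (integrable_mollify n hfI').restrict) hf'
      (tendsto_setIntegral_abs_mollify_indicator_sub hΩm hfin hf')
    · rw [abs_mul]
      exact mul_le_mul (hGD _) (hCφ x) (abs_nonneg _) ((abs_nonneg _).trans (hGD 0))
    · filter_upwards [hFlim] with x hx
      exact ((hG'.tendsto _).comp hx).mul_const _
  have hev : ∀ᶠ n in atTop, ∫ x in Ω, G (F n x) * partialDeriv i φ x
      = -∫ x in Ω, (deriv G (F n x) * φ x) * F' n x := by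
    filter_upwards [eventually_closedBall_bump_subset hΩ hφc hφΩ] with n hn
    have hGF : ContDiff ℝ 1 (fun x => G (F n x)) := hG.comp ((hFs n).of_le (by simp))
    have hpd : ∀ x, partialDeriv i (fun x => G (F n x)) x
        = deriv G (F n x) * partialDeriv i (F n) x := by
      intro x
      have h1 := (hG.differentiable (by simp) (F n x)).hasDerivAt
      have h2 := ((hFs n).differentiable (by simp) x).hasFDerivAt
      have := h1.comp_hasFDerivAt x h2
      rw [partialDeriv, show (fun x => G (F n x)) = G ∘ F n from rfl, this.fderiv]
      simp [partialDeriv]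
    have hcpd : Continuous (partialDeriv i (fun x => G (F n x))) :=
      (hGF.continuous_fderiv (by simp)).clm_apply continuous_const
    have key := integral_mul_fderiv_eq_neg_fderiv_mul_of_integrable (μ := (volume : Measure E3))
      (f := fun x => G (F n x)) (g := φ) (v := EuclideanSpace.single i 1)
      ((hcpd.mul hφ.continuous).integrable_of_hasCompactSupport hφc.mul_left)
      ((hGF.continuous.mul hdi).integrable_of_hasCompactSupport hdc.mul_left)
      ((hGF.continuous.mul hφ.continuous).integrable_of_hasCompactSupport hφc.mul_left)
      (fun x _ => hGF.differentiable (by simp) x) (fun x _ => hφ.differentiable (by simp) x)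
    rw [setIntegral_mul_of_tsupport_subset hdΩ]
    refine key.trans ?_
    congr 1
    change ∫ x, partialDeriv i (fun x => G (F n x)) x * φ x = _
    rw [← setIntegral_mul_of_tsupport_subset hφΩ]
    congr 1; ext x
    rw [hpd]
    by_cases hx : x ∈ tsupport φ
    · rw [partialDeriv_mollify_of_hasWeakPartial hΩm hf hfi n (hn x hx)]
      ring
    · rw [image_eq_zero_of_notMem_tsupport hx]
      ring
  have hlim := tendsto_nhds_unique (l1.congr' hev) l2.neg
  rw [hlim]
  congr 2; ext x; ring

/-! ### Morrey's inequality and Lipschitz bounds -/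

theorem mollify_congr_ae (n : ℕ) {f g : E3 → ℝ} (h : f =ᵐ[volume] g) :
    mollify n f = mollify n g := by
  ext x
  rw [mollify_eq_swap, mollify_eq_swap]
  refine integral_congr_ae ?_
  filter_upwards [h] with y hy
  rw [hy]

/-- Young's inequality for the mollification: it does not increase `Lᵠ` norms. -/
theorem eLpNorm_mollify_le (n : ℕ) {q : ℝ≥0∞} (hq1 : 1 ≤ q) (hq : q ≠ ⊤) {f : E3 → ℝ}
    (hf : AEStronglyMeasurable f volume) :
    eLpNorm (mollify n f) q volume ≤ eLpNorm f q volume := by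
  wlog hfm : StronglyMeasurable f generalizing f with H
  · have := H hf.stronglyMeasurable_mk.aestronglyMeasurable hf.stronglyMeasurable_mk
    rwa [← mollify_congr_ae n hf.ae_eq_mk, ← eLpNorm_congr_ae hf.ae_eq_mk] at this
  have hq0 : q ≠ 0 := (zero_lt_one.trans_le hq1).ne'
  set k : E3 → ℝ≥0∞ := fun y => ENNReal.ofReal (mollifier n y) with hk
  have hkm : Measurable k := (contDiff_mollifier n).continuous.measurable.ennreal_ofReal
  set ν : Measure E3 := volume.withDensity k with hν
  have hprob : IsProbabilityMeasure ν := by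
    refine ⟨?_⟩
    rw [hν, withDensity_apply _ MeasurableSet.univ, Measure.restrict_univ,
      ← ofReal_integral_eq_lintegral_ofReal (integrable_mollifier n)
        (Eventually.of_forall (mollifier_nonneg n)), integral_mollifier, ENNReal.ofReal_one]
  have hmeas : Measurable fun z : E3 × E3 => ‖f (z.1 - z.2)‖ₑ ^ q.toReal :=
    ((hfm.measurable.comp (measurable_fst.sub measurable_snd)).enorm).pow_const _
  have hpt : ∀ x, ‖mollify n f x‖ₑ ^ q.toReal ≤ ∫⁻ y, ‖f (x - y)‖ₑ ^ q.toReal ∂ν := by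
    intro x
    have hm : AEStronglyMeasurable (fun y => f (x - y)) ν :=
      (hfm.comp_measurable (measurable_const.sub measurable_id)).aestronglyMeasurable
    have hme : Measurable fun y => ‖f (x - y)‖ₑ :=
      (hfm.measurable.comp (measurable_const.sub measurable_id)).enorm
    have h1 : ‖mollify n f x‖ₑ ≤ eLpNorm (fun y => f (x - y)) 1 ν := by
      rw [eLpNorm_one_eq_lintegral_enorm, hν, lintegral_withDensity_eq_lintegral_mul _ hkm hme,
        mollify_eq]
      refine (enorm_integral_le_lintegral_enorm _).trans (le_of_eq ?_)
      refine lintegral_congr fun y => ?_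
      rw [enorm_mul, Real.enorm_of_nonneg (mollifier_nonneg n y)]
      rfl
    have h2 := h1.trans (eLpNorm_le_eLpNorm_of_exponent_le hq1 hm)
    rw [eLpNorm_eq_lintegral_rpow_enorm_toReal hq0 hq] at h2
    have h3 := ENNReal.rpow_le_rpow h2 (ENNReal.toReal_nonneg (a := q))
    rwa [← ENNReal.rpow_mul, one_div_mul_cancel (ENNReal.toReal_pos hq0 hq).ne',
      ENNReal.rpow_one] at h3
  rw [eLpNorm_eq_lintegral_rpow_enorm_toReal hq0 hq, eLpNorm_eq_lintegral_rpow_enorm_toReal hq0 hq]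
  refine ENNReal.rpow_le_rpow ?_ (by positivity)
  calc ∫⁻ x, ‖mollify n f x‖ₑ ^ q.toReal ≤ ∫⁻ x, ∫⁻ y, ‖f (x - y)‖ₑ ^ q.toReal ∂ν :=
        lintegral_mono hpt
    _ = ∫⁻ y, (∫⁻ x, ‖f (x - y)‖ₑ ^ q.toReal) ∂ν := lintegral_lintegral_swap hmeas.aemeasurable
    _ = ∫⁻ _, (∫⁻ x, ‖f x‖ₑ ^ q.toReal) ∂ν := by
        congr 1; ext y
        exact lintegral_sub_right_eq_self (fun x => ‖f x‖ₑ ^ q.toReal) y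
    _ = ∫⁻ x, ‖f x‖ₑ ^ q.toReal := by simp

theorem norm_fderiv_apply_le (v : E3 → ℝ) (z w : E3) :
    ‖fderiv ℝ v z w‖ ≤ ‖w‖ * ∑ i, ‖partialDeriv i v z‖ := by
  have hw : w = ∑ i, w i • EuclideanSpace.single i (1 : ℝ) := by
    have := (EuclideanSpace.basisFun (Fin 3) ℝ).sum_repr w
    simpa using this.symm
  calc ‖fderiv ℝ v z w‖ = ‖∑ i, w i * partialDeriv i v z‖ := by
        conv_lhs => rw [hw, map_sum]
        simp [partialDeriv]
    _ ≤ ∑ i, ‖w i * partialDeriv i v z‖ := norm_sum_le _ _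
    _ ≤ ∑ i, ‖w‖ * ‖partialDeriv i v z‖ := by
        refine Finset.sum_le_sum fun i _ => ?_
        rw [norm_mul]
        exact mul_le_mul_of_nonneg_right (PiLp.norm_apply_le w i) (norm_nonneg _)
    _ = _ := by rw [Finset.mul_sum]

/-- The `L¹` norm of `Φ (x + s ·)` over a ball is bounded by the `Lᵠ` norm of `Φ` over a set that
contains the image of the ball, with the factor `s ^ (-3 / q)` of the change of variables. -/
theorem lintegral_comp_add_smul_le {q : ℝ≥0∞} (hq1 : 1 ≤ q) (hq : q ≠ ⊤) {Φ : E3 → ℝ}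
    (hΦ : Continuous Φ) {s : ℝ} (hs : 0 < s) (x : E3) {D K : Set E3} (hK : MeasurableSet K)
    (hDK : ∀ y ∈ D, x + s • y ∈ K) :
    ∫⁻ y in D, ‖Φ (x + s • y)‖ₑ ≤ volume D ^ (1 - 1 / q.toReal) *
      (ENNReal.ofReal (s ^ (-(3 / q.toReal))) * eLpNorm Φ q (volume.restrict K)) := by
  have hqt : 0 < q.toReal := ENNReal.toReal_pos (zero_lt_one.trans_le hq1).ne' hq
  set A : E3 → E3 := fun y => x + s • y with hA
  have hAm : Measurable A := by fun_prop
  have hmap : Measure.map A volume = ENNReal.ofReal (s ^ 3)⁻¹ • (volume : Measure E3) := by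
    have h1 : A = (fun z => x + z) ∘ fun y => s • y := rfl
    rw [h1, ← Measure.map_map (by fun_prop) (by fun_prop), Measure.map_addHaar_smul _ hs.ne',
      Measure.map_smul, (measurePreserving_add_left volume x).map_eq]
    congr 2
    rw [show Module.finrank ℝ E3 = 3 by simp, abs_of_pos (by positivity)]
  have hle : Measure.map A (volume.restrict D) ≤
      ENNReal.ofReal (s ^ 3)⁻¹ • (volume : Measure E3).restrict K := by
    rw [← Measure.restrict_smul, ← hmap, Measure.restrict_map hAm hK]
    exact Measure.map_mono (Measure.restrict_mono hDK le_rfl) hAm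
  have hfac : (ENNReal.ofReal (s ^ 3)⁻¹) ^ (1 / q).toReal
      = ENNReal.ofReal (s ^ (-(3 / q.toReal))) := by
    rw [ENNReal.ofReal_rpow_of_nonneg (by positivity) (by positivity)]
    congr 1
    rw [← Real.rpow_natCast, ← Real.rpow_neg hs.le, ← Real.rpow_mul hs.le]
    congr 1
    rw [ENNReal.toReal_div]
    simp
    ring
  calc ∫⁻ y in D, ‖Φ (x + s • y)‖ₑ = eLpNorm (Φ ∘ A) 1 (volume.restrict D) := by
        rw [eLpNorm_one_eq_lintegral_enorm]; rfl
    _ ≤ eLpNorm (Φ ∘ A) q (volume.restrict D) * volume D ^ (1 - 1 / q.toReal) := by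
        have := eLpNorm_le_eLpNorm_mul_rpow_measure_univ (μ := volume.restrict D) (f := Φ ∘ A) hq1
          (hΦ.comp (by fun_prop)).aestronglyMeasurable
        simpa using this
    _ = eLpNorm Φ q (Measure.map A (volume.restrict D)) * volume D ^ (1 - 1 / q.toReal) := by
        rw [eLpNorm_map_measure hΦ.aestronglyMeasurable hAm.aemeasurable]
    _ ≤ (ENNReal.ofReal (s ^ (-(3 / q.toReal))) * eLpNorm Φ q (volume.restrict K))
          * volume D ^ (1 - 1 / q.toReal) := by
        gcongr
        refine (eLpNorm_mono_measure Φ hle).trans ?_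
        rw [eLpNorm_smul_measure_of_ne_top hq, hfac, smul_eq_mul]
    _ = _ := mul_comm _ _

/-- Morrey's inequality for `C¹` functions on the union of segments from `x` to a ball. -/
theorem exists_morrey_const {q : ℝ≥0∞} (hq3 : 3 < q) (hq : q ≠ ⊤) (b : E3) {ρ : ℝ} (hρ : 0 < ρ) :
    ∃ C : ℝ≥0∞, C ≠ ⊤ ∧ ∀ v : E3 → ℝ, ContDiff ℝ 1 v → ∀ (x : E3) (K : Set E3), MeasurableSet K →
      (∀ s ∈ Ioc (0 : ℝ) 1, ∀ y ∈ closedBall b ρ, x + s • y ∈ K) →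
      ‖v x‖ₑ ≤ C * (eLpNorm v q (volume.restrict K)
        + ∑ i, eLpNorm (partialDeriv i v) q (volume.restrict K)) := by
  have hq1 : 1 ≤ q := (by norm_num : (1 : ℝ≥0∞) ≤ 3).trans hq3.le
  have hq0 : q ≠ 0 := (zero_lt_one.trans_le hq1).ne'
  have hqr : 3 < q.toReal := by
    have := (ENNReal.toReal_lt_toReal (by simp) hq).2 hq3
    simpa using this
  set D : Set E3 := closedBall b ρ with hD
  have hDm : MeasurableSet D := isClosed_closedBall.measurableSet
  have hDpos : volume D ≠ 0 := (measure_closedBall_pos volume b hρ).ne'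
  have hDfin : volume D ≠ ⊤ := measure_closedBall_lt_top.ne
  set R : ℝ := ‖b‖ + ρ with hR
  have hR0 : 0 ≤ R := by positivity
  set J : ℝ≥0∞ := ∫⁻ s in Ioc (0 : ℝ) 1, ENNReal.ofReal (s ^ (-(3 / q.toReal))) with hJ
  -- This is where `q > 3` is needed.
  have hJfin : J ≠ ⊤ := by
    have : -1 < -(3 / q.toReal) := by
      rw [neg_lt_neg_iff, div_lt_one (by linarith)]; exact hqr
    have h1 := (intervalIntegral.intervalIntegrable_rpow' (a := 0) (b := 1) this).1
    exact h1.lintegral_lt_top.ne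
  set V : ℝ≥0∞ := volume D ^ (1 - 1 / q.toReal) with hV
  have hVfin : V ≠ ⊤ := by
    refine ENNReal.rpow_ne_top_of_nonneg ?_ hDfin
    rw [sub_nonneg, div_le_one (by linarith)]; linarith
  refine ⟨(volume D)⁻¹ * (V * (1 + ENNReal.ofReal R * J)), by finiteness, ?_⟩
  intro v hv x K hK hxK
  have hdc : ∀ i, Continuous (partialDeriv i v) := fun i =>
    (hv.continuous_fderiv (by simp)).clm_apply continuous_const
  -- Along the segment, `v (x + y) - v x = ∫₀¹ ∇v (x + s y) · y ds`; this is then averaged over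
  -- `y ∈ D`.
  have hpt : ∀ y ∈ D, ‖v x‖ₑ ≤ ‖v (x + (1 : ℝ) • y)‖ₑ
      + ∑ i, ENNReal.ofReal R * ∫⁻ s in Ioc (0 : ℝ) 1, ‖partialDeriv i v (x + s • y)‖ₑ := by
    intro y hy
    have hyR : ‖y‖ ≤ R := by
      have h1 : ‖y - b‖ ≤ ρ := by rwa [hD, mem_closedBall, dist_eq_norm] at hy
      calc ‖y‖ = ‖(y - b) + b‖ := by simp
        _ ≤ R := (norm_add_le _ _).trans (by linarith)
    have hder : ∀ s ∈ uIcc (0 : ℝ) 1,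
        HasDerivAt (fun s : ℝ => v (x + s • y)) (fderiv ℝ v (x + s • y) y) s := by
      intro s _
      have h1 : HasDerivAt (fun s : ℝ => x + s • y) y s := by
        simpa using ((hasDerivAt_id s).smul_const y).const_add x
      exact ((hv.differentiable (by simp) _).hasFDerivAt).comp_hasDerivAt s h1
    have hcont : Continuous fun s : ℝ => fderiv ℝ v (x + s • y) y :=
      ((hv.continuous_fderiv (by simp)).comp (by fun_prop)).clm_apply continuous_const
    have hftc := intervalIntegral.integral_eq_sub_of_hasDerivAt hder
      (hcont.intervalIntegrable 0 1)
    rw [intervalIntegral.integral_of_le zero_le_one] at hftc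
    have hvx : v x = v (x + (1 : ℝ) • y) - ∫ s in Ioc (0 : ℝ) 1, fderiv ℝ v (x + s • y) y := by
      rw [hftc]; simp
    have hbd : ‖∫ s in Ioc (0 : ℝ) 1, fderiv ℝ v (x + s • y) y‖ₑ
        ≤ ∑ i, ENNReal.ofReal R * ∫⁻ s in Ioc (0 : ℝ) 1, ‖partialDeriv i v (x + s • y)‖ₑ := by
      refine (enorm_integral_le_lintegral_enorm _).trans ?_
      have hmi : ∀ i, Measurable fun s : ℝ => ‖partialDeriv i v (x + s • y)‖ₑ := fun i =>
        ((hdc i).comp (by fun_prop : Continuous fun s : ℝ => x + s • y)).measurable.enorm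
      rw [← Finset.mul_sum, ← lintegral_finsetSum _ fun i _ => hmi i,
        ← lintegral_const_mul _ (Finset.measurable_fun_sum _ fun i _ => hmi i)]
      refine lintegral_mono fun s => ?_
      have h1 := (norm_fderiv_apply_le v (x + s • y) y).trans
        (mul_le_mul_of_nonneg_right hyR (by positivity))
      have h2 := ENNReal.ofReal_le_ofReal h1
      rw [ENNReal.ofReal_mul hR0, ENNReal.ofReal_sum_of_nonneg fun i _ => norm_nonneg _] at h2
      simpa only [ofReal_norm] using h2
    calc ‖v x‖ₑ ≤ ‖v (x + (1 : ℝ) • y)‖ₑ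
          + ‖∫ s in Ioc (0 : ℝ) 1, fderiv ℝ v (x + s • y) y‖ₑ := by
          conv_lhs => rw [hvx]
          exact enorm_sub_le
      _ ≤ _ := by gcongr
  have hswap : ∀ i, ∫⁻ y in D, ∫⁻ s in Ioc (0 : ℝ) 1, ‖partialDeriv i v (x + s • y)‖ₑ
      ≤ V * (J * eLpNorm (partialDeriv i v) q (volume.restrict K)) := by
    intro i
    have hm2 : Measurable fun z : E3 × ℝ => ‖partialDeriv i v (x + z.2 • z.1)‖ₑ :=
      ((hdc i).comp (by fun_prop : Continuous fun z : E3 × ℝ => x + z.2 • z.1)).measurable.enorm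
    rw [lintegral_lintegral_swap hm2.aemeasurable]
    calc ∫⁻ s in Ioc (0 : ℝ) 1, ∫⁻ y in D, ‖partialDeriv i v (x + s • y)‖ₑ
        ≤ ∫⁻ s in Ioc (0 : ℝ) 1, V * (ENNReal.ofReal (s ^ (-(3 / q.toReal)))
            * eLpNorm (partialDeriv i v) q (volume.restrict K)) :=
          setLIntegral_mono' measurableSet_Ioc fun s hs =>
            lintegral_comp_add_smul_le hq1 hq (hdc i) hs.1 x hK fun y hy => hxK s hs y hy
      _ = _ := by
          rw [lintegral_const_mul _ (by fun_prop), lintegral_mul_const _ (by fun_prop)]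
  have h0 : ∫⁻ y in D, ‖v (x + (1 : ℝ) • y)‖ₑ ≤ V * eLpNorm v q (volume.restrict K) := by
    have := lintegral_comp_add_smul_le hq1 hq hv.continuous one_pos x hK
      fun y hy => hxK 1 (by simp) y hy
    rwa [Real.one_rpow, ENNReal.ofReal_one, one_mul] at this
  have hsum : volume D * ‖v x‖ₑ ≤ V * (1 + ENNReal.ofReal R * J) * (eLpNorm v q (volume.restrict K)
        + ∑ i, eLpNorm (partialDeriv i v) q (volume.restrict K)) := by
    calc volume D * ‖v x‖ₑ = ∫⁻ y in D, ‖v x‖ₑ := by simp [mul_comm]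
      _ ≤ ∫⁻ y in D, (‖v (x + (1 : ℝ) • y)‖ₑ
          + ∑ i, ENNReal.ofReal R * ∫⁻ s in Ioc (0 : ℝ) 1, ‖partialDeriv i v (x + s • y)‖ₑ) :=
          setLIntegral_mono' hDm hpt
      _ = (∫⁻ y in D, ‖v (x + (1 : ℝ) • y)‖ₑ) + ∑ i, ENNReal.ofReal R *
          ∫⁻ y in D, ∫⁻ s in Ioc (0 : ℝ) 1, ‖partialDeriv i v (x + s • y)‖ₑ := by
          have hm3 : ∀ i, Measurable fun y : E3 =>
              ∫⁻ s in Ioc (0 : ℝ) 1, ‖partialDeriv i v (x + s • y)‖ₑ := fun i => by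
            have hm2 : Measurable fun z : E3 × ℝ => ‖partialDeriv i v (x + z.2 • z.1)‖ₑ :=
              ((hdc i).comp
                (by fun_prop : Continuous fun z : E3 × ℝ => x + z.2 • z.1)).measurable.enorm
            exact hm2.lintegral_prod_right'
          have hm4 : Measurable fun y : E3 => ‖v (x + (1 : ℝ) • y)‖ₑ :=
            (hv.continuous.comp
              (by fun_prop : Continuous fun y : E3 => x + (1 : ℝ) • y)).measurable.enorm
          rw [lintegral_add_left hm4, lintegral_finsetSum _ fun i _ => (hm3 i).const_mul _]
          congr 1
          exact Finset.sum_congr rfl fun i _ => lintegral_const_mul _ (hm3 i)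
      _ ≤ V * eLpNorm v q (volume.restrict K) + ∑ i, ENNReal.ofReal R *
          (V * (J * eLpNorm (partialDeriv i v) q (volume.restrict K))) := by
          gcongr with i _
          exact hswap i
      _ = V * eLpNorm v q (volume.restrict K) + V * (ENNReal.ofReal R * J) *
          ∑ i, eLpNorm (partialDeriv i v) q (volume.restrict K) := by
          rw [Finset.mul_sum]
          congr 1
          refine Finset.sum_congr rfl fun i _ => ?_
          ring
      _ ≤ _ := by
          rw [mul_add (V * _)]
          gcongr
          · calc V = V * 1 := (mul_one V).symm
              _ ≤ _ := by gcongr; exact le_self_add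
          · exact le_add_self
  calc ‖v x‖ₑ = (volume D)⁻¹ * (volume D * ‖v x‖ₑ) := by
        rw [← mul_assoc, ENNReal.inv_mul_cancel hDpos hDfin, one_mul]
    _ ≤ (volume D)⁻¹ * (V * (1 + ENNReal.ofReal R * J) * (eLpNorm v q (volume.restrict K)
        + ∑ i, eLpNorm (partialDeriv i v) q (volume.restrict K))) := by gcongr
    _ = _ := by ring

/-- A uniform interior cone condition near `x₀`: from every point of `closure Ω` near `x₀`, all
open-ended segments in the directions of a fixed ball stay in `Ω`. The cone is the union of the
segments from its vertex to the points of the ball `closedBall b ρ`. -/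
structure HasInteriorCone (Ω : Set E3) (x₀ : E3) (r : ℝ) (b : E3) (ρ : ℝ) : Prop where
  r_pos : 0 < r
  rho_pos : 0 < ρ
  mem : ∀ x ∈ closure Ω, dist x x₀ < r → ∀ s ∈ Ioc (0 : ℝ) 1, ∀ y ∈ closedBall b ρ, x + s • y ∈ Ω

/-- Morrey's inequality near a point at which the interior cone condition holds: apply the
inequality for `C¹` functions to the mollifications on the compact cone at `x`, which lies in `Ω`. -/
theorem HasInteriorCone.exists_morrey_const {Ω : Set E3} (hΩ : IsOpen Ω) (hfin : volume Ω ≠ ⊤)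
    {x₀ b : E3} {r ρ : ℝ} (hc : HasInteriorCone Ω x₀ r b ρ) {q : ℝ≥0∞} (hq3 : 3 < q)
    (hq : q ≠ ⊤) :
    ∃ C : ℝ≥0∞, C ≠ ⊤ ∧ ∀ f, MemSobolev 1 q Ω f →
      ∀ᵐ x ∂volume.restrict Ω, dist x x₀ < r → ‖f x‖ₑ ≤ C * sobolevENorm 1 q Ω f := by
  obtain ⟨C, hC, hM⟩ := MHD.exists_morrey_const hq3 hq b hc.rho_pos
  refine ⟨C, hC, fun f hf => ?_⟩
  have hΩm := hΩ.measurableSet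
  have hq1 : 1 ≤ q := (by norm_num : (1 : ℝ≥0∞) ≤ 3).trans hq3.le
  have hfinm : IsFiniteMeasure (volume.restrict Ω) := isFiniteMeasure_restrict.2 hfin
  have hfi : IntegrableOn f Ω := hf.1.integrable hq1
  have hw : ∀ i, HasWeakPartial Ω i f (weakPartial Ω i f) := fun i =>
    hasWeakPartial_weakPartial (hf.2 i).1
  have hgq : ∀ i, MemLp (weakPartial Ω i f) q (volume.restrict Ω) := fun i => (hf.2 i).2
  filter_upwards [mollify_indicator_tendsto_ae hΩm hfi, ae_restrict_mem hΩm] with x hx hxΩ hxr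
  set K : Set E3 := (fun z : ℝ × E3 => x + z.1 • z.2) '' (Icc 0 1 ×ˢ closedBall b ρ) with hK
  have hKc : IsCompact K :=
    (isCompact_Icc.prod (isCompact_closedBall b ρ)).image (by fun_prop)
  have hKΩ : K ⊆ Ω := by
    rintro _ ⟨⟨s, y⟩, ⟨hs, hy⟩, rfl⟩
    rcases hs.1.eq_or_lt with h | h
    · simp only at h; simpa [← h] using hxΩ
    · exact hc.mem x (subset_closure hxΩ) hxr s ⟨h, hs.2⟩ y hy
  have hlim : Tendsto (fun n => ‖mollify n (Ω.indicator f) x‖ₑ) atTop (𝓝 ‖f x‖ₑ) :=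
    (continuous_enorm.tendsto _).comp hx
  refine le_of_tendsto hlim ?_
  filter_upwards [eventually_closedBall_bump_subset hΩ hKc hKΩ] with n hn
  have hv := hM (mollify n (Ω.indicator f))
    ((contDiff_mollify n ((integrable_indicator_iff hΩm).2 hfi).locallyIntegrable).of_le (by simp))
    x K hKc.measurableSet fun s hs y hy => ⟨(s, y), ⟨⟨hs.1.le, hs.2⟩, hy⟩, rfl⟩
  have hY : ∀ g, MemLp g q (volume.restrict Ω) →
      eLpNorm (mollify n (Ω.indicator g)) q (volume.restrict K)
        ≤ eLpNorm g q (volume.restrict Ω) := by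
    intro g hg
    have hgm : AEStronglyMeasurable (Ω.indicator g) volume :=
      (aestronglyMeasurable_indicator_iff hΩm).2 hg.aestronglyMeasurable
    calc _ ≤ eLpNorm (mollify n (Ω.indicator g)) q volume :=
          eLpNorm_mono_measure _ Measure.restrict_le_self
      _ ≤ eLpNorm (Ω.indicator g) q volume := eLpNorm_mollify_le n hq1 hq hgm
      _ = _ := eLpNorm_indicator_eq_eLpNorm_restrict hΩm
  refine hv.trans ?_
  gcongr
  change _ ≤ eLpNorm f q (volume.restrict Ω)
    + ∑ i, eLpNorm (weakPartial Ω i f) q (volume.restrict Ω)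
  refine add_le_add (hY f hf.1) (Finset.sum_le_sum fun i _ => ?_)
  refine le_trans (le_of_eq ?_) (hY _ (hgq i))
  refine eLpNorm_congr_ae ?_
  filter_upwards [ae_restrict_mem hKc.measurableSet] with z hz
  exact partialDeriv_mollify_of_hasWeakPartial hΩm (hw i) hfi n (hn z hz)

/-- Morrey's embedding `W^{1,q}(Ω) ⊂ L^∞(Ω)`, `q > 3`, for a bounded open set that satisfies the
interior cone condition at every point of its closure. -/
theorem exists_sobolev_embedding_const {Ω : Set E3} (hΩ : IsOpen Ω) (hb : Bornology.IsBounded Ω)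
    (hcone : ∀ x ∈ closure Ω, ∃ r b ρ, HasInteriorCone Ω x r b ρ) {q : ℝ≥0∞} (hq3 : 3 < q)
    (hq : q ≠ ⊤) :
    ∃ C : ℝ≥0∞, C ≠ ⊤ ∧ ∀ f, MemSobolev 1 q Ω f →
      ∀ᵐ x ∂volume.restrict Ω, ‖f x‖ₑ ≤ C * sobolevENorm 1 q Ω f := by
  have key : ∃ C : ℝ≥0∞, C ≠ ⊤ ∧ ∀ f, MemSobolev 1 q Ω f →
      ∀ᵐ x ∂volume.restrict Ω, x ∈ closure Ω → ‖f x‖ₑ ≤ C * sobolevENorm 1 q Ω f := by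
    refine hb.isCompact_closure.induction_on (p := fun S => ∃ C : ℝ≥0∞, C ≠ ⊤ ∧
      ∀ f, MemSobolev 1 q Ω f → ∀ᵐ x ∂volume.restrict Ω, x ∈ S →
        ‖f x‖ₑ ≤ C * sobolevENorm 1 q Ω f) ⟨0, by simp, by simp⟩ ?_ ?_ ?_
    · rintro s t hst ⟨C, hC, h⟩
      refine ⟨C, hC, fun f hf => ?_⟩
      filter_upwards [h f hf] with x hx hxs using hx (hst hxs)
    · rintro s t ⟨C, hC, h⟩ ⟨C', hC', h'⟩
      refine ⟨C + C', by finiteness, fun f hf => ?_⟩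
      filter_upwards [h f hf, h' f hf] with x hx hx' hxs
      rw [add_mul]
      rcases hxs with hxs | hxs
      · exact (hx hxs).trans le_self_add
      · exact (hx' hxs).trans le_add_self
    · intro x hx
      obtain ⟨r, b, ρ, hc⟩ := hcone x hx
      obtain ⟨C, hC, h⟩ := hc.exists_morrey_const hΩ hb.measure_lt_top.ne hq3 hq
      exact ⟨ball x r, mem_nhdsWithin_of_mem_nhds (ball_mem_nhds x hc.r_pos), C, hC, h⟩
  obtain ⟨C, hC, h⟩ := key
  refine ⟨C, hC, fun f hf => ?_⟩
  filter_upwards [h f hf, ae_restrict_mem hΩ.measurableSet] with x hx hxΩ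
    using hx (subset_closure hxΩ)

/-- A function with bounded weak gradient is Lipschitz along the segments contained in `Ω`, off a
null set. -/
theorem exists_lipschitz_of_weakPartial_bdd {Ω : Set E3} (hΩ : IsOpen Ω) {f : E3 → ℝ}
    {g : Fin 3 → E3 → ℝ} {M : ℝ} (hM : 0 ≤ M) (hf : IntegrableOn f Ω)
    (hw : ∀ i, HasWeakPartial Ω i f (g i)) (hg : ∀ i, ∀ᵐ x ∂volume.restrict Ω, |g i x| ≤ M) :
    ∃ S : Set E3, (∀ᵐ x ∂volume.restrict Ω, x ∈ S) ∧ ∀ x ∈ S, ∀ y ∈ S, segment ℝ x y ⊆ Ω →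
      |f x - f y| ≤ 3 * M * ‖x - y‖ := by
  have hΩm := hΩ.measurableSet
  refine ⟨{x | Tendsto (fun n => mollify n (Ω.indicator f) x) atTop (𝓝 (f x))},
    mollify_indicator_tendsto_ae hΩm hf, fun x hx y hy hxy => ?_⟩
  refine le_of_tendsto ((hx.sub hy).abs) ?_
  have hseg : IsCompact (segment ℝ x y) := by
    rw [segment_eq_image_lineMap]
    exact isCompact_Icc.image AffineMap.lineMap_continuous
  filter_upwards [eventually_closedBall_bump_subset hΩ hseg hxy] with n hn
  have hcd := contDiff_mollify n ((integrable_indicator_iff hΩm).2 hf).locallyIntegrable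
  have := (convex_segment x y).norm_image_sub_le_of_norm_fderiv_le (𝕜 := ℝ)
    (f := mollify n (Ω.indicator f)) (C := 3 * M)
    (fun z _ => hcd.differentiable (by simp) z) (fun z hz => ?_) (right_mem_segment ℝ x y)
    (left_mem_segment ℝ x y)
  · simpa using this
  · refine ContinuousLinearMap.opNorm_le_bound _ (by positivity) fun w => ?_
    refine (norm_fderiv_apply_le _ z w).trans ?_
    rw [mul_comm]
    refine mul_le_mul_of_nonneg_right ?_ (norm_nonneg w)
    calc ∑ i, ‖partialDeriv i (mollify n (Ω.indicator f)) z‖ ≤ ∑ i : Fin 3, M := by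
          refine Finset.sum_le_sum fun i _ => ?_
          rw [partialDeriv_mollify_of_hasWeakPartial hΩm (hw i) hf n (hn z hz)]
          refine abs_mollify_le ?_
          filter_upwards [ae_abs_indicator_le hΩm hM (hg i)] with y hy _ using hy
      _ = 3 * M := by simp

/-! ### Geometry of smooth domains near the boundary -/

theorem exists_hasInteriorCone_of_mem {Ω : Set E3} (hΩ : IsOpen Ω) {x : E3} (hx : x ∈ Ω) :
    ∃ r b ρ, HasInteriorCone Ω x r b ρ := by
  obtain ⟨r, hr, hb⟩ := Metric.isOpen_iff.1 hΩ x hx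
  refine ⟨r / 2, 0, r / 2, by positivity, by positivity, fun z _ hz s hs y hy => hb ?_⟩
  rw [mem_ball, dist_eq_norm] at *
  rw [mem_closedBall, dist_zero_right] at hy
  calc ‖z + s • y - x‖ = ‖(z - x) + s • y‖ := by congr 1; abel
    _ ≤ ‖z - x‖ + ‖s • y‖ := norm_add_le _ _
    _ < r / 2 + r / 2 := by
      refine add_lt_add_of_lt_of_le hz ?_
      rw [norm_smul, Real.norm_of_nonneg hs.1.le]
      nlinarith [hs.1, hs.2, norm_nonneg y]
    _ = r := by ring

theorem fderiv_eq_inner_gradient (φ : E3 → ℝ) (x y : E3) :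
    fderiv ℝ φ x y = inner ℝ (gradient φ x) y := by
  rw [gradient, InnerProductSpace.toDual_symm_apply]

/-- A defining function `φ` of `Ω` near a boundary point `x₀` that decreases, at a uniform rate, in
all directions of a fixed ball. -/
structure IsBoundaryChart (Ω : Set E3) (x₀ : E3) (φ : E3 → ℝ) (R r : ℝ) (b : E3) (ρ c : ℝ) :
    Prop where
  smooth : ContDiff ℝ ∞ φ
  r_pos : 0 < r
  rho_pos : 0 < ρ
  c_pos : 0 < c
  radius_le : r + ‖b‖ + ρ ≤ R
  mem_iff : ∀ y ∈ ball x₀ R, (y ∈ Ω ↔ φ y < 0)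
  gradient_ne : ∀ y ∈ ball x₀ R, gradient φ y ≠ 0
  descent : ∀ z ∈ ball x₀ R, ∀ y ∈ closedBall b ρ, fderiv ℝ φ z y ≤ -c

theorem IsDefiningFunctionAt.exists_isBoundaryChart {Ω : Set E3} {x₀ : E3} {φ : E3 → ℝ}
    (h : IsDefiningFunctionAt Ω x₀ φ) {R₀ : ℝ} (hR₀ : 0 < R₀) :
    ∃ R r b ρ c, R ≤ R₀ ∧ IsBoundaryChart Ω x₀ φ R r b ρ c := by
  obtain ⟨hφ, hg, hev⟩ := h
  set g := gradient φ x₀ with hgdef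
  set a := ‖g‖ with ha
  have ha0 : 0 < a := norm_pos_iff.2 hg
  have hcont : Continuous (fderiv ℝ φ) := hφ.continuous_fderiv (by simp)
  -- The descent directions are those close to `e = -∇φ(x₀) / |∇φ(x₀)|`; the factor `τ = R / 4`
  -- scales the cone down so that it stays in the ball of radius `R`.
  have hnear : ∀ᶠ z in 𝓝 x₀, ‖fderiv ℝ φ z - fderiv ℝ φ x₀‖ < a / 4 := by
    have := (hcont.tendsto x₀).eventually (ball_mem_nhds _ (show 0 < a / 4 by positivity))
    simpa [dist_eq_norm] using this
  obtain ⟨R₁, hR₁, hball⟩ := Metric.eventually_nhds_iff_ball.1 (hev.and hnear)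
  set R := min R₀ R₁ with hR
  have hRpos : 0 < R := lt_min hR₀ hR₁
  have hsub : ∀ z ∈ ball x₀ R, z ∈ ball x₀ R₁ := fun z hz =>
    ball_subset_ball (min_le_right _ _) hz
  set τ := R / 4 with hτ
  have hτ0 : 0 < τ := by positivity
  set e : E3 := -(a⁻¹ • g) with he
  have hen : ‖e‖ = 1 := by
    rw [he, norm_neg, norm_smul, norm_inv, norm_norm, inv_mul_cancel₀ ha0.ne']
  have hfe : fderiv ℝ φ x₀ e = -a := by
    rw [fderiv_eq_inner_gradient, ← hgdef, he, inner_neg_right, inner_smul_right,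
      real_inner_self_eq_norm_sq, ← ha]
    field_simp
  have hfn : ‖fderiv ℝ φ x₀‖ ≤ a := by
    refine ContinuousLinearMap.opNorm_le_bound _ ha0.le fun y => ?_
    rw [fderiv_eq_inner_gradient]
    exact norm_inner_le_norm _ _
  have hdesc : ∀ z ∈ ball x₀ R, ∀ y ∈ closedBall (τ • e) (τ / 4),
      fderiv ℝ φ z y ≤ -(τ * a / 4) := by
    intro z hz y hy
    rw [mem_closedBall, dist_eq_norm] at hy
    have h1 := (hball z (hsub z hz)).2.le
    have hsplit : fderiv ℝ φ z y = fderiv ℝ φ x₀ (τ • e) + fderiv ℝ φ x₀ (y - τ • e)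
        + (fderiv ℝ φ z - fderiv ℝ φ x₀) y := by
      simp only [map_sub, sub_apply]; ring
    have hyn : ‖y‖ ≤ τ + τ / 4 := by
      calc ‖y‖ = ‖(y - τ • e) + τ • e‖ := by simp
        _ ≤ ‖y - τ • e‖ + ‖τ • e‖ := norm_add_le _ _
        _ ≤ τ / 4 + τ := by
          rw [norm_smul, hen, mul_one, Real.norm_of_nonneg hτ0.le]; linarith
        _ = _ := by ring
    have t1 : fderiv ℝ φ x₀ (τ • e) = -(τ * a) := by rw [map_smul, hfe]; simp
    have t2 : fderiv ℝ φ x₀ (y - τ • e) ≤ a * (τ / 4) :=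
      (le_abs_self _).trans ((ContinuousLinearMap.le_opNorm _ _).trans
        (mul_le_mul hfn hy (norm_nonneg _) ha0.le))
    have t3 : (fderiv ℝ φ z - fderiv ℝ φ x₀) y ≤ a / 4 * (τ + τ / 4) :=
      (le_abs_self _).trans ((ContinuousLinearMap.le_opNorm _ _).trans
        (mul_le_mul h1 hyn (norm_nonneg _) (by positivity)))
    rw [hsplit, t1]
    nlinarith [mul_pos hτ0 ha0]
  refine ⟨R, τ, τ • e, τ / 4, τ * a / 4, min_le_left _ _, hφ, hτ0, by positivity, by positivity,
    ?_, fun y hy => (hball y (hsub y hy)).1, fun y hy h0 => ?_, hdesc⟩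
  · rw [norm_smul, hen, mul_one, Real.norm_of_nonneg hτ0.le, hτ]; linarith
  · have h2 := hdesc y hy (τ • e) (mem_closedBall_self (by positivity))
    rw [fderiv_eq_inner_gradient, h0, inner_zero_left] at h2
    have : 0 < τ * a / 4 := by positivity
    linarith

namespace IsBoundaryChart

variable {Ω : Set E3} {x₀ b : E3} {φ : E3 → ℝ} {R r ρ c : ℝ}

theorem add_smul_mem_ball (h : IsBoundaryChart Ω x₀ φ R r b ρ c) {x : E3} (hx : dist x x₀ < r)
    {s : ℝ} (hs : s ∈ Icc (0 : ℝ) 1) {y : E3} (hy : y ∈ closedBall b ρ) :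
    x + s • y ∈ ball x₀ R := by
  rw [mem_ball, dist_eq_norm] at *
  rw [mem_closedBall, dist_eq_norm] at hy
  have hyn : ‖y‖ ≤ ‖b‖ + ρ := by
    calc ‖y‖ = ‖(y - b) + b‖ := by simp
      _ ≤ _ := (norm_add_le _ _).trans (by linarith)
  have hsy : ‖s • y‖ ≤ ‖b‖ + ρ := by
    rw [norm_smul, Real.norm_of_nonneg hs.1]
    nlinarith [hs.1, hs.2, norm_nonneg y]
  calc ‖x + s • y - x₀‖ = ‖(x - x₀) + s • y‖ := by congr 1; abel
    _ ≤ ‖x - x₀‖ + ‖s • y‖ := norm_add_le _ _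
    _ < r + (‖b‖ + ρ) := add_lt_add_of_lt_of_le hx hsy
    _ ≤ R := by linarith [h.radius_le]

theorem r_lt (h : IsBoundaryChart Ω x₀ φ R r b ρ c) : r < R := by
  have := h.radius_le
  have := h.rho_pos
  have := norm_nonneg b
  linarith

/-- Along a segment in a descent direction, `φ` decreases at rate at least `c`. -/
theorem le_sub_of_segment (h : IsBoundaryChart Ω x₀ φ R r b ρ c) {x y : E3} {s : ℝ} (hs : 0 ≤ s)
    (hy : y ∈ closedBall b ρ) (hmem : ∀ τ ∈ Icc 0 s, x + τ • y ∈ ball x₀ R) :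
    φ (x + s • y) ≤ φ x - c * s := by
  have hder : ∀ τ : ℝ, HasDerivAt (fun τ : ℝ => φ (x + τ • y)) (fderiv ℝ φ (x + τ • y) y) τ := by
    intro τ
    have h1 : HasDerivAt (fun s : ℝ => x + s • y) y τ := by
      simpa using ((hasDerivAt_id τ).smul_const y).const_add x
    exact ((h.smooth.differentiable (by simp) _).hasFDerivAt).comp_hasDerivAt τ h1
  have := (convex_Icc (0 : ℝ) s).image_sub_le_mul_sub_of_deriv_le
    (f := fun τ : ℝ => φ (x + τ • y)) (C := -c)
    (fun τ _ => (hder τ).continuousAt.continuousWithinAt)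
    (fun τ _ => (hder τ).differentiableAt.differentiableWithinAt)
    (fun τ hτ => by
      rw [(hder τ).deriv]
      exact h.descent _ (hmem τ (interior_subset hτ)) y hy)
    0 (left_mem_Icc.2 hs) s (right_mem_Icc.2 hs) hs
  simp only [zero_smul, add_zero, sub_zero] at this
  linarith

theorem nonpos_of_mem_closure (h : IsBoundaryChart Ω x₀ φ R r b ρ c) {x : E3}
    (hx : x ∈ closure Ω) (hxR : x ∈ ball x₀ R) : φ x ≤ 0 := by
  have h1 : x ∈ closure (Ω ∩ ball x₀ R) := by
    rw [inter_comm]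
    exact isOpen_ball.inter_closure ⟨hxR, hx⟩
  have h2 : Ω ∩ ball x₀ R ⊆ {y | φ y ≤ 0} := fun y hy => ((h.mem_iff y hy.2).1 hy.1).le
  exact closure_minimal h2 (isClosed_le h.smooth.continuous continuous_const) h1

theorem hasInteriorCone (h : IsBoundaryChart Ω x₀ φ R r b ρ c) :
    HasInteriorCone Ω x₀ r b ρ := by
  refine ⟨h.r_pos, h.rho_pos, fun x hx hxr s hs y hy => ?_⟩
  have hm : ∀ τ ∈ Icc 0 s, x + τ • y ∈ ball x₀ R := fun τ hτ =>
    h.add_smul_mem_ball hxr ⟨hτ.1, hτ.2.trans hs.2⟩ hy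
  have h1 := h.le_sub_of_segment hs.1.le hy hm
  have h2 := h.nonpos_of_mem_closure hx (mem_ball.2 (hxr.trans h.r_lt))
  refine (h.mem_iff _ (hm s (right_mem_Icc.2 hs.1.le))).2 ?_
  have := mul_pos h.c_pos hs.1
  linarith

end IsBoundaryChart

theorem IsSmoothSimplyConnectedDomain.exists_hasInteriorCone {Ω : Set E3}
    (hΩ : IsSmoothSimplyConnectedDomain Ω) {x : E3} (hx : x ∈ closure Ω) :
    ∃ r b ρ, HasInteriorCone Ω x r b ρ := by
  by_cases hxΩ : x ∈ Ω
  · exact exists_hasInteriorCone_of_mem hΩ.isOpen hxΩ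
  · obtain ⟨φ, hφ⟩ := hΩ.smooth_boundary x
      (by rw [hΩ.isOpen.frontier_eq]; exact ⟨hx, hxΩ⟩)
    obtain ⟨R, r, b, ρ, c, -, hch⟩ := hφ.exists_isBoundaryChart one_pos
    exact ⟨r, b, ρ, hch.hasInteriorCone⟩

/-- Cones are convex. -/
theorem HasInteriorCone.segment_subset {Ω : Set E3} {x₀ b p : E3} {r ρ : ℝ}
    (hc : HasInteriorCone Ω x₀ r b ρ) (hp : p ∈ closure Ω) (hpr : dist p x₀ < r) {s₁ s₂ : ℝ}
    (hs₁ : s₁ ∈ Ioc (0 : ℝ) 1) (hs₂ : s₂ ∈ Ioc (0 : ℝ) 1) {y₁ y₂ : E3}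
    (hy₁ : y₁ ∈ closedBall b ρ) (hy₂ : y₂ ∈ closedBall b ρ) :
    segment ℝ (p + s₁ • y₁) (p + s₂ • y₂) ⊆ Ω := by
  rintro _ ⟨α, β, hα, hβ, hαβ, rfl⟩
  set t := α * s₁ + β * s₂ with ht
  have ht0 : 0 < t := by
    rcases hα.eq_or_lt with h | h
    · have : β = 1 := by linarith
      rw [ht, ← h, this]; linarith [hs₂.1]
    · have := mul_pos h hs₁.1
      have := mul_nonneg hβ hs₂.1.le
      linarith
  have ht1 : t ≤ 1 := by
    calc t ≤ α * 1 + β * 1 := by rw [ht]; gcongr; exacts [hs₁.2, hs₂.2]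
      _ = 1 := by linarith
  have hw : (α * s₁ / t) • y₁ + (β * s₂ / t) • y₂ ∈ closedBall b ρ :=
    (convex_closedBall b ρ) hy₁ hy₂ (by have := hs₁.1; positivity) (by have := hs₂.1; positivity)
      (by rw [← add_div, ← ht, div_self ht0.ne'])
  have := hc.mem p hp hpr t ⟨ht0, ht1⟩ _ hw
  convert this using 1
  have e1 : t * (α * s₁ / t) = α * s₁ := by field_simp
  have e2 : t * (β * s₂ / t) = β * s₂ := by field_simp
  rw [smul_add t, smul_smul, smul_smul, e1, e2, smul_add, smul_add, smul_smul, smul_smul]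
  have : p = α • p + β • p := by rw [← add_smul, hαβ, one_smul]
  nth_rewrite 3 [this]
  abel

/-- A field that is Lipschitz (off a null set) in the cone at a boundary point `p` is close to its
boundary value at `p`: the cone fills a fixed proportion of each ball around `p`, so that averages
over the cone also converge. -/
theorem HasInteriorCone.norm_sub_boundaryValue_le {Ω : Set E3} {x₀ b p : E3}
    {r ρ : ℝ} (hc : HasInteriorCone Ω x₀ r b ρ) (hp : p ∈ closure Ω) (hpr : dist p x₀ < r)
    {u : E3 → E3} {S : Set E3} {L : ℝ} (hL : 0 ≤ L) (hS : ∀ᵐ x ∂volume.restrict Ω, x ∈ S)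
    (hLip : ∀ x ∈ S, ∀ y ∈ S, segment ℝ x y ⊆ Ω → ‖u x - u y‖ ≤ L * ‖x - y‖)
    {v : E3} (hv : HasBoundaryValue Ω u p v) {s : ℝ} (hs : s ∈ Ioc (0 : ℝ) 1)
    (hyS : p + s • b ∈ S) : ‖u (p + s • b) - v‖ ≤ L * ‖s • b‖ := by
  by_contra! hcon
  set y := p + s • b with hy
  have hbb : b ∈ closedBall b ρ := mem_closedBall_self hc.rho_pos.le
  set η := ‖u y - v‖ - L * ‖s • b‖ with hη
  have hη0 : 0 < η := by rw [hη]; linarith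
  -- In the ball of radius `t` around `p`, the copy `p + σ closedBall b ρ` of the base of the cone,
  -- `σ = t / m`, has the fraction `(ρ / m)³` of the volume. If the claim failed by `η`, the
  -- average of `|u - v|` over the ball would be at least `(η / 2) (ρ / m)³`.
  set m := 2 * (‖b‖ + ρ) with hm
  have hm0 : 0 < m := by have := hc.rho_pos; positivity
  have hκ : 0 < ENNReal.ofReal (η / 2) * ENNReal.ofReal ((ρ / m) ^ 3) := by
    have := hc.rho_pos
    refine ENNReal.mul_pos ?_ ?_ <;> simp only [ne_eq, ENNReal.ofReal_eq_zero, not_le] <;> positivity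
  have hsmall := hv.eventually (gt_mem_nhds hκ)
  have hr1 : ∀ᶠ t : ℝ in 𝓝[>] 0, t < m := mem_nhdsWithin_of_mem_nhds (Iio_mem_nhds hm0)
  have hr2 : ∀ᶠ t : ℝ in 𝓝[>] 0, t < η / (2 * (L + 1)) :=
    mem_nhdsWithin_of_mem_nhds (Iio_mem_nhds (by positivity))
  obtain ⟨t, ht, htm, htη, ht0⟩ :=
    (hsmall.and (hr1.and (hr2.and self_mem_nhdsWithin))).exists
  replace ht0 : 0 < t := ht0
  refine absurd ht (not_lt.2 ?_)
  set σ := t / m with hσ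
  have hσ0 : 0 < σ := by positivity
  have hσ1 : σ ≤ 1 := by rw [hσ, div_le_one hm0]; exact htm.le
  set D := closedBall (p + σ • b) (σ * ρ) with hD
  have hDrep : ∀ z ∈ D, ∃ w ∈ closedBall b ρ, z = p + σ • w := by
    intro z hz
    refine ⟨σ⁻¹ • (z - p), ?_, ?_⟩
    · rw [hD, mem_closedBall, dist_eq_norm] at hz
      rw [mem_closedBall, dist_eq_norm]
      have : σ⁻¹ • (z - p) - b = σ⁻¹ • (z - (p + σ • b)) := by
        rw [smul_sub σ⁻¹ z (p + σ • b), smul_add, smul_smul, inv_mul_cancel₀ hσ0.ne', one_smul,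
          smul_sub]
        abel
      rw [this, norm_smul, norm_inv, Real.norm_of_nonneg hσ0.le, inv_mul_le_iff₀ hσ0]
      exact hz
    · rw [smul_smul, mul_inv_cancel₀ hσ0.ne', one_smul]; abel
  have hDt : ∀ z ∈ D, ‖z - p‖ < t := by
    intro z hz
    obtain ⟨w, hw, rfl⟩ := hDrep z hz
    have hwn : ‖w‖ ≤ ‖b‖ + ρ := by
      rw [mem_closedBall, dist_eq_norm] at hw
      calc ‖w‖ = ‖(w - b) + b‖ := by simp
        _ ≤ _ := (norm_add_le _ _).trans (by linarith)
    rw [add_sub_cancel_left, norm_smul, Real.norm_of_nonneg hσ0.le]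
    calc σ * ‖w‖ ≤ σ * (‖b‖ + ρ) := by gcongr
      _ = t / 2 := by rw [show ‖b‖ + ρ = m / 2 by rw [hm]; ring, hσ]; field_simp
      _ < t := by linarith
  have hDΩ : D ⊆ Ω := by
    intro z hz
    obtain ⟨w, hw, rfl⟩ := hDrep z hz
    exact hc.mem p hp hpr σ ⟨hσ0, hσ1⟩ w hw
  have hDsub : D ⊆ ball p t ∩ Ω := fun z hz =>
    ⟨by rw [mem_ball, dist_eq_norm]; exact hDt z hz, hDΩ hz⟩
  have hDm : MeasurableSet D := isClosed_closedBall.measurableSet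
  have hlow : ∀ᵐ z ∂volume.restrict D, ENNReal.ofReal (η / 2) ≤ ‖u z - v‖ₑ := by
    filter_upwards [ae_mono (Measure.restrict_mono hDΩ le_rfl) hS, ae_restrict_mem hDm]
      with z hzS hzD
    rw [← ofReal_norm]
    refine ENNReal.ofReal_le_ofReal ?_
    have hseg : segment ℝ z y ⊆ Ω := by
      obtain ⟨w, hw, rfl⟩ := hDrep z hzD
      exact hc.segment_subset hp hpr ⟨hσ0, hσ1⟩ hs hw hbb
    have h1 := hLip z hzS y hyS hseg
    have h2 : ‖z - y‖ ≤ ‖s • b‖ + t := by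
      calc ‖z - y‖ = ‖(z - p) - s • b‖ := by rw [hy]; congr 1; abel
        _ ≤ ‖z - p‖ + ‖s • b‖ := norm_sub_le _ _
        _ ≤ _ := by linarith [hDt z hzD]
    have h3 : ‖u y - v‖ ≤ ‖u z - v‖ + ‖u z - u y‖ := by
      calc ‖u y - v‖ = ‖(u z - v) - (u z - u y)‖ := by congr 1; abel
        _ ≤ _ := norm_sub_le _ _
    have h4 : L * ‖z - y‖ ≤ L * ‖s • b‖ + L * t := by
      rw [← mul_add]; exact mul_le_mul_of_nonneg_left h2 hL
    have h5 : L * t ≤ η / 2 := by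
      rw [lt_div_iff₀ (by positivity)] at htη
      nlinarith
    linarith [hη]
  have hvol : volume D = ENNReal.ofReal ((ρ / m) ^ 3) * volume (ball p t) := by
    rw [hD, Measure.addHaar_closedBall _ _ (mul_nonneg hσ0.le hc.rho_pos.le),
      Measure.addHaar_ball _ _ ht0.le, ← mul_assoc, ← ENNReal.ofReal_mul
        (by have := hc.rho_pos; positivity)]
    congr 2
    rw [show Module.finrank ℝ E3 = 3 by simp, hσ]
    ring
  have hballpos : volume (ball p t) ≠ 0 := (measure_ball_pos volume p ht0).ne'
  have hballfin : volume (ball p t) ≠ ⊤ := measure_ball_lt_top.ne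
  rw [laverage_eq, Measure.restrict_apply_univ]
  calc ENNReal.ofReal (η / 2) * ENNReal.ofReal ((ρ / m) ^ 3)
      = ENNReal.ofReal (η / 2) * volume D / volume (ball p t) := by
        rw [hvol, ← mul_assoc, ENNReal.mul_div_cancel_right hballpos hballfin]
    _ ≤ (∫⁻ z in D, ‖u z - v‖ₑ) / volume (ball p t) := by
        gcongr
        calc ENNReal.ofReal (η / 2) * volume D = ∫⁻ _ in D, ENNReal.ofReal (η / 2) := by simp
          _ ≤ _ := lintegral_mono_ae hlow
    _ ≤ (∫⁻ z in ball p t ∩ Ω, ‖u z - v‖ₑ) / volume (ball p t ∩ Ω) := by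
        refine ENNReal.div_le_div (lintegral_mono_set hDsub) (measure_mono inter_subset_left)

/-! ### The divergence theorem for tangential Lipschitz fields -/

theorem norm_le_sum_abs (w : E3) : ‖w‖ ≤ ∑ i, |w i| := by
  have hw : w = ∑ i, w i • EuclideanSpace.single i (1 : ℝ) := by
    have := (EuclideanSpace.basisFun (Fin 3) ℝ).sum_repr w
    simpa using this.symm
  conv_lhs => rw [hw]
  refine (norm_sum_le _ _).trans (le_of_eq ?_)
  simp [norm_smul]

theorem fderiv_apply_eq_sum (φ : E3 → ℝ) (x w : E3) :
    fderiv ℝ φ x w = ∑ i, w i * partialDeriv i φ x := by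
  have hw : w = ∑ i, w i • EuclideanSpace.single i (1 : ℝ) := by
    have := (EuclideanSpace.basisFun (Fin 3) ℝ).sum_repr w
    simpa using this.symm
  conv_lhs => rw [hw, map_sum]
  simp [partialDeriv]

/-- Vector version of `exists_lipschitz_of_weakPartial_bdd`. -/
theorem exists_lipschitz_field {Ω : Set E3} (hΩ : IsOpen Ω) {u : E3 → E3}
    {g : Fin 3 → Fin 3 → E3 → ℝ} {M : ℝ} (hM : 0 ≤ M)
    (hu : ∀ i, IntegrableOn (fun y => u y i) Ω)
    (hw : ∀ i j, HasWeakPartial Ω j (fun y => u y i) (g i j))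
    (hg : ∀ i j, ∀ᵐ x ∂volume.restrict Ω, |g i j x| ≤ M) :
    ∃ S : Set E3, (∀ᵐ x ∂volume.restrict Ω, x ∈ S) ∧ ∀ x ∈ S, ∀ y ∈ S, segment ℝ x y ⊆ Ω →
      ‖u x - u y‖ ≤ 9 * M * ‖x - y‖ := by
  choose S hS hSL using fun i => exists_lipschitz_of_weakPartial_bdd hΩ hM (hu i) (hw i) (hg i)
  refine ⟨⋂ i, S i, ?_, fun x hx y hy hxy => ?_⟩
  · filter_upwards [ae_all_iff.2 hS] with x hx using mem_iInter.2 hx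
  · refine (norm_le_sum_abs _).trans ?_
    calc ∑ i, |(u x - u y) i| ≤ ∑ _i : Fin 3, 3 * M * ‖x - y‖ :=
          Finset.sum_le_sum fun i _ => hSL i x (mem_iInter.1 hx i) y (mem_iInter.1 hy i) hxy
      _ = 9 * M * ‖x - y‖ := by simp; ring

/-- For a Lipschitz field `u` tangential to `∂Ω`, the derivative of a defining function `φ` along
`u` vanishes at the rate of `φ` itself. A point `y` near the boundary is compared with the boundary
point `p` met when leaving `Ω` in the direction opposite to the axis of the cone. -/
theorem exists_abs_fderiv_apply_le {Ω : Set E3} (hΩ : IsSmoothSimplyConnectedDomain Ω)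
    {u : E3 → E3} {L U : ℝ} (hL : 0 ≤ L) (hU : ∀ᵐ x ∂volume.restrict Ω, ‖u x‖ ≤ U)
    {S : Set E3} (hS : ∀ᵐ x ∂volume.restrict Ω, x ∈ S)
    (hLip : ∀ x ∈ S, ∀ y ∈ S, segment ℝ x y ⊆ Ω → ‖u x - u y‖ ≤ L * ‖x - y‖)
    (hn : NormalComponentVanishes Ω u) {x₀ : E3} (hx₀ : x₀ ∈ frontier Ω) :
    ∃ (φ : E3 → ℝ) (r C : ℝ), ContDiff ℝ ∞ φ ∧ 0 < r ∧ 0 ≤ C ∧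
      (∀ y ∈ ball x₀ r, (y ∈ Ω ↔ φ y < 0)) ∧
      ∀ᵐ y ∂volume.restrict Ω, y ∈ ball x₀ r → |fderiv ℝ φ y (u y)| ≤ C * |φ y| := by
  obtain ⟨φ, hφd⟩ := hΩ.smooth_boundary x₀ hx₀
  have hφ := hφd.1
  have hφ' : ContDiff ℝ 1 (fderiv ℝ φ) := hφ.fderiv_right (by norm_cast)
  obtain ⟨Λ, t, ht, hΛ⟩ := hφ'.contDiffAt.exists_lipschitzOnWith (x := x₀)
  obtain ⟨R₀, hR₀, hR₀t⟩ := Metric.mem_nhds_iff.1 ht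
  obtain ⟨R, r, b, ρ, c, hRR, hch⟩ := hφd.exists_isBoundaryChart hR₀
  have hΛR : ∀ y ∈ ball x₀ R, ∀ z ∈ ball x₀ R,
      ‖fderiv ℝ φ y - fderiv ℝ φ z‖ ≤ Λ * ‖y - z‖ := by
    intro y hy z hz
    have := hΛ.dist_le_mul y (hR₀t (ball_subset_ball hRR hy)) z (hR₀t (ball_subset_ball hRR hz))
    simpa [dist_eq_norm] using this
  have hx₀R : x₀ ∈ ball x₀ R := mem_ball_self (hch.r_pos.trans hch.r_lt)
  set B := ‖fderiv ℝ φ x₀‖ + Λ * R with hB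
  have hBb : ∀ y ∈ ball x₀ R, ‖fderiv ℝ φ y‖ ≤ B := by
    intro y hy
    have h1 := hΛR y hy x₀ hx₀R
    have h2 : ‖y - x₀‖ ≤ R := by rw [← dist_eq_norm]; exact (mem_ball.1 hy).le
    calc ‖fderiv ℝ φ y‖ = ‖(fderiv ℝ φ y - fderiv ℝ φ x₀) + fderiv ℝ φ x₀‖ := by simp
      _ ≤ Λ * ‖y - x₀‖ + ‖fderiv ℝ φ x₀‖ := (norm_add_le _ _).trans (by gcongr)
      _ ≤ B := by rw [hB, add_comm]; gcongr
  have hφ0 : φ x₀ = 0 := by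
    have h1 := hch.nonpos_of_mem_closure (frontier_subset_closure hx₀) hx₀R
    have h2 : ¬ φ x₀ < 0 := fun h => by
      have := (hch.mem_iff x₀ hx₀R).2 h
      rw [hΩ.isOpen.frontier_eq] at hx₀
      exact hx₀.2 this
    linarith
  have hrp := hch.r_pos
  have hcp := hch.c_pos
  -- The exit time is at most `|φ y| / c`, and it is below `δ` for `y` close to `x₀`.
  set δ := min 1 (r / 2 / (‖b‖ + 1)) with hδ
  have hδ0 : 0 < δ := lt_min one_pos (by positivity)
  have hsmall : ∀ᶠ y in 𝓝 x₀, |φ y| < c * δ := by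
    have h1 : Tendsto (fun y => |φ y|) (𝓝 x₀) (𝓝 |φ x₀|) := (hφ.continuous.abs).tendsto x₀
    rw [hφ0, abs_zero] at h1
    exact h1.eventually (gt_mem_nhds (by positivity))
  obtain ⟨r₁, hr₁, hr₁b⟩ := Metric.eventually_nhds_iff_ball.1 hsmall
  set r' := min (r / 2) r₁ with hr'
  have hr'0 : 0 < r' := lt_min (by positivity) hr₁
  have hr'r : r' ≤ r / 2 := min_le_left _ _
  have hb0 : b ∈ closedBall b ρ := mem_closedBall_self hch.rho_pos.le
  have hU' : ∀ᵐ x ∂volume.restrict Ω, ‖u x‖ ≤ max U 0 := by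
    filter_upwards [hU] with x hx using hx.trans (le_max_left _ _)
  have hB0 : 0 ≤ B := (norm_nonneg _).trans (hBb x₀ hx₀R)
  have hU0 : 0 ≤ max U 0 := le_max_right _ _
  refine ⟨φ, r', (B * L + Λ * (max U 0 + L * ‖b‖)) * (‖b‖ / c), hφ, hr'0, by positivity,
    fun y hy => hch.mem_iff y (ball_subset_ball (by linarith [hch.r_lt]) hy), ?_⟩
  filter_upwards [hU', hS, ae_restrict_mem hΩ.isOpen.measurableSet] with y hyU hyS hyΩ hyr
  have hyr2 : dist y x₀ < r / 2 := (mem_ball.1 hyr).trans_le hr'r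
  have hyR : y ∈ ball x₀ R := mem_ball.2 (by linarith [hch.r_lt])
  have hφy : φ y < 0 := (hch.mem_iff y hyR).1 hyΩ
  have hφyδ : |φ y| < c * δ := hr₁b y (ball_subset_ball (min_le_right _ _) hyr)
  set s₁ := |φ y| / c with hs₁
  have hs₁0 : 0 < s₁ := div_pos (abs_pos.2 hφy.ne) hcp
  have hs₁δ : s₁ < δ := by rw [hs₁, div_lt_iff₀ hcp]; linarith
  have hs₁1 : s₁ ≤ 1 := hs₁δ.le.trans (min_le_left _ _)
  -- Points on the exit segment stay in the chart.
  have hin : ∀ s ∈ Icc 0 s₁, dist (y - s • b) x₀ < r := by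
    intro s hs
    have h1 : s * ‖b‖ ≤ r / 2 := by
      have h2 : s ≤ r / 2 / (‖b‖ + 1) := hs.2.trans (hs₁δ.le.trans (min_le_right _ _))
      rw [le_div_iff₀ (by positivity)] at h2
      nlinarith [hs.1]
    rw [dist_eq_norm] at hyr2 ⊢
    calc ‖y - s • b - x₀‖ = ‖(y - x₀) - s • b‖ := by congr 1; abel
      _ ≤ ‖y - x₀‖ + ‖s • b‖ := norm_sub_le _ _
      _ < r := by rw [norm_smul, Real.norm_of_nonneg hs.1]; linarith
  have hend : 0 ≤ φ (y - s₁ • b) := by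
    have h1 := hch.le_sub_of_segment (x := y - s₁ • b) hs₁0.le hb0 (fun τ hτ =>
      hch.add_smul_mem_ball (hin s₁ (right_mem_Icc.2 hs₁0.le)) ⟨hτ.1, hτ.2.trans hs₁1⟩ hb0)
    rw [sub_add_cancel] at h1
    have h2 : c * s₁ = -φ y := by
      rw [hs₁, abs_of_neg hφy]; field_simp
    linarith
  obtain ⟨s, hs, hφs⟩ : (0 : ℝ) ∈ (fun s : ℝ => φ (y - s • b)) '' Icc 0 s₁ := by
    refine intermediate_value_Icc hs₁0.le
      (hφ.continuous.comp (by fun_prop : Continuous fun s : ℝ => y - s • b)).continuousOn ⟨?_, hend⟩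
    simpa using hφy.le
  simp only at hφs
  have hs0 : 0 < s := by
    rcases hs.1.eq_or_lt with h | h
    · rw [← h, zero_smul, sub_zero] at hφs; linarith
    · exact h
  have hs1 : s ≤ 1 := hs.2.trans hs₁1
  set p := y - s • b with hp
  have hpr : dist p x₀ < r := hin s hs
  have hpR : p ∈ ball x₀ R := mem_ball.2 (hpr.trans hch.r_lt)
  have hyp : p + s • b = y := by rw [hp, sub_add_cancel]
  have hpcl : p ∈ closure Ω := by
    have h1 : Tendsto (fun τ : ℝ => p + τ • b) (𝓝[>] 0) (𝓝 p) := by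
      have : Continuous fun τ : ℝ => p + τ • b := by fun_prop
      have h2 := this.tendsto 0
      rw [zero_smul, add_zero] at h2
      exact h2.mono_left nhdsWithin_le_nhds
    refine mem_closure_of_tendsto h1 ?_
    filter_upwards [Ioc_mem_nhdsGT hs0] with τ hτ
    have hm : ∀ σ ∈ Icc 0 τ, p + σ • b ∈ ball x₀ R := fun σ hσ =>
      hch.add_smul_mem_ball hpr ⟨hσ.1, hσ.2.trans (hτ.2.trans hs1)⟩ hb0
    have h3 := hch.le_sub_of_segment hτ.1.le hb0 hm
    refine (hch.mem_iff _ (hm τ (right_mem_Icc.2 hτ.1.le))).2 ?_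
    have := mul_pos hcp hτ.1
    linarith
  have hpfr : p ∈ frontier Ω := by
    rw [hΩ.isOpen.frontier_eq]
    exact ⟨hpcl, fun h => by have := (hch.mem_iff p hpR).1 h; linarith⟩
  obtain ⟨v, hv, hvn⟩ := hn p hpfr
  have hgp := hch.gradient_ne p hpR
  have hvφ : fderiv ℝ φ p v = 0 := by
    have h1 := hvn (‖gradient φ p‖⁻¹ • gradient φ p) ⟨φ, ⟨hφ, hgp, by
      filter_upwards [isOpen_ball.mem_nhds hpR] with z hz using hch.mem_iff z hz⟩, rfl⟩
    rw [inner_smul_right, mul_eq_zero] at h1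
    rcases h1 with h1 | h1
    · exact absurd h1 (inv_ne_zero (norm_ne_zero_iff.2 hgp))
    · rw [fderiv_eq_inner_gradient, real_inner_comm]; exact h1
  have htr := hch.hasInteriorCone.norm_sub_boundaryValue_le hpcl hpr hL hS hLip hv ⟨hs0, hs1⟩
    (by rw [hyp]; exact hyS)
  rw [hyp, norm_smul, Real.norm_of_nonneg hs0.le] at htr
  have hvb : ‖v‖ ≤ max U 0 + L * ‖b‖ := by
    calc ‖v‖ = ‖u y - (u y - v)‖ := by simp
      _ ≤ ‖u y‖ + ‖u y - v‖ := norm_sub_le _ _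
      _ ≤ max U 0 + L * ‖b‖ := by
        refine add_le_add hyU (htr.trans ?_)
        gcongr
        exact mul_le_of_le_one_left (norm_nonneg b) hs1
  -- With `v` the boundary value at `p`, so that `∇φ(p) · v = 0`, both terms are of the order of
  -- `|y - p|`, hence of `|φ y|`.
  have hsplit : fderiv ℝ φ y (u y)
      = fderiv ℝ φ y (u y - v) + (fderiv ℝ φ y - fderiv ℝ φ p) v := by
    rw [map_sub, sub_apply, hvφ]; ring
  have e1 : |fderiv ℝ φ y (u y - v)| ≤ B * (L * (s * ‖b‖)) :=
    ((fderiv ℝ φ y).le_opNorm _).trans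
      (mul_le_mul (hBb y hyR) htr (norm_nonneg _) hB0)
  have e2 : |(fderiv ℝ φ y - fderiv ℝ φ p) v| ≤ Λ * (s * ‖b‖) * (max U 0 + L * ‖b‖) := by
    refine ((fderiv ℝ φ y - fderiv ℝ φ p).le_opNorm v).trans
      (mul_le_mul ?_ hvb (norm_nonneg _) (by positivity))
    refine (hΛR y hyR p hpR).trans (le_of_eq ?_)
    rw [show y - p = s • b by rw [hp]; abel, norm_smul, Real.norm_of_nonneg hs0.le]
  calc |fderiv ℝ φ y (u y)| ≤ B * (L * (s * ‖b‖)) + Λ * (s * ‖b‖) * (max U 0 + L * ‖b‖) := by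
        rw [hsplit]; exact (abs_add_le _ _).trans (add_le_add e1 e2)
    _ = (B * L + Λ * (max U 0 + L * ‖b‖)) * ‖b‖ * s := by ring
    _ ≤ (B * L + Λ * (max U 0 + L * ‖b‖)) * ‖b‖ * s₁ := by gcongr; exact hs.2
    _ = _ := by rw [hs₁]; ring

theorem exists_bound_deriv_smoothTransition :
    ∃ K : ℝ, 0 ≤ K ∧ (∀ x, |deriv Real.smoothTransition x| ≤ K) ∧
      (∀ x, x < 0 ∨ 1 < x → deriv Real.smoothTransition x = 0) := by
  have hcd : ContDiff ℝ 1 Real.smoothTransition := Real.smoothTransition.contDiff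
  have hzero : ∀ x, x < 0 ∨ 1 < x → deriv Real.smoothTransition x = 0 := by
    rintro x (hx | hx)
    · have : Real.smoothTransition =ᶠ[𝓝 x] fun _ => 0 := by
        filter_upwards [Iio_mem_nhds hx] with y hy
        exact Real.smoothTransition.zero_of_nonpos (le_of_lt hy)
      rw [this.deriv_eq, deriv_const]
    · have : Real.smoothTransition =ᶠ[𝓝 x] fun _ => 1 := by
        filter_upwards [Ioi_mem_nhds hx] with y hy
        exact Real.smoothTransition.one_of_one_le (le_of_lt hy)
      rw [this.deriv_eq, deriv_const]
  obtain ⟨K, hK⟩ := isCompact_Icc.exists_bound_of_continuousOn (s := Icc (0 : ℝ) 1)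
    (hcd.continuous_deriv le_rfl).continuousOn
  refine ⟨max K 0, le_max_right _ _, fun x => ?_, hzero⟩
  by_cases hx : x ∈ Icc (0 : ℝ) 1
  · exact (hK x hx).trans (le_max_left _ _)
  · rw [hzero x (by simpa [mem_Icc, imp_iff_not_or, or_comm, not_le] using hx), abs_zero]
    exact le_max_right _ _

/-- Near a boundary point, a field `G u` with `u` tangential and Lipschitz can be tested against
functions that do not vanish on the boundary: cut off by a function of `φ / ε`, where `φ` is the
defining function; the flux through the boundary layer is bounded, over a layer whose measure tends
to zero. -/
theorem integral_div_mul_of_flux_bound {Ω : Set E3} (hΩ : IsOpen Ω) (hfin : volume Ω ≠ ⊤)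
    {u : E3 → E3} {G : E3 → ℝ} {CG : ℝ} (hG : ∀ᵐ x ∂volume.restrict Ω, |G x| ≤ CG)
    {D : Fin 3 → E3 → ℝ} (hD : ∀ j, HasWeakPartial Ω j (fun y => G y * u y j) (D j))
    (hWi : ∀ j, IntegrableOn (fun y => G y * u y j) Ω) (hDi : ∀ j, IntegrableOn (D j) Ω)
    {φ : E3 → ℝ} {x₀ : E3} {r C : ℝ} (hφ : ContDiff ℝ ∞ φ) (hC : 0 ≤ C)
    (hmem : ∀ y ∈ ball x₀ r, (y ∈ Ω ↔ φ y < 0))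
    (hflux : ∀ᵐ y ∂volume.restrict Ω, y ∈ ball x₀ r → |fderiv ℝ φ y (u y)| ≤ C * |φ y|)
    {χ : E3 → ℝ} (hχ : ContDiff ℝ ∞ χ) (hχc : HasCompactSupport χ) (hχs : tsupport χ ⊆ ball x₀ r) :
    ∫ x in Ω, (∑ j, G x * u x j * partialDeriv j χ x) = -∫ x in Ω, (∑ j, D j x) * χ x := by
  have hfinm : IsFiniteMeasure (volume.restrict Ω) := isFiniteMeasure_restrict.2 hfin
  have hΩm := hΩ.measurableSet
  obtain ⟨K, hK0, hK, hKz⟩ := exists_bound_deriv_smoothTransition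
  obtain ⟨Cχ, hCχ⟩ := hχc.exists_bound_of_continuous hχ.continuous
  have hCχ0 : 0 ≤ Cχ := (norm_nonneg _).trans (hCχ 0)
  set θ : ℕ → E3 → ℝ := fun n y => -((n : ℝ) + 1) * φ y - 1 with hθ
  have hθs : ∀ n, ContDiff ℝ ∞ (θ n) := fun n => (contDiff_const.mul hφ).sub contDiff_const
  set η : ℕ → E3 → ℝ := fun n y => Real.smoothTransition (θ n y) with hη
  have hηs : ∀ n, ContDiff ℝ ∞ (η n) := fun n => Real.smoothTransition.contDiff.comp (hθs n)
  have hη1 : ∀ n y, |η n y| ≤ 1 := fun n y => by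
    rw [abs_of_nonneg (Real.smoothTransition.nonneg _)]
    exact Real.smoothTransition.le_one _
  set σ : ℕ → E3 → ℝ := fun n y => deriv Real.smoothTransition (θ n y) with hσ
  have hσc : ∀ n, Continuous (σ n) := fun n =>
    ((Real.smoothTransition.contDiff (n := 1)).continuous_deriv le_rfl).comp (hθs n).continuous
  have hdη : ∀ n j y, partialDeriv j (η n) y = -((n : ℝ) + 1) * σ n y * partialDeriv j φ y := by
    intro n j y
    have h1 : HasFDerivAt (θ n) (-((n : ℝ) + 1) • fderiv ℝ φ y) y :=
      (((hφ.differentiable (by simp) y).hasFDerivAt).const_mul _).sub_const 1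
    have h2 : HasDerivAt Real.smoothTransition (σ n y) (θ n y) :=
      ((Real.smoothTransition.contDiff (n := 1)).differentiable (by simp) _).hasDerivAt
    have h3 := h2.comp_hasFDerivAt y h1
    rw [partialDeriv, show η n = Real.smoothTransition ∘ θ n from rfl, h3.fderiv]
    simp [partialDeriv]; ring
  -- The shift by `1` in `θ n` keeps the support of the cutoff away from the boundary.
  have hts : ∀ n, tsupport (fun y => χ y * η n y) ⊆ Ω := by
    intro n y hy
    have h1 : y ∈ tsupport χ := tsupport_mul_subset_left hy
    have h2 : tsupport (η n) ⊆ {y | 0 ≤ θ n y} := by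
      refine closure_minimal (fun z hz => ?_) (isClosed_le continuous_const (hθs n).continuous)
      by_contra h
      exact hz (Real.smoothTransition.zero_of_nonpos (not_le.1 h).le)
    have h3 : 0 ≤ θ n y := h2 (tsupport_mul_subset_right hy)
    refine (hmem y (hχs h1)).2 ?_
    simp only [hθ] at h3
    by_contra h
    have : 0 ≤ ((n : ℝ) + 1) * φ y := mul_nonneg (by positivity) (not_lt.1 h)
    linarith
  set P : E3 → ℝ := fun x => ∑ j, G x * u x j * partialDeriv j χ x with hP
  set Q : E3 → ℝ := fun x => fderiv ℝ φ x (u x) with hQ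
  have hbdχ : ∀ j, Integrable (fun x => G x * u x j * partialDeriv j χ x) (volume.restrict Ω) := by
    intro j
    obtain ⟨c, hc⟩ := (hasCompactSupport_partialDeriv hχc j).exists_bound_of_continuous
      (continuous_partialDeriv hχ j)
    exact (hWi j).mul_bdd (continuous_partialDeriv hχ j).aestronglyMeasurable
      (Eventually.of_forall hc)
  have hPi : Integrable P (volume.restrict Ω) := integrable_finsetSum _ fun j _ => hbdχ j
  have hDs : Integrable (fun x => ∑ j, D j x) (volume.restrict Ω) :=
    integrable_finsetSum _ fun j _ => hDi j
  have hDχ : Integrable (fun x => (∑ j, D j x) * χ x) (volume.restrict Ω) :=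
    hDs.mul_bdd hχ.continuous.aestronglyMeasurable (Eventually.of_forall hCχ)
  set T : ℕ → E3 → ℝ := fun n x => ((n : ℝ) + 1) * σ n x * χ x * (G x * Q x) with hT
  have hGQ : ∀ x, G x * Q x = ∑ j, G x * u x j * partialDeriv j φ x := fun x => by
    rw [hQ]; simp only; rw [fderiv_apply_eq_sum, Finset.mul_sum]
    exact Finset.sum_congr rfl fun j _ => by ring
  have hTm : ∀ n, AEStronglyMeasurable (T n) (volume.restrict Ω) := by
    intro n
    have h1 : AEStronglyMeasurable (fun x => G x * Q x) (volume.restrict Ω) := by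
      simp only [hGQ]
      refine Finset.aestronglyMeasurable_fun_sum _ fun j _ => ?_
      exact (hWi j).aestronglyMeasurable.mul (continuous_partialDeriv hφ j).aestronglyMeasurable
    have h2 : Continuous fun x => ((n : ℝ) + 1) * σ n x * χ x :=
      (continuous_const.mul (hσc n)).mul hχ.continuous
    exact h2.aestronglyMeasurable.mul h1
  -- `T n` is the term in which the cutoff is differentiated. It lives on the layer
  -- `1 ≤ (n + 1) |φ| ≤ 2`, where the factor `n + 1` is compensated by `|∇φ · u| ≤ C |φ|`.
  have hTb : ∀ n, ∀ᵐ x ∂volume.restrict Ω, ‖T n x‖ ≤ 2 * K * Cχ * CG * C := by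
    intro n
    filter_upwards [hG, hflux] with x hGx hfx
    have hCG0 : 0 ≤ CG := (abs_nonneg _).trans hGx
    by_cases hx : x ∈ tsupport χ
    · by_cases h01 : θ n x < 0 ∨ 1 < θ n x
      · simp only [hT, hσ, hKz _ h01]; simp; positivity
      · push Not at h01
        have h2 : ((n : ℝ) + 1) * |φ x| ≤ 2 := by
          simp only [hθ] at h01
          have hneg : φ x ≤ 0 := by
            by_contra h
            have : 0 < ((n : ℝ) + 1) * φ x := mul_pos (by positivity) (not_le.1 h)
            linarith
          rw [abs_of_nonpos hneg]; linarith
        have hq := hfx (hχs hx)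
        calc ‖T n x‖ = ((n : ℝ) + 1) * |σ n x| * |χ x| * (|G x| * |Q x|) := by
              simp only [hT, norm_mul, Real.norm_eq_abs]
              rw [abs_of_nonneg (by positivity : (0 : ℝ) ≤ (n : ℝ) + 1)]
          _ ≤ ((n : ℝ) + 1) * K * Cχ * (CG * (C * |φ x|)) := by
              gcongr
              · exact hK _
              · exact hCχ x
          _ = (((n : ℝ) + 1) * |φ x|) * (K * Cχ * CG * C) := by ring
          _ ≤ 2 * (K * Cχ * CG * C) := by gcongr
          _ = _ := by ring
    · simp only [hT, image_eq_zero_of_notMem_tsupport hx]; simp; positivity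
  have hθlim : ∀ x ∈ Ω, x ∈ tsupport χ → ∀ᶠ n in atTop, 1 < θ n x := by
    intro x hxΩ hx
    have hneg := (hmem x (hχs hx)).1 hxΩ
    obtain ⟨N, hN⟩ := exists_nat_gt (2 / (-φ x))
    filter_upwards [eventually_ge_atTop N] with n hn
    have h1 : 2 < N * (-φ x) := by rwa [div_lt_iff₀ (by linarith)] at hN
    have h2 : (N : ℝ) ≤ n := by exact_mod_cast hn
    simp only [hθ]
    nlinarith
  have hηlim : ∀ x ∈ Ω, x ∈ tsupport χ → Tendsto (fun n => η n x) atTop (𝓝 1) := by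
    intro x hxΩ hx
    refine tendsto_const_nhds.congr' ?_
    filter_upwards [hθlim x hxΩ hx] with n hn
    exact (Real.smoothTransition.one_of_one_le hn.le).symm
  have l1 : Tendsto (fun n => ∫ x in Ω, η n x * P x) atTop (𝓝 (∫ x in Ω, P x)) := by
    refine tendsto_integral_of_dominated_convergence (fun x => |P x|)
      (fun n => (hηs n).continuous.aestronglyMeasurable.mul hPi.aestronglyMeasurable) hPi.abs
      (fun n => Eventually.of_forall fun x => ?_) ?_
    · rw [norm_mul]
      exact mul_le_of_le_one_left (abs_nonneg _) (hη1 n x)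
    · filter_upwards [ae_restrict_mem hΩm] with x hxΩ
      by_cases hx : x ∈ tsupport χ
      · simpa using (hηlim x hxΩ hx).mul_const (P x)
      · have : P x = 0 := Finset.sum_eq_zero fun j _ => by
          rw [image_eq_zero_of_notMem_tsupport (fun h => hx (tsupport_partialDeriv_subset χ j h)),
            mul_zero]
        simp [this]
  have l2 : Tendsto (fun n => ∫ x in Ω, η n x * ((∑ j, D j x) * χ x)) atTop
      (𝓝 (∫ x in Ω, (∑ j, D j x) * χ x)) := by
    refine tendsto_integral_of_dominated_convergence (fun x => |(∑ j, D j x) * χ x|)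
      (fun n => (hηs n).continuous.aestronglyMeasurable.mul hDχ.aestronglyMeasurable) hDχ.abs
      (fun n => Eventually.of_forall fun x => ?_) ?_
    · rw [norm_mul]
      exact mul_le_of_le_one_left (abs_nonneg _) (hη1 n x)
    · filter_upwards [ae_restrict_mem hΩm] with x hxΩ
      by_cases hx : x ∈ tsupport χ
      · simpa using (hηlim x hxΩ hx).mul_const ((∑ j, D j x) * χ x)
      · simp [image_eq_zero_of_notMem_tsupport hx]
  have l3 : Tendsto (fun n => ∫ x in Ω, T n x) atTop (𝓝 0) := by
    have := tendsto_integral_of_dominated_convergence (μ := volume.restrict Ω) (F := T)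
      (f := fun _ => (0 : ℝ)) (fun _ => 2 * K * Cχ * CG * C) hTm (integrable_const _) hTb ?_
    · simpa using this
    · filter_upwards [ae_restrict_mem hΩm] with x hxΩ
      by_cases hx : x ∈ tsupport χ
      · refine tendsto_const_nhds.congr' ?_
        filter_upwards [hθlim x hxΩ hx] with n hn
        simp only [hT, hσ, hKz _ (Or.inr hn)]; simp
      · simp [hT, image_eq_zero_of_notMem_tsupport hx]
  have hTi : ∀ n, Integrable (T n) (volume.restrict Ω) := fun n =>
    Integrable.of_bound (hTm n) _ (hTb n)
  have hηP : ∀ n, Integrable (fun x => η n x * P x) (volume.restrict Ω) := fun n =>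
    hPi.bdd_mul (hηs n).continuous.aestronglyMeasurable (Eventually.of_forall (hη1 n))
  have hident : ∀ n, (∫ x in Ω, η n x * P x) - ∫ x in Ω, T n x
      = -∫ x in Ω, η n x * ((∑ j, D j x) * χ x) := by
    intro n
    have hsm : ContDiff ℝ ∞ (fun y => χ y * η n y) := hχ.mul (hηs n)
    have hcs : HasCompactSupport (fun y => χ y * η n y) := hχc.mul_right
    have hj := fun j => (hD j).2.2 _ hsm hcs (hts n)
    have hiW : ∀ j, Integrable (fun x => G x * u x j * partialDeriv j (fun y => χ y * η n y) x)
        (volume.restrict Ω) := fun j =>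
      (integrable_mul_of_tsupport_subset (hD j).1 (continuous_partialDeriv hsm j)
        (hasCompactSupport_partialDeriv hcs j)
        ((tsupport_partialDeriv_subset _ j).trans (hts n))).restrict
    have hiD : ∀ j, Integrable (fun x => D j x * (χ x * η n x)) (volume.restrict Ω) := fun j =>
      (integrable_mul_of_tsupport_subset (hD j).2.1 hsm.continuous hcs (hts n)).restrict
    have hsum := Finset.sum_congr rfl fun j (_ : j ∈ Finset.univ) => hj j
    rw [Finset.sum_neg_distrib, ← integral_finsetSum _ fun j _ => hiW j,
      ← integral_finsetSum _ fun j _ => hiD j] at hsum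
    rw [← integral_sub (hηP n) (hTi n)]
    have e1 : (fun x => η n x * P x - T n x)
        = fun x => ∑ j, G x * u x j * partialDeriv j (fun y => χ y * η n y) x := by
      ext x
      simp only [hT, hP, hGQ, Finset.mul_sum]
      rw [← Finset.sum_sub_distrib]
      refine Finset.sum_congr rfl fun j _ => ?_
      rw [partialDeriv_mul (hχ.differentiable (by simp) x) ((hηs n).differentiable (by simp) x),
        hdη]
      ring
    have e2 : (fun x => η n x * ((∑ j, D j x) * χ x)) = fun x => ∑ j, D j x * (χ x * η n x) := by
      ext x
      rw [Finset.sum_mul, Finset.mul_sum]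
      exact Finset.sum_congr rfl fun j _ => by ring
    rw [e1, e2, hsum]
  have := tendsto_nhds_unique ((l1.sub l3).congr hident) l2.neg
  simpa using this

/-- The divergence theorem `∫ div (G u) = 0` for a bounded function `G` and a Lipschitz field `u`
with `u · n = 0` on the boundary: localize with a partition of unity. -/
theorem integral_div_eq_zero {Ω : Set E3} (hΩ : IsSmoothSimplyConnectedDomain Ω)
    {u : E3 → E3} {g : Fin 3 → Fin 3 → E3 → ℝ} {M U : ℝ}
    (hu : ∀ i, ∀ᵐ x ∂volume.restrict Ω, |u x i| ≤ U)
    (hw : ∀ i j, HasWeakPartial Ω j (fun y => u y i) (g i j))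
    (hg : ∀ i j, ∀ᵐ x ∂volume.restrict Ω, |g i j x| ≤ M) (hM : 0 ≤ M)
    (hn : NormalComponentVanishes Ω u) {G : E3 → ℝ} {CG : ℝ}
    (hGm : AEStronglyMeasurable G (volume.restrict Ω))
    (hG : ∀ᵐ x ∂volume.restrict Ω, |G x| ≤ CG)
    {D : Fin 3 → E3 → ℝ} (hD : ∀ j, HasWeakPartial Ω j (fun y => G y * u y j) (D j))
    (hDi : ∀ j, IntegrableOn (D j) Ω) : ∫ x in Ω, (∑ j, D j x) = 0 := by
  have hfin : volume Ω ≠ ⊤ := hΩ.isBounded.measure_lt_top.ne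
  have hui : ∀ i, IntegrableOn (fun y => u y i) Ω := fun i =>
    integrableOn_of_ae_abs_le hfin (hw i i).1.aestronglyMeasurable (hu i)
  have hWi : ∀ j, IntegrableOn (fun y => G y * u y j) Ω := fun j => (hui j).bdd_mul hGm hG
  have hU : ∀ᵐ x ∂volume.restrict Ω, ‖u x‖ ≤ 3 * U := by
    filter_upwards [ae_all_iff.2 hu] with x hx
    calc ‖u x‖ ≤ ∑ i, |u x i| := norm_le_sum_abs _
      _ ≤ ∑ _i : Fin 3, U := Finset.sum_le_sum fun i _ => hx i
      _ = 3 * U := by simp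
  obtain ⟨S, hS, hLip⟩ := exists_lipschitz_field hΩ.isOpen hM hui hw hg
  have hloc : ∀ x ∈ closure Ω, ∃ r, 0 < r ∧ ∀ χ : E3 → ℝ, ContDiff ℝ ∞ χ → HasCompactSupport χ →
      tsupport χ ⊆ ball x r →
      ∫ x in Ω, (∑ j, G x * u x j * partialDeriv j χ x) = -∫ x in Ω, (∑ j, D j x) * χ x := by
    intro x hx
    by_cases hxΩ : x ∈ Ω
    · obtain ⟨r, hr, hball⟩ := Metric.isOpen_iff.1 hΩ.isOpen x hxΩ
      refine ⟨r, hr, fun χ hχ hχc hχs => ?_⟩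
      have hsum := Finset.sum_congr rfl fun j (_ : j ∈ Finset.univ) =>
        (hD j).2.2 χ hχ hχc (hχs.trans hball)
      rw [Finset.sum_neg_distrib, ← integral_finsetSum, ← integral_finsetSum] at hsum
      · rw [hsum]; simp only [Finset.sum_mul]
      · exact fun j _ => (integrable_mul_of_tsupport_subset (hD j).2.1 hχ.continuous hχc
          (hχs.trans hball)).restrict
      · exact fun j _ => (integrable_mul_of_tsupport_subset (hD j).1 (continuous_partialDeriv hχ j)
          (hasCompactSupport_partialDeriv hχc j)
          ((tsupport_partialDeriv_subset _ j).trans (hχs.trans hball))).restrict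
    · obtain ⟨φ, r, C, hφ, hr, hC, hmem, hflux⟩ := exists_abs_fderiv_apply_le hΩ
        (by positivity : 0 ≤ 9 * M) hU hS hLip hn
        (show x ∈ frontier Ω by rw [hΩ.isOpen.frontier_eq]; exact ⟨hx, hxΩ⟩)
      exact ⟨r, hr, fun χ hχ hχc hχs => integral_div_mul_of_flux_bound hΩ.isOpen hfin hG hD hWi hDi
        hφ hC hmem hflux hχ hχc hχs⟩
  choose! r hr hint using hloc
  obtain ⟨F, hFcl, hFcov⟩ := hΩ.isBounded.isCompact_closure.elim_nhds_subcover
    (fun x => ball x (r x)) fun x hx => ball_mem_nhds x (hr x hx)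
  obtain ⟨f, hf⟩ := SmoothPartitionOfUnity.exists_isSubordinate (modelWithCornersSelf ℝ E3)
    (isClosed_closure (s := Ω)) (fun x : F => ball (x : E3) (r x)) (fun _ => isOpen_ball)
    (fun y hy => by
      obtain ⟨x, hx, hy⟩ := mem_iUnion₂.1 (hFcov hy)
      exact mem_iUnion.2 ⟨⟨x, hx⟩, hy⟩)
  have hfs : ∀ i, ContDiff ℝ ∞ (f i) := fun i => (f i).contMDiff.contDiff
  have hfc : ∀ i, HasCompactSupport (f i) := fun i =>
    (isCompact_closedBall (i : E3) (r i)).of_isClosed_subset (isClosed_tsupport _)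
      ((hf i).trans ball_subset_closedBall)
  have hsum1 : ∀ x ∈ Ω, ∑ i, f i x = 1 := fun x hx => by
    rw [← finsum_eq_sum_of_fintype]; exact f.sum_eq_one (subset_closure hx)
  -- The derivatives of the partition of unity add up to zero, so that only the divergence remains
  -- after summation.
  have hsumd : ∀ j, ∀ x ∈ Ω, ∑ i, partialDeriv j (f i) x = 0 := by
    intro j x hx
    have h1 : (fun y => ∑ i, f i y) =ᶠ[𝓝 x] fun _ => (1 : ℝ) := by
      filter_upwards [hΩ.isOpen.mem_nhds hx] with y hy using hsum1 y hy
    have h2 := h1.fderiv_eq (𝕜 := ℝ)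
    rw [fderiv_fun_sum fun i _ => (hfs i).differentiable (by simp) x, fderiv_fun_const] at h2
    simp only [partialDeriv]
    rw [← sum_apply, h2]
    simp
  have hkey := Finset.sum_congr rfl fun (i : F) (_ : i ∈ Finset.univ) =>
    hint i (hFcl i i.2) (f i) (hfs i) (hfc i) (hf i)
  have hDs : Integrable (fun x => ∑ j, D j x) (volume.restrict Ω) :=
    integrable_finsetSum _ fun j _ => hDi j
  rw [Finset.sum_neg_distrib, ← integral_finsetSum, ← integral_finsetSum] at hkey
  · have e1 : ∫ x in Ω, ∑ i : F, (∑ j, D j x) * f i x = ∫ x in Ω, ∑ j, D j x := by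
      refine setIntegral_congr_fun hΩ.isOpen.measurableSet fun x hx => ?_
      rw [← Finset.mul_sum, hsum1 x hx, mul_one]
    have e2 : ∫ x in Ω, ∑ i : F, ∑ j, G x * u x j * partialDeriv j (f i) x = 0 := by
      rw [← integral_zero E3 ℝ (μ := volume.restrict Ω)]
      refine setIntegral_congr_fun hΩ.isOpen.measurableSet fun x hx => ?_
      simp only
      rw [Finset.sum_comm]
      refine Finset.sum_eq_zero fun j _ => ?_
      rw [← Finset.mul_sum, hsumd j x hx, mul_zero]
    rw [e1, e2] at hkey
    linarith
  · intro i _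
    obtain ⟨c, hc⟩ := (hfc i).exists_bound_of_continuous (hfs i).continuous
    exact hDs.mul_bdd (hfs i).continuous.aestronglyMeasurable (Eventually.of_forall hc)
  · intro i _
    refine integrable_finsetSum _ fun j _ => ?_
    obtain ⟨c, hc⟩ := (hasCompactSupport_partialDeriv (hfc i) j).exists_bound_of_continuous
      (continuous_partialDeriv (hfs i) j)
    exact (hWi j).mul_bdd (continuous_partialDeriv (hfs i) j).aestronglyMeasurable
      (Eventually.of_forall hc)

/-! ### Weak time derivatives -/

/-- The functions `ε⁻¹ s'((t - a) / ε)`, where `s` is the smooth transition, are an approximate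
identity at `a`. -/
theorem tendsto_integral_mul_deriv_smoothTransition {r : ℝ → ℝ} {T a : ℝ}
    (hr : ContinuousOn r (Icc 0 T)) (ha : a ∈ Ioo 0 T) {ε : ℕ → ℝ} (hε : ∀ n, 0 < ε n)
    (hε0 : Tendsto ε atTop (𝓝 0)) (hεT : ∀ n, a + ε n < T) :
    Tendsto (fun n => ∫ t in Ioo 0 T,
      r t * ((ε n)⁻¹ * deriv Real.smoothTransition ((t - a) / ε n))) atTop (𝓝 (r a)) := by
  obtain ⟨K, hK0, hK, hKz⟩ := exists_bound_deriv_smoothTransition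
  have hdc : Continuous (deriv Real.smoothTransition) :=
    (Real.smoothTransition.contDiff (n := 1)).continuous_deriv le_rfl
  obtain ⟨B, hB⟩ := isCompact_Icc.exists_bound_of_continuousOn hr
  have hmem : ∀ n, ∀ σ ∈ Icc (0 : ℝ) 1, ε n * σ + a ∈ Icc 0 T := by
    intro n σ hσ
    have h1 := mul_nonneg (hε n).le hσ.1
    have h2 := mul_le_mul_of_nonneg_left hσ.2 (hε n).le
    have h3 := hεT n
    have h4 := ha.1
    constructor <;> linarith
  have hrew : ∀ n, ∫ t in Ioo 0 T, r t * ((ε n)⁻¹ * deriv Real.smoothTransition ((t - a) / ε n))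
      = ∫ σ in (0 : ℝ)..1, r (ε n * σ + a) * deriv Real.smoothTransition σ := by
    intro n
    have hεn := hε n
    have h1 := intervalIntegral.integral_comp_mul_add (a := 0) (b := 1)
      (fun t => r t * deriv Real.smoothTransition ((t - a) / ε n)) hεn.ne' a
    have h2 : ∀ σ : ℝ, (ε n * σ + a - a) / ε n = σ := fun σ => by field_simp; ring
    simp only [h2] at h1
    rw [h1, intervalIntegral.integral_of_le (by linarith), smul_eq_mul, ← integral_const_mul,
      integral_Ioc_eq_integral_Ioo]
    have h3 : ∫ t in Ioo 0 T, r t * ((ε n)⁻¹ * deriv Real.smoothTransition ((t - a) / ε n))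
        = ∫ t in Icc a (a + ε n), r t * ((ε n)⁻¹ * deriv Real.smoothTransition ((t - a) / ε n)) := by
      refine setIntegral_eq_of_subset_of_forall_sdiff_eq_zero measurableSet_Ioo
        (fun t ht => ⟨ha.1.trans_le ht.1, ht.2.trans_lt (hεT n)⟩) fun t ht => ?_
      rw [hKz]
      · simp
      · have h4 : ¬ (a ≤ t ∧ t ≤ a + ε n) := ht.2
        by_cases h5 : a ≤ t
        · right; rw [lt_div_iff₀ hεn]
          have : ¬ t ≤ a + ε n := fun h => h4 ⟨h5, h⟩
          linarith
        · left; exact div_neg_of_neg_of_pos (by linarith) hεn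
    rw [h3, integral_Icc_eq_integral_Ioo]
    have h6 : ε n * 0 + a = a := by ring
    have h7 : ε n * 1 + a = a + ε n := by ring
    rw [h6, h7]
    exact setIntegral_congr_fun measurableSet_Ioo fun t _ => by ring
  simp only [hrew]
  have hlim : Tendsto (fun n => ∫ σ in (0 : ℝ)..1, r (ε n * σ + a) * deriv Real.smoothTransition σ)
      atTop (𝓝 (∫ σ in (0 : ℝ)..1, r a * deriv Real.smoothTransition σ)) := by
    refine intervalIntegral.tendsto_integral_filter_of_dominated_convergence (fun _ => B * K) ?_ ?_
      (by simp) ?_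
    · refine Eventually.of_forall fun n => ?_
      have hc : ContinuousOn (fun σ => r (ε n * σ + a) * deriv Real.smoothTransition σ)
          (Icc 0 1) :=
        (hr.comp (by fun_prop) fun σ hσ => hmem n σ hσ).mul hdc.continuousOn
      rw [uIoc_of_le zero_le_one]
      exact (hc.mono Ioc_subset_Icc_self).aestronglyMeasurable measurableSet_Ioc
    · refine Eventually.of_forall fun n => Eventually.of_forall fun σ hσ => ?_
      rw [uIoc_of_le zero_le_one] at hσ
      rw [norm_mul]
      have hb := hB _ (hmem n σ (Ioc_subset_Icc_self hσ))
      exact mul_le_mul hb (hK σ) (abs_nonneg _) ((norm_nonneg _).trans hb)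
    · refine Eventually.of_forall fun σ hσ => ?_
      rw [uIoc_of_le zero_le_one] at hσ
      refine Tendsto.mul_const _ ?_
      have h1 : Tendsto (fun n => ε n * σ + a) atTop (𝓝[Icc 0 T] a) := by
        refine tendsto_nhdsWithin_iff.2 ⟨?_, Eventually.of_forall fun n =>
          hmem n σ (Ioc_subset_Icc_self hσ)⟩
        simpa using (hε0.mul_const σ).add_const a
      exact (hr a (Ioo_subset_Icc_self ha)).tendsto.comp h1
  have hint : ∫ σ in (0 : ℝ)..1, r a * deriv Real.smoothTransition σ = r a := by
    rw [intervalIntegral.integral_const_mul, intervalIntegral.integral_deriv_eq_sub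
      (fun x _ => (Real.smoothTransition.contDiff (n := 1)).differentiable (by simp) x)
      (hdc.intervalIntegrable _ _)]
    simp
  rwa [hint] at hlim

/-- A continuous function whose distributional derivative is a continuous function satisfies the
fundamental theorem of calculus. The test functions are smoothed indicator functions of `(a, b]`. -/
theorem sub_eq_integral_of_weak_deriv {r v : ℝ → ℝ} {T : ℝ} (hr : ContinuousOn r (Icc 0 T))
    (hv : ContinuousOn v (Icc 0 T))
    (h : ∀ θ : ℝ → ℝ, ContDiff ℝ ∞ θ → HasCompactSupport θ → tsupport θ ⊆ Ioo 0 T →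
      ∫ t in Ioo 0 T, r t * deriv θ t = -∫ t in Ioo 0 T, v t * θ t)
    {a b : ℝ} (ha : 0 < a) (hab : a ≤ b) (hb : b < T) : r b - r a = ∫ t in a..b, v t := by
  set δ := T - b with hδ
  have hδ0 : 0 < δ := by rw [hδ]; linarith
  set ε : ℕ → ℝ := fun n => δ / ((n : ℝ) + 2) with hε
  have hεpos : ∀ n, 0 < ε n := fun n => by positivity
  have hε0 : Tendsto ε atTop (𝓝 0) :=
    tendsto_const_nhds.div_atTop
      (tendsto_atTop_add_const_right _ _ tendsto_natCast_atTop_atTop)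
  have hεδ : ∀ n, ε n < δ := fun n => by
    rw [hε]; simp only
    rw [div_lt_iff₀ (by positivity)]
    have : (0 : ℝ) ≤ n := Nat.cast_nonneg n
    nlinarith
  have haI : a ∈ Ioo 0 T := ⟨ha, by linarith⟩
  have hbI : b ∈ Ioo 0 T := ⟨by linarith, hb⟩
  set st := Real.smoothTransition with hst
  have hstc : ContDiff ℝ ∞ st := Real.smoothTransition.contDiff
  set θ : ℕ → ℝ → ℝ := fun n t => st ((t - a) / ε n) - st ((t - b) / ε n) with hθ
  have hθs : ∀ n, ContDiff ℝ ∞ (θ n) := fun n =>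
    (hstc.comp ((contDiff_id.sub contDiff_const).div_const _)).sub
      (hstc.comp ((contDiff_id.sub contDiff_const).div_const _))
  have hts : ∀ n, tsupport (θ n) ⊆ Icc a (b + ε n) := by
    intro n
    refine closure_minimal (fun t ht => ?_) isClosed_Icc
    by_contra hcon
    refine ht ?_
    have hεn := hεpos n
    rw [mem_Icc, not_and_or, not_le, not_le] at hcon
    rcases hcon with h1 | h1
    · simp only [hθ, hst]
      rw [Real.smoothTransition.zero_of_nonpos (div_nonpos_of_nonpos_of_nonneg (by linarith) hεn.le),
        Real.smoothTransition.zero_of_nonpos (div_nonpos_of_nonpos_of_nonneg (by linarith) hεn.le),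
        sub_zero]
    · simp only [hθ, hst]
      rw [Real.smoothTransition.one_of_one_le (by rw [le_div_iff₀ hεn]; linarith),
        Real.smoothTransition.one_of_one_le (by rw [le_div_iff₀ hεn]; linarith), sub_self]
  have hder : ∀ n t, deriv (θ n) t = (ε n)⁻¹ * deriv st ((t - a) / ε n)
      - (ε n)⁻¹ * deriv st ((t - b) / ε n) := by
    intro n t
    have hd : ∀ c : ℝ, HasDerivAt (fun t => st ((t - c) / ε n))
        ((ε n)⁻¹ * deriv st ((t - c) / ε n)) t := by
      intro c
      have h1 : HasDerivAt (fun t : ℝ => (t - c) / ε n) (1 / ε n) t :=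
        ((hasDerivAt_id t).sub_const c).div_const _
      have h2 := ((hstc.differentiable (by simp)) ((t - c) / ε n)).hasDerivAt.comp t h1
      rw [one_div, mul_comm] at h2
      exact h2
    exact ((hd a).sub (hd b)).deriv
  have hri : IntegrableOn r (Ioo 0 T) := hr.integrableOn_Icc.mono_set Ioo_subset_Icc_self
  have hvi : IntegrableOn v (Ioo 0 T) := hv.integrableOn_Icc.mono_set Ioo_subset_Icc_self
  obtain ⟨K, hK0, hK, -⟩ := exists_bound_deriv_smoothTransition
  have hdc : Continuous (deriv st) := (hstc.of_le (by simp)).continuous_deriv le_rfl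
  have hri' : ∀ n c, IntegrableOn (fun t => r t * ((ε n)⁻¹ * deriv st ((t - c) / ε n)))
      (Ioo 0 T) := by
    intro n c
    refine hri.mul_bdd (c := (ε n)⁻¹ * K) (Continuous.aestronglyMeasurable (by fun_prop))
      (Eventually.of_forall fun t => ?_)
    rw [norm_mul, Real.norm_of_nonneg (inv_nonneg.2 (hεpos n).le)]
    exact mul_le_mul_of_nonneg_left (hK _) (inv_nonneg.2 (hεpos n).le)
  have l1 := tendsto_integral_mul_deriv_smoothTransition hr haI hεpos hε0
    fun n => by have := hεδ n; rw [hδ] at this; linarith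
  have l2 := tendsto_integral_mul_deriv_smoothTransition hr hbI hεpos hε0
    fun n => by have := hεδ n; rw [hδ] at this; linarith
  have l3 : Tendsto (fun n => ∫ t in Ioo 0 T, v t * θ n t) atTop
      (𝓝 (∫ t in Ioo 0 T, (Ioc a b).indicator v t)) := by
    have hstlim : ∀ c t : ℝ, c < t → Tendsto (fun n => st ((t - c) / ε n)) atTop (𝓝 1) := by
      intro c t hct
      refine tendsto_const_nhds.congr' ?_
      filter_upwards [hε0.eventually (gt_mem_nhds (sub_pos.2 hct))] with n hn
      exact (Real.smoothTransition.one_of_one_le (by rw [le_div_iff₀ (hεpos n)]; linarith)).symm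
    have hstlim0 : ∀ c t : ℝ, t ≤ c → Tendsto (fun n => st ((t - c) / ε n)) atTop (𝓝 0) := by
      intro c t hct
      refine tendsto_const_nhds.congr fun n => ?_
      exact (Real.smoothTransition.zero_of_nonpos
        (div_nonpos_of_nonpos_of_nonneg (by linarith) (hεpos n).le)).symm
    refine tendsto_integral_of_dominated_convergence (fun t => |v t| * 1)
      (fun n => hvi.aestronglyMeasurable.mul (hθs n).continuous.aestronglyMeasurable)
      (hvi.abs.mul_const 1) (fun n => Eventually.of_forall fun t => ?_)
      (Eventually.of_forall fun t => ?_)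
    · rw [norm_mul]
      refine mul_le_mul_of_nonneg_left ?_ (norm_nonneg _)
      have e1 := Real.smoothTransition.nonneg ((t - a) / ε n)
      have e2 := Real.smoothTransition.nonneg ((t - b) / ε n)
      have e3 := Real.smoothTransition.le_one ((t - a) / ε n)
      have e4 := Real.smoothTransition.le_one ((t - b) / ε n)
      rw [Real.norm_eq_abs, abs_le]
      constructor <;> simp only [hθ, hst] <;> linarith
    · by_cases h1 : a < t
      · by_cases h2 : t ≤ b
        · rw [indicator_of_mem (show t ∈ Ioc a b from ⟨h1, h2⟩)]
          simpa using ((hstlim a t h1).sub (hstlim0 b t h2)).const_mul (v t)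
        · rw [indicator_of_notMem fun h => h2 h.2]
          simpa using ((hstlim a t h1).sub (hstlim b t (not_le.1 h2))).const_mul (v t)
      · rw [indicator_of_notMem fun h => h1 h.1]
        simpa using ((hstlim0 a t (not_lt.1 h1)).sub
          (hstlim0 b t ((not_lt.1 h1).trans hab))).const_mul (v t)
  have hid : ∀ n, (∫ t in Ioo 0 T, r t * ((ε n)⁻¹ * deriv st ((t - a) / ε n)))
      - (∫ t in Ioo 0 T, r t * ((ε n)⁻¹ * deriv st ((t - b) / ε n)))
      = -∫ t in Ioo 0 T, v t * θ n t := by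
    intro n
    rw [← h (θ n) (hθs n) (isCompact_Icc.of_isClosed_subset (isClosed_tsupport _) (hts n))
      ((hts n).trans fun t ht => ⟨ha.trans_le ht.1, by
        have := hεδ n; rw [hδ] at this; linarith [ht.2]⟩),
      ← integral_sub (hri' n a) (hri' n b)]
    congr 1; ext t
    rw [hder]; ring
  have hfin := tendsto_nhds_unique ((l1.sub l2).congr hid) l3.neg
  have hsub : Ioc a b ⊆ Ioo 0 T := fun t ht => ⟨ha.trans ht.1, ht.2.trans_lt hb⟩
  rw [setIntegral_indicator measurableSet_Ioc, inter_eq_right.2 hsub,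
    ← intervalIntegral.integral_of_le hab] at hfin
  linarith

/-- A weak time derivative, tested against a product `θ(t) ψ(x)`. -/
theorem HasWeakTimeDeriv.integral_mul_deriv {Ω : Set E3} {T : ℝ} {f g : ℝ → E3 → ℝ}
    (h : HasWeakTimeDeriv Ω T f g) {θ : ℝ → ℝ} (hθ : ContDiff ℝ ∞ θ) (hθc : HasCompactSupport θ)
    (hθT : tsupport θ ⊆ Ioo 0 T) {ψ : E3 → ℝ} (hψ : ContDiff ℝ ∞ ψ) (hψc : HasCompactSupport ψ)
    (hψΩ : tsupport ψ ⊆ Ω) :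
    ∫ t in Ioo 0 T, (∫ x in Ω, f t x * ψ x) * deriv θ t
      = -∫ t in Ioo 0 T, (∫ x in Ω, g t x * ψ x) * θ t := by
  have hprod : ∀ κ : ℝ → ℝ, HasCompactSupport κ → tsupport κ ⊆ Ioo 0 T →
      tsupport (fun z : ℝ × E3 => κ z.1 * ψ z.2) ⊆ tsupport κ ×ˢ tsupport ψ := by
    intro κ _ _
    refine closure_minimal (fun z hz => ?_) ((isClosed_tsupport _).prod (isClosed_tsupport _))
    exact ⟨subset_tsupport _ (left_ne_zero_of_mul hz), subset_tsupport _ (right_ne_zero_of_mul hz)⟩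
  have hcomp : ∀ κ : ℝ → ℝ, HasCompactSupport κ → tsupport κ ⊆ Ioo 0 T →
      HasCompactSupport (fun z : ℝ × E3 => κ z.1 * ψ z.2) := fun κ hκ hκT =>
    (hκ.isCompact.prod hψc.isCompact).of_isClosed_subset (isClosed_tsupport _) (hprod κ hκ hκT)
  have hdθc : HasCompactSupport (deriv θ) := hθc.deriv
  have hdθT : tsupport (deriv θ) ⊆ Ioo 0 T := (tsupport_deriv_subset).trans hθT
  have hdθ : Continuous (deriv θ) := (hθ.of_le (by simp)).continuous_deriv le_rfl
  have hfub : ∀ (k : ℝ → E3 → ℝ) (κ : ℝ → ℝ),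
      LocallyIntegrableOn (fun z : ℝ × E3 => k z.1 z.2) (Ioo 0 T ×ˢ Ω) → Continuous κ →
      HasCompactSupport κ → tsupport κ ⊆ Ioo 0 T →
      ∫ z in Ioo 0 T ×ˢ Ω, k z.1 z.2 * (κ z.1 * ψ z.2)
        = ∫ t in Ioo 0 T, (∫ x in Ω, k t x * ψ x) * κ t := by
    intro k κ hk hκ hκc hκT
    have hint : Integrable (fun z : ℝ × E3 => k z.1 z.2 * (κ z.1 * ψ z.2)) :=
      integrable_mul_of_tsupport_subset hk ((hκ.comp continuous_fst).mul
        (hψ.continuous.comp continuous_snd)) (hcomp κ hκc hκT)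
        ((hprod κ hκc hκT).trans (prod_mono hκT hψΩ))
    rw [Measure.volume_eq_prod] at hint ⊢
    rw [setIntegral_prod _ hint.integrableOn]
    congr 1; ext t
    rw [← integral_mul_const]
    congr 1; ext x
    ring
  have hsm : ContDiff ℝ ∞ (fun z : ℝ × E3 => θ z.1 * ψ z.2) :=
    (hθ.comp contDiff_fst).mul (hψ.comp contDiff_snd)
  have hd : ∀ z : ℝ × E3, fderiv ℝ (fun z : ℝ × E3 => θ z.1 * ψ z.2) z (1, 0)
      = deriv θ z.1 * ψ z.2 := by
    intro z
    have hfst : HasFDerivAt (fun z : ℝ × E3 => z.1) (ContinuousLinearMap.fst ℝ ℝ E3) z :=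
      hasFDerivAt_fst
    have hsnd : HasFDerivAt (fun z : ℝ × E3 => z.2) (ContinuousLinearMap.snd ℝ ℝ E3) z :=
      hasFDerivAt_snd
    have h1 : HasFDerivAt (fun z : ℝ × E3 => θ z.1)
        (deriv θ z.1 • ContinuousLinearMap.fst ℝ ℝ E3) z :=
      ((hθ.differentiable (by simp) z.1).hasDerivAt).comp_hasFDerivAt z hfst
    have h2 : HasFDerivAt (fun z : ℝ × E3 => ψ z.2)
        ((fderiv ℝ ψ z.2).comp (ContinuousLinearMap.snd ℝ ℝ E3)) z :=
      ((hψ.differentiable (by simp) z.2).hasFDerivAt).comp z hsnd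
    have h3 : HasFDerivAt (fun z : ℝ × E3 => θ z.1 * ψ z.2) _ z := h1.mul h2
    rw [h3.fderiv]
    simp [mul_comm]
  have key := h.2.2 _ hsm (hcomp θ hθc hθT) ((hprod θ hθc hθT).trans (prod_mono hθT hψΩ))
  simp only [hd] at key
  rwa [hfub f (deriv θ) h.1 hdθ hdθc hdθT, hfub g θ h.2.1 hθ.continuous hθc hθT] at key

/-! ### Functions of class `C¹` in time with values in `L²` -/

/-- Square integrable functions on `Ω`. -/
abbrev L2 (Ω : Set E3) : Type := Lp ℝ 2 (volume.restrict Ω : Measure E3)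

open Classical in
/-- A function of time and space as a curve in `L²(Ω)`, with the value `0` at the times at which it
is not square integrable. -/
def toL2 (Ω : Set E3) (f : ℝ → E3 → ℝ) (t : ℝ) : L2 Ω :=
  if h : MemLp (f t) 2 (volume.restrict Ω) then h.toLp (f t) else 0

theorem toL2_coeFn {Ω : Set E3} {f : ℝ → E3 → ℝ} {t : ℝ}
    (h : MemLp (f t) 2 (volume.restrict Ω)) : toL2 Ω f t =ᵐ[volume.restrict Ω] f t := by
  rw [toL2, dif_pos h]
  exact h.coeFn_toLp

theorem ContinuousInSobolev.continuousOn_toL2 {Ω : Set E3} {T : ℝ} {f : ℝ → E3 → ℝ}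
    (h : ContinuousInSobolev 0 2 Ω T f) : ContinuousOn (toL2 Ω f) (Icc 0 T) := by
  intro t ht
  rw [ContinuousWithinAt, Lp.tendsto_Lp_iff_tendsto_eLpNorm']
  refine (h.2 t ht).congr' ?_
  filter_upwards [self_mem_nhdsWithin] with s hs
  change eLpNorm (f s - f t) 2 (volume.restrict Ω) = _
  refine eLpNorm_congr_ae ?_
  filter_upwards [toL2_coeFn (h.1 s hs), toL2_coeFn (h.1 t ht)] with x h1 h2
  simp [h1, h2]

/-- On a set of finite measure, continuity in time with values in `W^{k,q}`, `q ≥ 2`, gives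
continuity with values in `L²`. -/
theorem ContinuousInSobolev.to_L2 {Ω : Set E3} (hfin : volume Ω ≠ ⊤) {k : ℕ} {q : ℝ≥0∞}
    (hq : 2 ≤ q) {T : ℝ} {f : ℝ → E3 → ℝ} (h : ContinuousInSobolev k q Ω T f) :
    ContinuousInSobolev 0 2 Ω T f := by
  have hfinm : IsFiniteMeasure (volume.restrict Ω) := isFiniteMeasure_restrict.2 hfin
  have hm : ∀ g, MemSobolev k q Ω g → MemLp g q (volume.restrict Ω) := by
    intro g hg
    cases k with
    | zero => exact hg
    | succ k => exact hg.1
  have hn : ∀ g, eLpNorm g q (volume.restrict Ω) ≤ sobolevENorm k q Ω g := by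
    intro g
    cases k with
    | zero => exact le_rfl
    | succ k => exact le_self_add
  refine ⟨fun t ht => (hm _ (h.1 t ht)).mono_exponent hq, fun t ht => ?_⟩
  set c : ℝ≥0∞ := (volume.restrict Ω) univ ^ (1 / (2 : ℝ≥0∞).toReal - 1 / q.toReal) with hc
  have hexp : 0 ≤ 1 / (2 : ℝ≥0∞).toReal - 1 / q.toReal := by
    rcases eq_or_ne q ⊤ with rfl | hq'
    · simp
    · have := (ENNReal.toReal_le_toReal (by simp) hq').2 hq
      rw [sub_nonneg]
      exact one_div_le_one_div_of_le (by simp) this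
  have hcfin : c ≠ ⊤ := ENNReal.rpow_ne_top_of_nonneg hexp (measure_ne_top _ _)
  have hlim : Tendsto (fun s => sobolevENorm k q Ω (f s - f t) * c) (𝓝[Icc 0 T] t) (𝓝 0) := by
    have := ENNReal.Tendsto.mul_const (b := c) (h.2 t ht) (Or.inr hcfin)
    rwa [zero_mul] at this
  refine tendsto_of_tendsto_of_tendsto_of_le_of_le' tendsto_const_nhds hlim
    (Eventually.of_forall fun s => zero_le) ?_
  filter_upwards [self_mem_nhdsWithin] with s hs
  have hms := ((hm _ (h.1 s hs)).sub (hm _ (h.1 t ht))).aestronglyMeasurable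
  exact (eLpNorm_le_eLpNorm_mul_rpow_measure_univ hq hms).trans (by gcongr; exact hn _)

theorem L2_inner_eq (Ω : Set E3) (f g : L2 Ω) : inner ℝ f g = ∫ x in Ω, f x * g x := by
  rw [MeasureTheory.L2.inner_def]
  congr 1; ext x
  simp [mul_comm]

/-- An element of `L²(Ω)` is determined by its integrals against test functions. -/
theorem L2_eq_zero_of_test {Ω : Set E3} (hΩ : IsOpen Ω) (hfin : volume Ω ≠ ⊤) {w : L2 Ω}
    (h : ∀ ψ : E3 → ℝ, ContDiff ℝ ∞ ψ → HasCompactSupport ψ → tsupport ψ ⊆ Ω →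
      ∫ x in Ω, w x * ψ x = 0) : w = 0 := by
  have hfinm : IsFiniteMeasure (volume.restrict Ω) := isFiniteMeasure_restrict.2 hfin
  have hwi : IntegrableOn w Ω := (Lp.memLp w).integrable one_le_two
  have h0 : ∀ᵐ x, x ∈ Ω → w x = 0 := by
    refine hΩ.ae_eq_zero_of_integral_contDiff_smul_eq_zero hwi.locallyIntegrableOn
      fun ψ hψ hψc hψΩ => ?_
    rw [← h ψ hψ hψc hψΩ, setIntegral_mul_of_tsupport_subset hψΩ]
    congr 1; ext x; simp [mul_comm]
  rw [Lp.eq_zero_iff_ae_eq_zero]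
  exact (ae_restrict_iff' hΩ.measurableSet).2 h0

/-- If `f` and its weak time derivative `g` are continuous in time with values in `L²(Ω)`, then `g`
is the derivative of the curve `f` in `L²(Ω)`. -/
theorem HasWeakTimeDeriv.hasDerivAt_toL2 {Ω : Set E3} (hΩ : IsOpen Ω) (hfin : volume Ω ≠ ⊤)
    {T : ℝ} {f g : ℝ → E3 → ℝ} (h : HasWeakTimeDeriv Ω T f g)
    (hf : ContinuousInSobolev 0 2 Ω T f) (hg : ContinuousInSobolev 0 2 Ω T g) {t : ℝ}
    (ht : t ∈ Ioo 0 T) : HasDerivAt (toL2 Ω f) (toL2 Ω g t) t := by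
  have hfc := hf.continuousOn_toL2
  have hgc := hg.continuousOn_toL2
  have hftc : ∀ a b, 0 < a → a ≤ b → b < T →
      toL2 Ω f b - toL2 Ω f a = ∫ τ in a..b, toL2 Ω g τ := by
    intro a b ha hab hb
    rw [← sub_eq_zero]
    refine L2_eq_zero_of_test hΩ hfin fun ψ hψ hψc hψΩ => ?_
    have hψL : MemLp ψ 2 (volume.restrict Ω) :=
      (hψ.continuous.memLp_of_hasCompactSupport hψc).restrict Ω
    set Ψ : L2 Ω := hψL.toLp ψ with hΨ
    have hin : ∀ w : L2 Ω, ∫ x in Ω, w x * ψ x = inner ℝ Ψ w := by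
      intro w
      rw [L2_inner_eq]
      refine integral_congr_ae ?_
      filter_upwards [hψL.coeFn_toLp] with x hx
      rw [hΨ, hx, mul_comm]
    have hin' : ∀ (k : ℝ → E3 → ℝ), ContinuousInSobolev 0 2 Ω T k → ∀ τ ∈ Ioo 0 T,
        ∫ x in Ω, k τ x * ψ x = inner ℝ Ψ (toL2 Ω k τ) := by
      intro k hk τ hτ
      rw [← hin]
      refine integral_congr_ae ?_
      filter_upwards [toL2_coeFn (hk.1 τ (Ioo_subset_Icc_self hτ))] with x hx
      rw [hx]
    have hgi : IntervalIntegrable (toL2 Ω g) volume a b := by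
      refine (hgc.mono ?_).intervalIntegrable
      rw [uIcc_of_le hab]
      exact Icc_subset_Icc ha.le hb.le
    have hscal := sub_eq_integral_of_weak_deriv
      (r := fun τ => inner ℝ Ψ (toL2 Ω f τ)) (v := fun τ => inner ℝ Ψ (toL2 Ω g τ))
      (continuousOn_const.inner hfc) (continuousOn_const.inner hgc) (fun θ hθ hθc hθT => by
        have := h.integral_mul_deriv hθ hθc hθT hψ hψc hψΩ
        rw [setIntegral_congr_fun measurableSet_Ioo fun τ hτ => by
          rw [hin' f hf τ hτ]] at this
        rw [this, setIntegral_congr_fun measurableSet_Ioo fun τ hτ => by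
          rw [hin' g hg τ hτ]]) ha hab hb
    rw [hin, inner_sub_right, inner_sub_right, hscal, sub_eq_zero]
    exact (innerSL ℝ Ψ).intervalIntegral_comp_comm hgi
  -- Differentiate `f s = f a + ∫ₐˢ g` at `s = t`, with a base point `a` in the open interval.
  set a := t / 2 with ha
  have ha0 : 0 < a := half_pos ht.1
  have hat : a < t := half_lt_self ht.1
  have hgi : IntervalIntegrable (toL2 Ω g) volume a t := by
    refine (hgc.mono ?_).intervalIntegrable
    rw [uIcc_of_le hat.le]
    exact Icc_subset_Icc ha0.le ht.2.le
  have hgI : ContinuousOn (toL2 Ω g) (Ioo 0 T) := hgc.mono Ioo_subset_Icc_self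
  have hd := (intervalIntegral.integral_hasDerivAt_right hgi
    (hgI.stronglyMeasurableAtFilter isOpen_Ioo t ht)
    (hgI.continuousAt (isOpen_Ioo.mem_nhds ht))).add_const (toL2 Ω f a)
  refine hd.congr_of_eventuallyEq ?_
  filter_upwards [Ioo_mem_nhds hat ht.2] with s hs
  rw [← hftc a s ha0 hs.1.le hs.2]
  abel

/-- Second order Taylor estimate for the integral functional `∫ G(f)`. -/
theorem abs_integral_comp_sub_le {Ω : Set E3} (hfin : volume Ω ≠ ⊤) {G G' : ℝ → ℝ} {B B' C : ℝ}
    (hG : Continuous G) (hG' : Continuous G') (hB : ∀ x, |G x| ≤ B) (hB' : ∀ x, |G' x| ≤ B')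
    (hT : ∀ x y, |G y - G x - G' x * (y - x)| ≤ C * (y - x) ^ 2) {f g : E3 → ℝ}
    (hf : MemLp f 2 (volume.restrict Ω)) (hg : MemLp g 2 (volume.restrict Ω)) :
    |(∫ x in Ω, G (g x)) - (∫ x in Ω, G (f x)) - ∫ x in Ω, G' (f x) * (g x - f x)|
      ≤ C * ∫ x in Ω, (g x - f x) ^ 2 := by
  have hfinm : IsFiniteMeasure (volume.restrict Ω) := isFiniteMeasure_restrict.2 hfin
  have i1 : Integrable (fun x => G (g x)) (volume.restrict Ω) :=
    Integrable.of_bound (hG.comp_aestronglyMeasurable hg.aestronglyMeasurable) B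
      (Eventually.of_forall fun x => hB _)
  have i2 : Integrable (fun x => G (f x)) (volume.restrict Ω) :=
    Integrable.of_bound (hG.comp_aestronglyMeasurable hf.aestronglyMeasurable) B
      (Eventually.of_forall fun x => hB _)
  have i3 : Integrable (fun x => G' (f x) * (g x - f x)) (volume.restrict Ω) :=
    ((hg.sub hf).integrable one_le_two).bdd_mul
      (hG'.comp_aestronglyMeasurable hf.aestronglyMeasurable) (Eventually.of_forall fun x => hB' _)
  have i4 : Integrable (fun x => (g x - f x) ^ 2) (volume.restrict Ω) := (hg.sub hf).integrable_sq
  have e : (∫ x in Ω, G (g x)) - (∫ x in Ω, G (f x)) - ∫ x in Ω, G' (f x) * (g x - f x)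
      = ∫ x in Ω, (G (g x) - G (f x) - G' (f x) * (g x - f x)) := by
    rw [← integral_sub i1 i2]
    exact (integral_sub (i1.sub i2) i3).symm
  rw [e, ← integral_const_mul, ← Real.norm_eq_abs]
  exact norm_integral_le_of_norm_le (i4.const_mul C) (Eventually.of_forall fun x => by
    rw [Real.norm_eq_abs]; exact hT (f x) (g x))

theorem norm_sq_toL2_sub {Ω : Set E3} {f : ℝ → E3 → ℝ} {s t : ℝ}
    (hs : MemLp (f s) 2 (volume.restrict Ω)) (ht : MemLp (f t) 2 (volume.restrict Ω)) :
    ‖toL2 Ω f s - toL2 Ω f t‖ ^ 2 = ∫ x in Ω, (f s x - f t x) ^ 2 := by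
  rw [← real_inner_self_eq_norm_sq, L2_inner_eq]
  refine integral_congr_ae ?_
  filter_upwards [toL2_coeFn hs, toL2_coeFn ht, Lp.coeFn_sub (toL2 Ω f s) (toL2 Ω f t)]
    with x h1 h2 h3
  rw [h3, Pi.sub_apply, h1, h2]; ring

/-- Expansion of `∫ G(f(s))` around the time `t`, in terms of the curve in `L²(Ω)`. -/
theorem exists_taylor_integral_comp {Ω : Set E3} (hfin : volume Ω ≠ ⊤) {G G' : ℝ → ℝ} {B B' C : ℝ}
    (hG : Continuous G) (hG' : Continuous G') (hB : ∀ x, |G x| ≤ B) (hB' : ∀ x, |G' x| ≤ B')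
    (hT : ∀ x y, |G y - G x - G' x * (y - x)| ≤ C * (y - x) ^ 2) {f : ℝ → E3 → ℝ} {t : ℝ}
    (hft : MemLp (f t) 2 (volume.restrict Ω)) :
    ∃ ℓ : L2 Ω →L[ℝ] ℝ, (∀ w : L2 Ω, ℓ w = ∫ x in Ω, G' (f t x) * w x) ∧
      ∀ s, MemLp (f s) 2 (volume.restrict Ω) →
        |(∫ x in Ω, G (f s x)) - (∫ x in Ω, G (f t x)) - ℓ (toL2 Ω f s - toL2 Ω f t)|
          ≤ C * ‖toL2 Ω f s - toL2 Ω f t‖ ^ 2 := by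
  have hfinm : IsFiniteMeasure (volume.restrict Ω) := isFiniteMeasure_restrict.2 hfin
  have hm : MemLp (fun x => G' (f t x)) 2 (volume.restrict Ω) :=
    MemLp.of_bound (hG'.comp_aestronglyMeasurable hft.aestronglyMeasurable) B'
      (Eventually.of_forall fun x => hB' _)
  have hℓ : ∀ w : L2 Ω, innerSL ℝ (hm.toLp _) w = ∫ x in Ω, G' (f t x) * w x := by
    intro w
    rw [innerSL_apply_apply, L2_inner_eq]
    refine integral_congr_ae ?_
    filter_upwards [hm.coeFn_toLp] with x hx
    rw [hx]
  refine ⟨innerSL ℝ (hm.toLp _), hℓ, fun s hfs => ?_⟩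
  rw [norm_sq_toL2_sub hfs hft, hℓ]
  have e : ∫ x in Ω, G' (f t x) * (toL2 Ω f s - toL2 Ω f t : L2 Ω) x
      = ∫ x in Ω, G' (f t x) * (f s x - f t x) := by
    refine integral_congr_ae ?_
    filter_upwards [toL2_coeFn hfs, toL2_coeFn hft, Lp.coeFn_sub (toL2 Ω f s) (toL2 Ω f t)]
      with x h1 h2 h3
    rw [h3, Pi.sub_apply, h1, h2]
  rw [e]
  exact abs_integral_comp_sub_le hfin hG hG' hB hB' hT hft hfs

theorem continuousOn_integral_comp {Ω : Set E3} (hfin : volume Ω ≠ ⊤) {G G' : ℝ → ℝ} {B B' C : ℝ}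
    (hG : Continuous G) (hG' : Continuous G') (hB : ∀ x, |G x| ≤ B) (hB' : ∀ x, |G' x| ≤ B')
    (hT : ∀ x y, |G y - G x - G' x * (y - x)| ≤ C * (y - x) ^ 2) {T : ℝ} {f : ℝ → E3 → ℝ}
    (hf : ContinuousInSobolev 0 2 Ω T f) :
    ContinuousOn (fun s => ∫ x in Ω, G (f s x)) (Icc 0 T) := by
  intro t ht
  obtain ⟨ℓ, -, hℓ⟩ := exists_taylor_integral_comp hfin hG hG' hB hB' hT (hf.1 t ht)
  have hc : Tendsto (fun s => toL2 Ω f s - toL2 Ω f t) (𝓝[Icc 0 T] t) (𝓝 0) := by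
    have := (hf.continuousOn_toL2 t ht).tendsto.sub_const (toL2 Ω f t)
    rwa [sub_self] at this
  have h1 : Tendsto (fun s => C * ‖toL2 Ω f s - toL2 Ω f t‖ ^ 2) (𝓝[Icc 0 T] t) (𝓝 0) := by
    simpa using (hc.norm.pow 2).const_mul C
  have h2 : Tendsto (fun s => (∫ x in Ω, G (f s x)) - (∫ x in Ω, G (f t x))
      - ℓ (toL2 Ω f s - toL2 Ω f t)) (𝓝[Icc 0 T] t) (𝓝 0) := by
    refine squeeze_zero_norm' ?_ h1
    filter_upwards [self_mem_nhdsWithin] with s hs using hℓ s (hf.1 s hs)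
  have h3 : Tendsto (fun s => ℓ (toL2 Ω f s - toL2 Ω f t)) (𝓝[Icc 0 T] t) (𝓝 0) := by
    have := (ℓ.continuous.tendsto 0).comp hc
    rw [map_zero] at this
    exact this
  have h4 := (h2.add h3).add_const (∫ x in Ω, G (f t x))
  simp only [add_zero, zero_add] at h4
  exact h4.congr fun s => by ring

/-- `d/dt ∫ G(f) = ∫ G'(f) f_t`. -/
theorem hasDerivAt_integral_comp {Ω : Set E3} (hΩ : IsOpen Ω) (hfin : volume Ω ≠ ⊤)
    {G G' : ℝ → ℝ} {B B' C : ℝ} (hG : Continuous G) (hG' : Continuous G') (hB : ∀ x, |G x| ≤ B)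
    (hB' : ∀ x, |G' x| ≤ B') (hT : ∀ x y, |G y - G x - G' x * (y - x)| ≤ C * (y - x) ^ 2)
    {T : ℝ} {f g : ℝ → E3 → ℝ} (h : HasWeakTimeDeriv Ω T f g)
    (hf : ContinuousInSobolev 0 2 Ω T f) (hg : ContinuousInSobolev 0 2 Ω T g) {t : ℝ}
    (ht : t ∈ Ioo 0 T) :
    HasDerivAt (fun s => ∫ x in Ω, G (f s x)) (∫ x in Ω, G' (f t x) * g t x) t := by
  have htI := Ioo_subset_Icc_self ht
  obtain ⟨ℓ, hℓw, hℓ⟩ := exists_taylor_integral_comp hfin hG hG' hB hB' hT (hf.1 t htI)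
  have hR := h.hasDerivAt_toL2 hΩ hfin hf hg ht
  have hval : ℓ (toL2 Ω g t) = ∫ x in Ω, G' (f t x) * g t x := by
    rw [hℓw]
    refine integral_congr_ae ?_
    filter_upwards [toL2_coeFn (hg.1 t htI)] with x hx
    rw [hx]
  have h1 : HasDerivAt (fun s => ℓ (toL2 Ω f s - toL2 Ω f t)) (ℓ (toL2 Ω g t)) t :=
    ℓ.hasFDerivAt.comp_hasDerivAt t (hR.sub_const _)
  have h2 : HasDerivAt (fun s => (∫ x in Ω, G (f s x)) - (∫ x in Ω, G (f t x))
      - ℓ (toL2 Ω f s - toL2 Ω f t)) 0 t := by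
    rw [hasDerivAt_iff_isLittleO]
    have hO : (fun s => toL2 Ω f s - toL2 Ω f t) =O[𝓝 t] fun s => s - t := hR.isBigO_sub
    have hO2 : (fun s => C * ‖toL2 Ω f s - toL2 Ω f t‖ ^ 2) =o[𝓝 t] fun s => s - t := by
      refine Asymptotics.IsLittleO.const_mul_left ?_ C
      refine ((hO.norm_left).pow 2).trans_isLittleO ?_
      simp only [pow_two]
      have hz : (fun s : ℝ => s - t) =o[𝓝 t] fun _ => (1 : ℝ) := by
        rw [Asymptotics.isLittleO_one_iff]
        have := (tendsto_id (x := 𝓝 t)).sub_const t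
        rwa [sub_self] at this
      simpa using hz.mul_isBigO (Asymptotics.isBigO_refl (fun s : ℝ => s - t) (𝓝 t))
    refine Asymptotics.IsBigO.trans_isLittleO ?_ hO2
    refine Asymptotics.IsBigO.of_bound 1 ?_
    filter_upwards [isOpen_Ioo.mem_nhds ht] with s hs
    have := hℓ s (hf.1 s (Ioo_subset_Icc_self hs))
    simp only [sub_self, map_zero, smul_zero, sub_zero, one_mul]
    exact this.trans (le_abs_self _)
  have h3 := (h2.add h1).add_const (∫ x in Ω, G (f t x))
  rw [zero_add, hval] at h3
  refine h3.congr_of_eventuallyEq (Eventually.of_forall fun s => ?_)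
  simp

/-! ### Integrability in time of the supremum of the velocity gradient -/

theorem lowerSemicontinuous_eLpNorm_top_L2 (Ω : Set E3) :
    LowerSemicontinuous fun w : L2 Ω => eLpNorm w ∞ (volume.restrict Ω) := by
  refine lowerSemicontinuous_iff_isClosed_preimage.2 fun c => isSeqClosed_iff_isClosed.1 ?_
  intro w w₀ hw hlim
  obtain ⟨φ, -, hφ⟩ := (tendstoInMeasure_of_tendsto_Lp hlim).exists_seq_tendsto_ae
  exact Lp.eLpNorm_le_of_ae_tendsto (u := atTop)
    (Eventually.of_forall fun n => hw (φ n))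
    (fun n => Lp.aestronglyMeasurable _) hφ

theorem ContinuousInSobolev.weakPartial {Ω : Set E3} (hΩ : IsOpen Ω) {k : ℕ} {p : ℝ≥0∞} {T : ℝ}
    {f : ℝ → E3 → ℝ} (h : ContinuousInSobolev (k + 1) p Ω T f) (i : Fin 3) :
    ContinuousInSobolev 0 p Ω T (fun t => weakPartial Ω i (f t)) := by
  have hm : ∀ g, MemSobolev k p Ω g → MemLp g p (volume.restrict Ω) := by
    intro g hg
    cases k with
    | zero => exact hg
    | succ k => exact hg.1
  have hn : ∀ g, eLpNorm g p (volume.restrict Ω) ≤ sobolevENorm k p Ω g := by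
    intro g
    cases k with
    | zero => exact le_rfl
    | succ k => exact le_self_add
  refine ⟨fun t ht => hm _ ((h.1 t ht).2 i).2, fun t ht => ?_⟩
  refine tendsto_of_tendsto_of_tendsto_of_le_of_le' tendsto_const_nhds (h.2 t ht)
    (Eventually.of_forall fun s => zero_le) ?_
  filter_upwards [self_mem_nhdsWithin] with s hs
  have hd := ((hasWeakPartial_weakPartial ((h.1 s hs).2 i).1).sub
    (hasWeakPartial_weakPartial ((h.1 t ht).2 i).1)).weakPartial_ae_eq hΩ
  change eLpNorm (MHD.weakPartial Ω i (f s) - MHD.weakPartial Ω i (f t)) p (volume.restrict Ω) ≤ _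
  rw [← eLpNorm_congr_ae hd]
  refine (hn _).trans (le_trans ?_ le_add_self)
  exact Finset.single_le_sum
    (f := fun j => sobolevENorm k p Ω (MHD.weakPartial Ω j (f s - f t)))
    (fun _ _ => zero_le) (Finset.mem_univ i)

/-- The supremum norm of a first order derivative of `f ∈ C([0,T]; H²)` is measurable in time,
being a lower semicontinuous function of the derivative in `L²`. -/
theorem ContinuousInSobolev.aemeasurable_eLpNorm_weakPartial {Ω : Set E3} (hΩ : IsOpen Ω) {k : ℕ}
    {T : ℝ} {f : ℝ → E3 → ℝ} (h : ContinuousInSobolev (k + 1) 2 Ω T f) (i : Fin 3) :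
    AEMeasurable (fun t => eLpNorm (MHD.weakPartial Ω i (f t)) ∞ (volume.restrict Ω))
      (volume.restrict (Ioo 0 T)) := by
  have hw := h.weakPartial hΩ i
  borelize (L2 Ω)
  have hc := (hw.continuousOn_toL2.mono Ioo_subset_Icc_self).aemeasurable
    (μ := volume) measurableSet_Ioo
  refine ((lowerSemicontinuous_eLpNorm_top_L2 Ω).measurable.comp_aemeasurable hc).congr ?_
  filter_upwards [ae_restrict_mem measurableSet_Ioo] with t ht
  exact eLpNorm_congr_ae (toL2_coeFn (hw.1 t (Ioo_subset_Icc_self ht)))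

theorem lintegral_const_mul_lt_top_of_sq {T : ℝ} {s : ℝ → ℝ≥0∞}
    (hs : ∫⁻ t in Ioo 0 T, s t ^ 2 < ⊤) {C : ℝ≥0∞} (hC : C ≠ ⊤) :
    ∫⁻ t in Ioo 0 T, C * s t < ⊤ := by
  have hle : ∀ t, C * s t ≤ C * (1 + s t ^ 2) := by
    intro t
    gcongr
    rcases le_total (s t) 1 with h | h
    · exact h.trans le_self_add
    · exact (le_self_pow₀ h two_ne_zero).trans le_add_self
  refine (lintegral_mono hle).trans_lt ?_
  rw [lintegral_const_mul' _ _ hC, lintegral_add_left measurable_const]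
  refine ENNReal.mul_lt_top hC.lt_top (ENNReal.add_lt_top.2 ⟨?_, hs⟩)
  simp

/-- By the Sobolev embedding `W^{2,q} ⊂ W^{1,∞}`, `q > 3`, a function in
`C([0,T]; H²) ∩ L²(0,T; W^{2,q})` is in `L¹(0,T; W^{1,∞})`. -/
theorem lintegral_eLpNorm_weakPartial_lt_top {Ω : Set E3} {q C : ℝ≥0∞} (hC : C ≠ ⊤)
    (hemb : ∀ f, MemSobolev 1 q Ω f →
      ∀ᵐ x ∂volume.restrict Ω, ‖f x‖ₑ ≤ C * sobolevENorm 1 q Ω f) {T : ℝ} {f : ℝ → E3 → ℝ}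
    (h : SqIntegrableInSobolev 2 q Ω T f) (i : Fin 3) :
    ∫⁻ t in Ioo 0 T, eLpNorm (weakPartial Ω i (f t)) ∞ (volume.restrict Ω) < ⊤ := by
  refine lt_of_le_of_lt (lintegral_mono_ae ?_) (lintegral_const_mul_lt_top_of_sq h.2 hC)
  filter_upwards [h.1] with t ht
  rw [eLpNorm_exponent_top]
  refine essSup_le_of_ae_le _ ?_
  filter_upwards [hemb _ (ht.2 i).2] with x hx
  refine hx.trans ?_
  gcongr
  exact (Finset.single_le_sum (f := fun j => sobolevENorm 1 q Ω (weakPartial Ω j (f t)))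
    (fun _ _ => zero_le) (Finset.mem_univ i)).trans le_add_self

theorem MemSobolev.memSobolev_one_of_two {Ω : Set E3} {q : ℝ≥0∞} {f : E3 → ℝ}
    (h : MemSobolev 2 q Ω f) : MemSobolev 1 q Ω f :=
  ⟨h.1, fun i => ⟨(h.2 i).1, (h.2 i).2.1⟩⟩

theorem sobolevENorm_ne_top : ∀ (k : ℕ) {q : ℝ≥0∞} {Ω : Set E3} {f : E3 → ℝ},
    MemSobolev k q Ω f → sobolevENorm k q Ω f ≠ ⊤
  | 0, _, _, _, h => h.2.ne
  | k + 1, _, _, _, h => ENNReal.add_ne_top.2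
      ⟨h.1.2.ne, ENNReal.sum_ne_top.2 fun i _ => sobolevENorm_ne_top k (h.2 i).2⟩

theorem exists_ae_abs_le_of_memSobolev {Ω : Set E3} {q C : ℝ≥0∞} (hC : C ≠ ⊤)
    (hemb : ∀ f, MemSobolev 1 q Ω f →
      ∀ᵐ x ∂volume.restrict Ω, ‖f x‖ₑ ≤ C * sobolevENorm 1 q Ω f) {f : E3 → ℝ}
    (h : MemSobolev 1 q Ω f) : ∃ M : ℝ, ∀ᵐ x ∂volume.restrict Ω, |f x| ≤ M := by
  refine ⟨(C * sobolevENorm 1 q Ω f).toReal, ?_⟩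
  filter_upwards [hemb f h] with x hx
  have := ENNReal.toReal_mono (ENNReal.mul_ne_top hC (sobolevENorm_ne_top 1 h)) hx
  rwa [toReal_enorm, Real.norm_eq_abs] at this

theorem ae_abs_le_toReal_eLpNorm_top {Ω : Set E3} {f : E3 → ℝ}
    (h : eLpNorm f ∞ (volume.restrict Ω) ≠ ⊤) :
    ∀ᵐ x ∂volume.restrict Ω, |f x| ≤ (eLpNorm f ∞ (volume.restrict Ω)).toReal := by
  filter_upwards [enorm_ae_le_eLpNormEssSup f (volume.restrict Ω)] with x hx
  rw [← eLpNorm_exponent_top] at hx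
  have := ENNReal.toReal_mono h hx
  rwa [toReal_enorm, Real.norm_eq_abs] at this

/-! ### Negative powers of the density -/

/-- The regularized negative power `(r² + δ²)⁻ᵖ`. -/
def negPow (δ : ℝ) (p : ℕ) (r : ℝ) : ℝ := ((r ^ 2 + δ ^ 2)⁻¹) ^ p

theorem negPow_pos {δ : ℝ} (hδ : 0 < δ) (p : ℕ) (r : ℝ) : 0 < negPow δ p r := by
  unfold negPow; positivity

theorem negPow_succ (δ : ℝ) (p : ℕ) (r : ℝ) :
    negPow δ (p + 1) r = negPow δ p r * (r ^ 2 + δ ^ 2)⁻¹ := pow_succ _ _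

theorem hasDerivAt_negPow {δ : ℝ} (hδ : 0 < δ) (p : ℕ) (r : ℝ) :
    HasDerivAt (negPow δ p) (-(2 * p) * r * negPow δ (p + 1) r) r := by
  have hne : r ^ 2 + δ ^ 2 ≠ 0 := by positivity
  have h1 : HasDerivAt (fun r : ℝ => r ^ 2 + δ ^ 2) (2 * r) r := by
    simpa using (hasDerivAt_pow 2 r).add_const (δ ^ 2)
  refine ((h1.inv hne).pow p).congr_deriv ?_
  unfold negPow
  cases p with
  | zero => simp
  | succ n =>
    simp only [Nat.add_sub_cancel, Pi.inv_apply, div_eq_mul_inv, ← inv_pow]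
    push_cast
    ring

theorem deriv_negPow {δ : ℝ} (hδ : 0 < δ) (p : ℕ) :
    deriv (negPow δ p) = fun r => -(2 * p) * r * negPow δ (p + 1) r :=
  funext fun r => (hasDerivAt_negPow hδ p r).deriv

theorem continuous_negPow {δ : ℝ} (hδ : 0 < δ) (p : ℕ) : Continuous (negPow δ p) :=
  continuous_iff_continuousAt.2 fun r => (hasDerivAt_negPow hδ p r).continuousAt

theorem continuous_deriv_negPow {δ : ℝ} (hδ : 0 < δ) (p : ℕ) :
    Continuous (deriv (negPow δ p)) := by
  rw [deriv_negPow hδ]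
  exact (continuous_const.mul continuous_id).mul (continuous_negPow hδ _)

theorem contDiff_negPow {δ : ℝ} (hδ : 0 < δ) (p : ℕ) : ContDiff ℝ 1 (negPow δ p) :=
  contDiff_one_iff_deriv.2
    ⟨fun r => (hasDerivAt_negPow hδ p r).differentiableAt, continuous_deriv_negPow hδ p⟩

theorem negPow_le_of_abs_le {δ : ℝ} (hδ : 0 < δ) (p : ℕ) {r s : ℝ} (h : |s| ≤ |r|) :
    negPow δ p r ≤ negPow δ p s := by
  unfold negPow
  have := sq_le_sq.2 h
  gcongr

theorem negPow_le {δ : ℝ} (hδ : 0 < δ) (p : ℕ) (r : ℝ) : negPow δ p r ≤ negPow δ p 0 :=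
  negPow_le_of_abs_le hδ p (by simp)

theorem sq_mul_negPow_succ_le {δ : ℝ} (hδ : 0 < δ) (p : ℕ) (r : ℝ) :
    r ^ 2 * negPow δ (p + 1) r ≤ negPow δ p r := by
  have h : r ^ 2 * (r ^ 2 + δ ^ 2)⁻¹ ≤ 1 := by
    rw [← div_eq_mul_inv]
    exact div_le_one_of_le₀ (by nlinarith [sq_nonneg δ]) (by positivity)
  rw [negPow_succ]
  nlinarith [negPow_pos hδ p r]

/-- The exponents are such that `|r G'(r)| ≤ 2p G(r)` uniformly in the regularization. -/
theorem abs_mul_deriv_negPow_le {δ : ℝ} (hδ : 0 < δ) (p : ℕ) (r : ℝ) :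
    |r * deriv (negPow δ p) r| ≤ 2 * p * negPow δ p r := by
  have h : r * deriv (negPow δ p) r = -(2 * p * (r ^ 2 * negPow δ (p + 1) r)) := by
    rw [deriv_negPow hδ]; ring
  have h0 := (negPow_pos hδ (p + 1) r).le
  rw [h, abs_neg, abs_of_nonneg (by positivity)]
  gcongr
  exact sq_mul_negPow_succ_le hδ p r

theorem abs_deriv_negPow_le {δ : ℝ} (hδ : 0 < δ) (p : ℕ) (r : ℝ) :
    |deriv (negPow δ p) r| ≤ 2 * p * (negPow δ (p + 1) 0 + negPow δ p 0) := by
  have h0 := (negPow_pos hδ (p + 1) r).le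
  have h1 : |r| ≤ 1 + r ^ 2 := by
    rw [← sq_abs]; nlinarith [sq_nonneg (|r| - 1), abs_nonneg r]
  rw [deriv_negPow hδ]
  simp only [abs_mul, abs_neg, abs_of_nonneg h0]
  rw [Nat.abs_cast, abs_two, mul_assoc]
  gcongr
  have h2 := mul_le_mul_of_nonneg_right h1 h0
  have h3 := sq_mul_negPow_succ_le hδ p r
  have h4 := negPow_le hδ p r
  have h5 := negPow_le hδ (p + 1) r
  linarith

theorem hasDerivAt_deriv_negPow {δ : ℝ} (hδ : 0 < δ) (p : ℕ) (r : ℝ) :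
    HasDerivAt (deriv (negPow δ p)) (-(2 * p) * negPow δ (p + 1) r
      + 2 * p * (2 * (p + 1 : ℕ)) * (r ^ 2 * negPow δ (p + 1 + 1) r)) r := by
  rw [deriv_negPow hδ]
  have h1 : HasDerivAt (fun r : ℝ => -(2 * p) * r) (-(2 * p)) r := by
    simpa using (hasDerivAt_id r).const_mul (-(2 * p : ℝ))
  refine (h1.mul (hasDerivAt_negPow hδ (p + 1) r)).congr_deriv ?_
  push_cast
  ring

theorem abs_sub_sub_deriv_mul_le {G : ℝ → ℝ} {C : ℝ} {G'' : ℝ → ℝ} (hG : Differentiable ℝ G)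
    (hG' : ∀ r, HasDerivAt (deriv G) (G'' r) r) (hC : ∀ r, |G'' r| ≤ C) (x y : ℝ) :
    |G y - G x - deriv G x * (y - x)| ≤ C * (y - x) ^ 2 := by
  have h1 : ∀ s, |deriv G s - deriv G x| ≤ C * |s - x| := fun s =>
    convex_univ.norm_image_sub_le_of_norm_hasDerivWithin_le
      (fun r _ => (hG' r).hasDerivWithinAt) (fun r _ => hC r) (mem_univ x) (mem_univ s)
  have hd : ∀ s, HasDerivAt (fun s => G s - deriv G x * s) (deriv G s - deriv G x) s := by
    intro s
    have h := (hG s).hasDerivAt.sub ((hasDerivAt_id s).const_mul (deriv G x))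
    rw [mul_one] at h
    exact h
  have hC0 : 0 ≤ C := (abs_nonneg _).trans (hC 0)
  have h2 := (convex_uIcc x y).norm_image_sub_le_of_norm_hasDerivWithin_le
    (fun s _ => (hd s).hasDerivWithinAt) (C := C * |y - x|)
    (fun s hs => (h1 s).trans (mul_le_mul_of_nonneg_left (abs_sub_left_of_mem_uIcc hs) hC0))
    left_mem_uIcc right_mem_uIcc
  rw [Real.norm_eq_abs, Real.norm_eq_abs, mul_assoc, abs_mul_abs_self] at h2
  calc _ = |G y - deriv G x * y - (G x - deriv G x * x)| := by congr 1; ring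
    _ ≤ _ := h2
    _ = _ := by ring

theorem exists_taylor_negPow {δ : ℝ} (hδ : 0 < δ) (p : ℕ) : ∃ C, ∀ x y,
    |negPow δ p y - negPow δ p x - deriv (negPow δ p) x * (y - x)| ≤ C * (y - x) ^ 2 := by
  refine ⟨2 * p * negPow δ (p + 1) 0 + 2 * p * (2 * (p + 1 : ℕ)) * negPow δ (p + 1) 0,
    abs_sub_sub_deriv_mul_le (fun r => (hasDerivAt_negPow hδ p r).differentiableAt)
      (hasDerivAt_deriv_negPow hδ p) fun r => ?_⟩
  have h0 := (negPow_pos hδ (p + 1) r).le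
  have h1 := (negPow_pos hδ (p + 1 + 1) r).le
  refine (abs_add_le _ _).trans ?_
  rw [neg_mul, abs_neg, abs_of_nonneg (by positivity), abs_of_nonneg (by positivity)]
  have h4 := negPow_le hδ (p + 1) r
  have h5 := (sq_mul_negPow_succ_le hδ (p + 1) r).trans h4
  gcongr

/-! ### The renormalized continuity equation -/

/-- The identity `∫ G'(ρ) div (ρu) = ∫ (ρ G'(ρ) - G(ρ)) div u` for `u · n = 0` on the boundary. -/
theorem integral_deriv_mul_weakDiv {Ω : Set E3} (hΩ : IsSmoothSimplyConnectedDomain Ω)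
    {r : E3 → ℝ} {r' : Fin 3 → E3 → ℝ} {R : ℝ} (hr : ∀ᵐ x ∂volume.restrict Ω, |r x| ≤ R)
    (hr' : ∀ j, HasWeakPartial Ω j r (r' j)) (hri : ∀ j, IntegrableOn (r' j) Ω)
    {u : E3 → E3} {g : Fin 3 → Fin 3 → E3 → ℝ} {M U : ℝ}
    (hu : ∀ i, ∀ᵐ x ∂volume.restrict Ω, |u x i| ≤ U)
    (hw : ∀ i j, HasWeakPartial Ω j (fun y => u y i) (g i j))
    (hg : ∀ i j, ∀ᵐ x ∂volume.restrict Ω, |g i j x| ≤ M) (hM : 0 ≤ M)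
    (hn : NormalComponentVanishes Ω u) {G : ℝ → ℝ} {B B' : ℝ} (hG : ContDiff ℝ 1 G)
    (hB : ∀ s, |G s| ≤ B) (hB' : ∀ s, |deriv G s| ≤ B') :
    ∫ x in Ω, deriv G (r x) * weakDiv Ω (fun y => r y • u y) x
      = ∫ x in Ω, (r x * deriv G (r x) - G (r x)) * ∑ j, g j j x := by
  have hfin : volume Ω ≠ ⊤ := hΩ.isBounded.measure_lt_top.ne
  have hG' : Continuous (deriv G) := hG.continuous_deriv le_rfl
  have hrm : AEStronglyMeasurable r (volume.restrict Ω) := (hr' 0).1.aestronglyMeasurable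
  have hgi : ∀ i j, IntegrableOn (g i j) Ω := fun i j =>
    integrableOn_of_ae_abs_le hfin (hw i j).2.1.aestronglyMeasurable (hg i j)
  have hri0 : IntegrableOn r Ω := integrableOn_of_ae_abs_le hfin hrm hr
  have hdiv : ∀ᵐ x ∂volume.restrict Ω, weakDiv Ω (fun y => r y • u y) x
      = ∑ j, (r x * g j j x + r' j x * u x j) := by
    have h1 : ∀ j, weakPartial Ω j (fun y => r y * u y j)
        =ᵐ[volume.restrict Ω] fun x => r x * g j j x + r' j x * u x j := fun j =>
      ((hr' j).mul hΩ.isOpen hfin (hw j j) hr (hu j) (hri j) (hgi j j)).weakPartial_ae_eq hΩ.isOpen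
    filter_upwards [ae_all_iff.2 h1] with x hx
    simp only [weakDiv, PiLp.smul_apply, smul_eq_mul]
    exact Finset.sum_congr rfl fun j _ => hx j
  have hcomp : ∀ j, HasWeakPartial Ω j (fun x => G (r x)) (fun x => deriv G (r x) * r' j x) :=
    fun j => (hr' j).comp hΩ.isOpen hfin hri0 (hri j) hG hB hB'
  have hGm : AEStronglyMeasurable (fun x => G (r x)) (volume.restrict Ω) :=
    hG.continuous.comp_aestronglyMeasurable hrm
  have hGm' : AEStronglyMeasurable (fun x => deriv G (r x)) (volume.restrict Ω) :=
    hG'.comp_aestronglyMeasurable hrm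
  have hGr : ∀ᵐ x ∂volume.restrict Ω, |G (r x)| ≤ B := Eventually.of_forall fun x => hB _
  have hci : ∀ j, IntegrableOn (fun x => deriv G (r x) * r' j x) Ω := fun j =>
    (hri j).bdd_mul hGm' (Eventually.of_forall fun x => hB' _)
  have hD : ∀ j, HasWeakPartial Ω j (fun x => G (r x) * u x j)
      (fun x => G (r x) * g j j x + deriv G (r x) * r' j x * u x j) := fun j =>
    (hcomp j).mul hΩ.isOpen hfin (hw j j) hGr (hu j) (hci j) (hgi j j)
  have hDi : ∀ j, IntegrableOn (fun x => G (r x) * g j j x + deriv G (r x) * r' j x * u x j) Ω :=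
    fun j => ((hgi j j).bdd_mul hGm hGr).add
      ((hci j).mul_bdd (hw j j).1.aestronglyMeasurable (hu j))
  have hzero := integral_div_eq_zero hΩ hu hw hg hM hn hGm hGr hD hDi
  have hrG : IntegrableOn (fun x => (r x * deriv G (r x) - G (r x)) * ∑ j, g j j x) Ω := by
    refine Integrable.bdd_mul (c := R * B' + B) (integrable_finsetSum _ fun j _ => hgi j j)
      ((hrm.mul hGm').sub hGm) ?_
    filter_upwards [hr] with x hx
    have hR : 0 ≤ R := (abs_nonneg _).trans hx
    refine (norm_sub_le _ _).trans (add_le_add ?_ (hB _))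
    rw [norm_mul]
    exact mul_le_mul hx (hB' _) (norm_nonneg _) hR
  rw [← add_zero (∫ x in Ω, (r x * deriv G (r x) - G (r x)) * ∑ j, g j j x), ← hzero,
    ← integral_add hrG (integrable_finsetSum _ fun j _ => hDi j)]
  refine integral_congr_ae ?_
  filter_upwards [hdiv] with x hx
  rw [hx]
  simp only [Fin.sum_univ_three]
  ring

/-! ### Propagation of lower bounds of the density backwards in time -/

/-- Backward Grönwall inequality with an integrable rate, in logarithmic form. -/
theorem le_exp_integral_mul_of_abs_deriv_le {T : ℝ} (hT : 0 ≤ T) {Y Y' A : ℝ → ℝ}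
    (hY : ContinuousOn Y (Icc 0 T)) (hpos : ∀ t ∈ Icc 0 T, 0 < Y t)
    (hd : ∀ t ∈ Ioo 0 T, HasDerivAt Y (Y' t) t) (hA : IntegrableOn A (Ioo 0 T))
    (hle : ∀ᵐ t ∂volume.restrict (Ioo 0 T), |Y' t| ≤ A t * Y t) :
    Y 0 ≤ Real.exp (∫ t in Ioo 0 T, A t) * Y T := by
  have hlc : ContinuousOn (fun t => Real.log (Y t)) (Icc 0 T) :=
    hY.log fun t ht => (hpos t ht).ne'
  have hld : ∀ t ∈ Ioo 0 T, HasDerivAt (fun t => Real.log (Y t)) (Y' t / Y t) t := fun t ht =>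
    (hd t ht).log (hpos t (Ioo_subset_Icc_self ht)).ne'
  have hb : ∀ᵐ t ∂volume.restrict (Ioo 0 T), |Y' t / Y t| ≤ A t := by
    filter_upwards [hle, ae_restrict_mem measurableSet_Ioo] with t h ht
    have h0 := hpos t (Ioo_subset_Icc_self ht)
    rwa [abs_div, abs_of_pos h0, div_le_iff₀ h0]
  have hm : AEStronglyMeasurable (fun t => Y' t / Y t) (volume.restrict (Ioo 0 T)) := by
    refine (measurable_deriv fun t => Real.log (Y t)).aestronglyMeasurable.congr ?_
    filter_upwards [ae_restrict_mem measurableSet_Ioo] with t ht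
    exact (hld t ht).deriv
  have hi : IntegrableOn (fun t => Y' t / Y t) (Ioo 0 T) := hA.mono' hm hb
  have hftc := intervalIntegral.integral_eq_sub_of_hasDerivAt_of_le hT hlc hld
    ((intervalIntegrable_iff_integrableOn_Ioo_of_le hT).2 hi)
  rw [intervalIntegral.integral_of_le hT, integral_Ioc_eq_integral_Ioo] at hftc
  have hn : |∫ t in Ioo 0 T, Y' t / Y t| ≤ ∫ t in Ioo 0 T, A t :=
    (Real.norm_eq_abs _).symm.trans_le (norm_integral_le_of_norm_le hA hb)
  rw [hftc, abs_le] at hn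
  have h0 := hpos 0 (left_mem_Icc.2 hT)
  have hT0 := hpos T (right_mem_Icc.2 hT)
  rw [← Real.log_le_log_iff h0 (mul_pos (Real.exp_pos _) hT0),
    Real.log_mul (Real.exp_pos _).ne' hT0.ne', Real.log_exp]
  linarith [hn.1]

/-- At a time at which the continuity equation holds,
`|∫ G'(ρ) ρ_t| ≤ (2p + 1) ‖div u‖_∞ ∫ G(ρ)` for `G(r) = (r² + δ²)⁻ᵖ`. -/
theorem abs_integral_deriv_negPow_mul_le {Ω : Set E3} (hΩ : IsSmoothSimplyConnectedDomain Ω)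
    {q C : ℝ≥0∞} (hC : C ≠ ⊤) (hq : 1 ≤ q)
    (hemb : ∀ f, MemSobolev 1 q Ω f →
      ∀ᵐ x ∂volume.restrict Ω, ‖f x‖ₑ ≤ C * sobolevENorm 1 q Ω f)
    {r rt : E3 → ℝ} (hr : MemSobolev 1 q Ω r) {u : E3 → E3}
    (hu : ∀ i, MemSobolev 2 q Ω (fun x => u x i)) (hn : NormalComponentVanishes Ω u)
    (hmass : ∀ᵐ x ∂volume.restrict Ω, rt x + weakDiv Ω (fun y => r y • u y) x = 0)
    {A : ℝ} (hA : ∀ᵐ x ∂volume.restrict Ω, |weakDiv Ω u x| ≤ A) {δ : ℝ} (hδ : 0 < δ) (p : ℕ) :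
    |∫ x in Ω, deriv (negPow δ p) (r x) * rt x|
      ≤ (2 * p + 1) * A * ∫ x in Ω, negPow δ p (r x) := by
  have hfin : volume Ω ≠ ⊤ := hΩ.isBounded.measure_lt_top.ne
  have hfinm : IsFiniteMeasure (volume.restrict Ω) := isFiniteMeasure_restrict.2 hfin
  obtain ⟨R, hR⟩ := exists_ae_abs_le_of_memSobolev hC hemb hr
  choose U hU using fun i => exists_ae_abs_le_of_memSobolev hC hemb (hu i).memSobolev_one_of_two
  choose M hM using fun i j => exists_ae_abs_le_of_memSobolev hC hemb ((hu i).2 j).2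
  have hUs : ∀ i, ∀ᵐ x ∂volume.restrict Ω, |u x i| ≤ ∑ k, |U k| := by
    intro i
    filter_upwards [hU i] with x hx
    exact hx.trans ((le_abs_self _).trans
      (Finset.single_le_sum (f := fun k => |U k|) (fun _ _ => abs_nonneg _) (Finset.mem_univ i)))
  have hMs : ∀ i j, ∀ᵐ x ∂volume.restrict Ω,
      |weakPartial Ω j (fun y => u y i) x| ≤ ∑ k, ∑ l, |M k l| := by
    intro i j
    filter_upwards [hM i j] with x hx
    refine hx.trans ((le_abs_self _).trans ?_)
    refine (Finset.single_le_sum (f := fun l => |M i l|) (fun _ _ => abs_nonneg _)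
      (Finset.mem_univ j)).trans ?_
    exact Finset.single_le_sum (f := fun k => ∑ l, |M k l|)
      (fun _ _ => Finset.sum_nonneg fun _ _ => abs_nonneg _) (Finset.mem_univ i)
  have hB : ∀ s, |negPow δ p s| ≤ negPow δ p 0 := fun s => by
    rw [abs_of_pos (negPow_pos hδ p s)]; exact negPow_le hδ p s
  have key := integral_deriv_mul_weakDiv hΩ hR
    (fun j => hasWeakPartial_weakPartial (hr.2 j).1)
    (fun j => (hr.2 j).2.integrable hq) hUs
    (fun i j => hasWeakPartial_weakPartial ((hu i).2 j).1) hMs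
    (Finset.sum_nonneg fun _ _ => Finset.sum_nonneg fun _ _ => abs_nonneg _) hn
    (contDiff_negPow hδ p) hB (abs_deriv_negPow_le hδ p)
  have e : ∫ x in Ω, deriv (negPow δ p) (r x) * rt x
      = -∫ x in Ω, deriv (negPow δ p) (r x) * weakDiv Ω (fun y => r y • u y) x := by
    rw [← integral_neg]
    refine integral_congr_ae ?_
    filter_upwards [hmass] with x hx
    rw [eq_neg_of_add_eq_zero_left hx, mul_neg]
  have hGi : IntegrableOn (fun x => negPow δ p (r x)) Ω :=
    integrableOn_of_ae_abs_le hfin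
      ((continuous_negPow hδ p).comp_aestronglyMeasurable hr.1.aestronglyMeasurable)
      (Eventually.of_forall fun x => hB _)
  rw [e, abs_neg, key, ← integral_const_mul, ← Real.norm_eq_abs]
  refine norm_integral_le_of_norm_le (hGi.const_mul _) ?_
  filter_upwards [hA] with x hx
  have h0 := (negPow_pos hδ p (r x)).le
  rw [norm_mul, mul_assoc, mul_comm A, ← mul_assoc]
  refine mul_le_mul ?_ hx (norm_nonneg _) (by positivity)
  refine (norm_sub_le _ _).trans ?_
  rw [Real.norm_eq_abs, Real.norm_eq_abs, abs_of_nonneg h0]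
  linarith [abs_mul_deriv_negPow_le hδ p (r x)]

/-- Along a strong solution, the integrals of negative powers of the density at two times are
comparable, with a constant that is exponential in the power and does not depend on the
regularization. -/
theorem IsStrongSolutionWith.exists_integral_negPow_le {Ω : Set E3}
    (hΩ : IsSmoothSimplyConnectedDomain Ω) {mu lam γ T : ℝ} (hT : 0 < T)
    {ρ₀ : E3 → ℝ} {u₀ H₀ : E3 → E3} {ρ : ℝ → E3 → ℝ} {u H : ℝ → E3 → E3}
    {q : ℝ≥0∞} {ρt : ℝ → E3 → ℝ} {ut Ht mt : ℝ → E3 → E3}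
    (hs : IsStrongSolutionWith Ω mu lam γ T ρ₀ u₀ H₀ ρ u H q ρt ut Ht mt) :
    ∃ K : ℝ, ∀ δ : ℝ, 0 < δ → ∀ p : ℕ,
      ∫ x in Ω, negPow δ p (ρ 0 x)
        ≤ Real.exp ((2 * p + 1) * K) * ∫ x in Ω, negPow δ p (ρ T x) := by
  have hfin : volume Ω ≠ ⊤ := hΩ.isBounded.measure_lt_top.ne
  have hfinm : IsFiniteMeasure (volume.restrict Ω) := isFiniteMeasure_restrict.2 hfin
  have hne : Ω.Nonempty := hΩ.isSimplyConnected.nonempty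
  have hq2 : (2 : ℝ≥0∞) ≤ q := le_trans (by norm_num) hs.q_gt.le
  have hq1 : (1 : ℝ≥0∞) ≤ q := le_trans (by norm_num) hs.q_gt.le
  obtain ⟨C, hC, hemb⟩ := exists_sobolev_embedding_const hΩ.isOpen hΩ.isBounded
    (fun x hx => hΩ.exists_hasInteriorCone hx) hs.q_gt (hs.q_le.trans_lt (by simp)).ne
  set a : Fin 3 → ℝ → ℝ≥0∞ := fun i t =>
    eLpNorm (weakPartial Ω i (fun x => u t x i)) ∞ (volume.restrict Ω) with ha
  have ham : ∀ i, AEMeasurable (a i) (volume.restrict (Ioo 0 T)) := fun i =>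
    (hs.u_cont i).aemeasurable_eLpNorm_weakPartial hΩ.isOpen i
  have hai : ∀ i, ∫⁻ t in Ioo 0 T, a i t ≠ ⊤ := fun i =>
    (lintegral_eLpNorm_weakPartial_lt_top hC hemb (hs.u_sq i) i).ne
  have hA : IntegrableOn (fun t => ∑ i, (a i t).toReal) (Ioo 0 T) :=
    integrable_finsetSum _ fun i _ => integrable_toReal_of_lintegral_ne_top (ham i) (hai i)
  refine ⟨∫ t in Ioo 0 T, ∑ i, (a i t).toReal, fun δ hδ p => ?_⟩
  obtain ⟨C₂, hC₂⟩ := exists_taylor_negPow hδ p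
  have hB : ∀ s, |negPow δ p s| ≤ negPow δ p 0 := fun s => by
    rw [abs_of_pos (negPow_pos hδ p s)]; exact negPow_le hδ p s
  have hρ2 := hs.rho_cont.to_L2 hfin hq2
  have hρt2 := hs.rhot_cont.to_L2 hfin hq2
  have hpos : ∀ t ∈ Icc 0 T, 0 < ∫ x in Ω, negPow δ p (ρ t x) := by
    intro t ht
    have hi : IntegrableOn (fun x => negPow δ p (ρ t x)) Ω :=
      integrableOn_of_ae_abs_le hfin ((continuous_negPow hδ p).comp_aestronglyMeasurable
        (hρ2.1 t ht).aestronglyMeasurable) (Eventually.of_forall fun x => hB _)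
    rw [integral_pos_iff_support_of_nonneg (fun x => (negPow_pos hδ p _).le) hi]
    have : Function.support (fun x => negPow δ p (ρ t x)) = univ :=
      eq_univ_of_forall fun x => (negPow_pos hδ p _).ne'
    rw [this, Measure.restrict_apply_univ]
    exact hΩ.isOpen.measure_pos _ hne
  have hfinal := le_exp_integral_mul_of_abs_deriv_le hT.le
    (continuousOn_integral_comp hfin (continuous_negPow hδ p) (continuous_deriv_negPow hδ p) hB
      (abs_deriv_negPow_le hδ p) hC₂ hρ2) hpos
    (fun t ht => hasDerivAt_integral_comp hΩ.isOpen hfin (continuous_negPow hδ p)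
      (continuous_deriv_negPow hδ p) hB (abs_deriv_negPow_le hδ p) hC₂ hs.rho_timeDeriv hρ2 hρt2
      ht)
    (hA.const_mul (2 * p + 1)) ?_
  · rwa [integral_const_mul] at hfinal
  filter_upwards [hs.mass_eq, ae_all_iff.2 fun i => (hs.u_sq i).1,
    ae_all_iff.2 fun i => ae_lt_top' (ham i) (hai i), ae_restrict_mem measurableSet_Ioo]
    with t hmass hu hfa ht
  refine abs_integral_deriv_negPow_mul_le hΩ hC hq1 hemb
    (hs.rho_cont.1 t (Ioo_subset_Icc_self ht)) hu (hs.u_normal t (Ioo_subset_Ioc_self ht)) hmass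
    ?_ hδ p
  filter_upwards [ae_all_iff.2 fun i => ae_abs_le_toReal_eLpNorm_top (hfa i).ne] with x hx
  exact (Finset.abs_sum_le_sum_abs _ _).trans (Finset.sum_le_sum fun i _ => hx i)

/-- Letting the power tend to infinity, bounds on the integrals of negative powers become a lower
bound. -/
theorem ae_le_of_integral_negPow_le {Ω : Set E3} (hfin : volume Ω ≠ ⊤) {r s : E3 → ℝ}
    (hrm : AEStronglyMeasurable r (volume.restrict Ω))
    (hsm : AEStronglyMeasurable s (volume.restrict Ω))
    (hr : ∀ᵐ x ∂volume.restrict Ω, 0 ≤ r x) {c K : ℝ} (hc : 0 < c)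
    (hs : ∀ᵐ x ∂volume.restrict Ω, c ≤ s x)
    (h : ∀ δ : ℝ, 0 < δ → ∀ p : ℕ, ∫ x in Ω, negPow δ p (r x)
      ≤ Real.exp ((2 * p + 1) * K) * ∫ x in Ω, negPow δ p (s x)) :
    ∀ᵐ x ∂volume.restrict Ω, c * Real.exp (-K) / 2 ≤ r x := by
  have hfinm : IsFiniteMeasure (volume.restrict Ω) := isFiniteMeasure_restrict.2 hfin
  set α := c * Real.exp (-K) / 2 with hα
  have hα0 : 0 < α := by positivity
  set m := (volume.restrict Ω).real {x | ¬ α ≤ r x} with hm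
  have hint : ∀ {f : E3 → ℝ} (p : ℕ), AEStronglyMeasurable f (volume.restrict Ω) →
      IntegrableOn (fun x => negPow α p (f x)) Ω := fun p hf =>
    integrableOn_of_ae_abs_le hfin ((continuous_negPow hα0 p).comp_aestronglyMeasurable hf)
      (Eventually.of_forall fun x => by
        rw [abs_of_pos (negPow_pos hα0 p _)]; exact negPow_le hα0 p _)
  -- With `δ = α`, the ratio `(c² + δ²)⁻¹ e^{2K} / (α² + δ²)⁻¹` is at most `1 / 2`.
  have hbound : ∀ p : ℕ, m ≤ volume.real Ω * Real.exp K * (1 / 2) ^ p := by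
    intro p
    have h1 : negPow α p α * m ≤ ∫ x in Ω, negPow α p (r x) := by
      refine le_trans ?_ (mul_meas_ge_le_integral_of_nonneg
        (Eventually.of_forall fun x => (negPow_pos hα0 p _).le) (hint p hrm) (negPow α p α))
      refine mul_le_mul_of_nonneg_left ?_ (negPow_pos hα0 p _).le
      refine ENNReal.toReal_mono (measure_ne_top _ _) (measure_mono_ae ?_)
      filter_upwards [hr] with x hx hxα
      refine negPow_le_of_abs_le hα0 p ?_
      rw [abs_of_nonneg hx, abs_of_pos hα0]
      exact (not_le.1 hxα).le
    have h2 : ∫ x in Ω, negPow α p (s x) ≤ ((c ^ 2)⁻¹) ^ p * volume.real Ω := by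
      refine (setIntegral_mono_ae_restrict (hint p hsm)
        (integrableOn_const hfin : IntegrableOn (fun _ => ((c ^ 2)⁻¹) ^ p) Ω) ?_).trans
        (le_of_eq ?_)
      · filter_upwards [hs] with x hx
        unfold negPow
        have : c ^ 2 ≤ s x ^ 2 + α ^ 2 := by nlinarith [sq_nonneg α]
        gcongr
      · rw [setIntegral_const, smul_eq_mul, mul_comm]
    have h3 := h1.trans ((h α hα0 p).trans (mul_le_mul_of_nonneg_left h2 (Real.exp_pos _).le))
    have h4 : (c ^ 2)⁻¹ * Real.exp (2 * K) = 1 / 2 * (α ^ 2 + α ^ 2)⁻¹ := by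
      have : Real.exp (2 * K) = (Real.exp (-K) ^ 2)⁻¹ := by
        rw [← Real.exp_nat_mul, ← Real.exp_neg]; congr 1; push_cast; ring
      rw [this, hα]
      have := Real.exp_pos (-K)
      field_simp
      ring
    have h5 : Real.exp ((2 * p + 1) * K) * (((c ^ 2)⁻¹) ^ p * volume.real Ω)
        = negPow α p α * (volume.real Ω * Real.exp K * (1 / 2) ^ p) := by
      have : Real.exp ((2 * p + 1) * K) = Real.exp (2 * K) ^ p * Real.exp K := by
        rw [← Real.exp_nat_mul, ← Real.exp_add]; congr 1; ring
      rw [this]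
      calc _ = ((c ^ 2)⁻¹ * Real.exp (2 * K)) ^ p * (volume.real Ω * Real.exp K) := by
            rw [mul_pow]; ring
        _ = _ := by rw [h4, mul_pow]; unfold negPow; ring
    rw [h5] at h3
    exact le_of_mul_le_mul_left h3 (negPow_pos hα0 p α)
  have hlim : Tendsto (fun p : ℕ => volume.real Ω * Real.exp K * (1 / 2 : ℝ) ^ p) atTop (𝓝 0) := by
    have := (tendsto_pow_atTop_nhds_zero_of_lt_one (r := (1 / 2 : ℝ)) (by norm_num)
      (by norm_num)).const_mul (volume.real Ω * Real.exp K)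
    rwa [mul_zero] at this
  have hm0 : m = 0 := le_antisymm (ge_of_tendsto' hlim hbound) measureReal_nonneg
  rw [ae_iff]
  exact (measureReal_eq_zero_iff (measure_ne_top _ _)).1 hm0

theorem infOver_congr {Ω : Set E3} {f g : E3 → ℝ} (h : ∀ᵐ x ∂volume.restrict Ω, f x = g x) :
    infOver Ω f = infOver Ω g := essInf_congr_ae h

theorem ae_infOver_le {Ω : Set E3} {f : E3 → ℝ} (h : ∀ᵐ x ∂volume.restrict Ω, 0 ≤ f x) :
    ∀ᵐ x ∂volume.restrict Ω, infOver Ω f ≤ f x :=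
  ae_essInf_le ⟨0, h⟩

theorem le_infOver {Ω : Set E3} (hΩ : IsOpen Ω) (hne : Ω.Nonempty) {f : E3 → ℝ} {c M : ℝ}
    (hM : ∀ᵐ x ∂volume.restrict Ω, |f x| ≤ M) (h : ∀ᵐ x ∂volume.restrict Ω, c ≤ f x) :
    c ≤ infOver Ω f := by
  have : NeBot (ae (volume.restrict Ω)) := by
    rw [ae_neBot, Ne, Measure.restrict_eq_zero]
    exact (hΩ.measure_pos _ hne).ne'
  refine le_essInf_of_ae_le c h (IsBoundedUnder.isCoboundedUnder_ge ⟨M, ?_⟩)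
  exact hM.mono fun x hx => (le_abs_self _).trans hx

end MHD

end

theorem corollary1p2
    (Ω : Set MHD.E3) (hΩ : MHD.IsSmoothSimplyConnectedDomain Ω)
    (mu lam γ : ℝ) (hmu : 0 < mu) (hlam : 0 ≤ 2 * mu + 3 * lam) (hγ : 1 < γ)
    (ρ₀ : MHD.E3 → ℝ) (u₀ H₀ : MHD.E3 → MHD.E3)
    (hdata : MHD.IsAdmissibleInitialData Ω ρ₀ u₀ H₀)
    (ρ : ℝ → MHD.E3 → ℝ) (u H : ℝ → MHD.E3 → MHD.E3)
    (hsol : MHD.IsGlobalStrongSolution Ω mu lam γ ρ₀ u₀ H₀ ρ u H)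
    (ρhat : ℝ) (hρhat : 0 < ρhat)
    (hbound : ∀ t : ℝ, 0 ≤ t →
      eLpNorm (ρ t) ∞ (volume.restrict Ω) ≤ ENNReal.ofReal ρhat)
    (hvac : MHD.infOver Ω ρ₀ = 0) :
    ∀ t : ℝ, 0 ≤ t → MHD.infOver Ω (ρ t) = 0 := by
  intro t ht
  have hne := hΩ.isSimplyConnected.nonempty
  have hbd : ∀ s, 0 ≤ s → ∀ᵐ x ∂volume.restrict Ω,
      |ρ s x| ≤ (eLpNorm (ρ s) ∞ (volume.restrict Ω)).toReal := fun s hs =>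
    MHD.ae_abs_le_toReal_eLpNorm_top ((hbound s hs).trans_lt ENNReal.ofReal_lt_top).ne
  rcases ht.eq_or_lt with rfl | htpos
  · obtain ⟨q, ρt, ut, Ht, mt, hs⟩ := hsol 1 one_pos
    rw [MHD.infOver_congr hs.rho_init, hvac]
  obtain ⟨q, ρt, ut, Ht, mt, hs⟩ := hsol t htpos
  have h0I : (0 : ℝ) ∈ Icc 0 t := left_mem_Icc.2 ht
  have htI : t ∈ Icc 0 t := right_mem_Icc.2 ht
  refine le_antisymm (not_lt.1 fun hc => ?_)
    (MHD.le_infOver hΩ.isOpen hne (hbd t ht) (hs.rho_nonneg t htI))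
  obtain ⟨K, hK⟩ := hs.exists_integral_negPow_le hΩ htpos
  have hlow := MHD.ae_le_of_integral_negPow_le hΩ.isBounded.measure_lt_top.ne
    (hs.rho_cont.1 0 h0I).1.aestronglyMeasurable (hs.rho_cont.1 t htI).1.aestronglyMeasurable
    (hs.rho_nonneg 0 h0I) hc (MHD.ae_infOver_le (hs.rho_nonneg t htI)) hK
  have h := MHD.le_infOver hΩ.isOpen hne (hbd 0 le_rfl) hlow
  rw [MHD.infOver_congr hs.rho_init, hvac] at h
  exact absurd h (not_le.2 (div_pos (mul_pos hc (Real.exp_pos _)) two_pos))
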